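/- **Theorem 2 (running time of GraphDPD).** *Input.* A keyword co-occurrence graph $\mathbb G=(\mathbb V,\mathbb E)$ (a simple undirected graph on $\mathbb V=\{1,\dots,n\}$, $n\ge 1$, given by its edge list), daily frequencies $a^t(v),b^t(v)\in\mathbb N$ of every keyword $v$ on the days $t=1,\dots,T$ ($T\ge1$, the maximal window size), and expected frequencies $\lambda_a(v),\lambda_b(v)>0$. For a window $R=\{i,\dots,j\}$ let $\mathcal P_v=\sum_{t\in R}a^t(v)$, $\mathcal Q_v=\sum_{t\in R}b^t(v)$ and, for $x\in[0,1]^n$, $$\hat F(x,R)=\mathcal P^{\mathsf T}x\log\frac{\mathcal P^{\mathsf T}x}{|R|\lambda_a^{\mathsf T}x}+|R|\lambda_a^{\mathsf T}x-\mathcal P^{\mathsf T}x+\mathcal Q^{\mathsf T}x\log\frac{\mathcal Q^{\mathsf T}x}{|R|\lambda_b^{\mathsf T}x}+|R|\lambda_b^{\mathsf T}x-\mathcal Q^{\mathsf T}x ,$$ and $F(S,R)=\hat F(\mathbf 1_S,R)$. *Relaxed-GraphMP* for the window $R$ starts from an initial vector $x^0$ and repeats, at most $t$ times ($t\ge1$),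 until a halting condition (a test of the iteration counter, of $\|x^{i+1}-x^i\|^2$ and of the values $\hat F(x^i,R),\hat F(x^{i+1},R)$) holds: (1) compute $\mathcal P,\mathcal Q$ and the gradient $\nabla\hat F(x^i,R)$; (2) $g\leftarrow\mathrm{Head}(\nabla\hat F(x^i,R),\mathbb G)$; (3) $\Omega\leftarrow\mathrm{supp}(g)\cup\mathrm{supp}(x^i)$; (4) $b\leftarrow$ the result of $l$ steps of projected gradient ascent for $\hat F(\cdot,R)$ over $\{x\in[0,1]^n:\mathrm{supp}(x)\subseteq\Omega\}$; (5) $x^{i+1}\leftarrow\mathrm{Tail}(b,\mathbb G)$. It returns $S=\mathrm{supp}(x)$ of the last iterate $x$. Head and Tail are the head and tail projections of Hegde, Indyk and Schmidt onto vectors whose support is connected and of bounded size: a bisection over the ratio of edge costs to prizes, with one run of the near-linear Goemans–Williamson prize-collecting Steiner tree algorithm (moat growing with dynamic edge splitting) per round; the prizes, which are the squared entries of the projected vector, are held in fixed-point precision with a resolution of $n^{-q}$ relative to the largest one, that is, with $O(\log n)$ bits. *GraphDPD* runs Relaxed-GraphMP on all windows $R=\{i,\dots,j\}$, $1\le i<j\le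 T$, computes an empirical p-value of the resulting pair $(S,R)$ by a randomization test with $N$ replicas of the data set (Relaxed-GraphMP is run on every replica in the window $R$, and its score there is compared with $F(S,R)$), and returns the pairs whose p-value is at most the significance level $\alpha$. *Claim.* For all fixed $N$ and $q$ there is a constant $C>0$ such that for every input, every choice of the remaining parameters (initial vector, halting condition, step size, size bound of the projections, $\alpha$, $t$, $l$) and every outcome of the random draws, GraphDPD terminates after at most $$C\cdot T^2\cdot t\cdot\bigl(nT+nl+|\mathbb E|\log^3 n\bigr)$$ elementary steps of a unit-cost random access machine over the reals (with $\log$ and rounding as elementary operations). That is, it runs in $O(T^2\cdot t\,(nT+nl+|\mathbb E|\log^3 n))$ time. -/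

import Mathlib

/-!
# Cost model

A computation returns a value together with the number of elementary steps it used, and it may
diverge.  The machine is the unit-cost random access machine with real and integer registers:
one `step` evaluates an expression made of a bounded number of elementary operations (arithmetic,
comparison, logarithm, rounding, one access to an array or record, cons / head / tail of a list).
Every pass of a loop costs one step in addition to the steps of its body.  Arrays are functions on
their index set, written by `Function.update`; they are used in a single-threaded way.
-/

namespace GraphDPD

noncomputable section

/-- A possibly diverging computation, with the number of steps it performs. -/
def Comp (α : Type) : Type := Part (α × ℕ)

/-- Sequential composition adds the costs. -/
instance : Monad Comp where
  pure a := Part.some (a, 0)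
  bind x f := Part.bind x fun p => Part.map (fun q => (q.1, p.2 + q.2)) (f p.1)

/-- One elementary step. -/
def step {α : Type} (a : α) : Comp α := Part.some (a, 1)

/-- `prog.RunsWithin c`: the computation terminates after at most `c` steps. -/
def Comp.RunsWithin {α : Type} (prog : Comp α) (c : ℝ) : Prop :=
  ∃ a : α, ∃ k : ℕ, (a, k) ∈ (show Part (α × ℕ) from prog) ∧ (k : ℝ) ≤ c

/-- Unbounded loop: run `body` until it returns `Sum.inl`. The counter carries the steps so far. -/
def loop {σ β : Type} (body : σ → Comp (β ⊕ σ)) (s : σ) : Comp β :=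
  PFun.fix (α := σ × ℕ) (β := β × ℕ)
    (fun p => Part.map
      (fun q : (β ⊕ σ) × ℕ =>
        Sum.map (fun b => (b, p.2 + q.2 + 1)) (fun s' => (s', p.2 + q.2 + 1)) q.1)
      (body p.1)) (s, 0)

/-- Bounded loop over the entries of a list, updating a state. -/
def fold {α σ : Type} (f : σ → α → Comp σ) : σ → List α → Comp σ
  | s, [] => step s
  | s, x :: xs => do
      let s ← step s
      let s ← f s x
      fold f s xs

/-- Fill an array, entry by entry. -/
def tabulate {n : ℕ} {β : Type} (dflt : β) (f : Fin n → Comp β) : Comp (Fin n → β) :=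
  fold (fun (g : Fin n → β) v => do
    let y ← f v
    step (Function.update g v y)) (fun _ => dflt) (List.finRange n)

/-- A blank array of which only the entries listed in `dom` are initialised (and ever used). -/
def alloc {n : ℕ} {β : Type} (dom : List (Fin n)) (dflt : β) : Comp (Fin n → β) :=
  fold (fun (g : Fin n → β) v => step (Function.update g v dflt)) (fun _ => dflt) dom

/-! # Meldable heaps (leftist heaps whose keys can be shifted lazily) -/

/-- `off` is a shift that is still to be applied to both children. -/
inductive Heap (α : Type) : Type
  | nil : Heap α
  | node (rank : ℕ) (key : ℤ) (val : α) (off : ℤ) (left right : Heap α) : Heap α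

namespace Heap

variable {α : Type}

def size : Heap α → ℕ
  | nil => 0
  | node _ _ _ _ l r => size l + size r + 1

def rank : Heap α → ℕ
  | nil => 0
  | node rk _ _ _ _ _ => rk

/-- Add `d` to all keys. -/
def shift (d : ℤ) : Heap α → Heap α
  | nil => nil
  | node rk k v o l r => node rk (k + d) v (o + d) l r

theorem size_shift (d : ℤ) (h : Heap α) : (shift d h).size = h.size := by
  cases h <;> rfl

/-- The smallest key, or `dflt` if that is smaller. -/
def minKey (dflt : ℤ) : Heap α → ℤ
  | nil => dflt
  | node _ k _ _ _ _ => min dflt k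

/-- A node with the child of larger rank on the left. -/
def make (k : ℤ) (v : α) (o : ℤ) (a b : Heap α) : Heap α :=
  if b.rank ≤ a.rank then node (b.rank + 1) k v o a b else node (a.rank + 1) k v o b a

def meld : Heap α → Heap α → Comp (Heap α)
  | nil, b => step b
  | node rk k v o l r, nil => step (node rk k v o l r)
  | node rk₁ k₁ v₁ o₁ l₁ r₁, node rk₂ k₂ v₂ o₂ l₂ r₂ =>
      if k₁ ≤ k₂ then do
        let c ← meld r₁ (shift (-o₁) (node rk₂ k₂ v₂ o₂ l₂ r₂))
        step (make k₁ v₁ o₁ l₁ c)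
      else do
        let c ← meld r₂ (shift (-o₂) (node rk₁ k₁ v₁ o₁ l₁ r₁))
        step (make k₂ v₂ o₂ l₂ c)
  termination_by a b => a.size + b.size
  decreasing_by
    all_goals simp only [size_shift, size]
    all_goals omega

def push (k : ℤ) (v : α) (h : Heap α) : Comp (Heap α) :=
  meld (node 1 k v 0 nil nil) h

/-- Remove the entry with the smallest key. -/
def pop : Heap α → Comp (Option (ℤ × α × Heap α))
  | nil => step none
  | node _ k v o l r => do
      let h ← meld (shift o l) (shift o r)
      step (some (k, v, h))

end Heap

/-!
# Prize-collecting Steiner trees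

The Goemans–Williamson moat growing scheme for the (unrooted) prize-collecting Steiner tree problem
with integer prizes `p v` and a common integer edge cost `cost`, in the near-linear version with
dynamic edge splitting: each endpoint of an edge owns a part of the remaining slack; when a part is
used up, the slack is split again in two halves, and the edge is tight once its slack is at most
one unit.
-/

/-- A part of an edge, stored in the heap of the cluster containing its endpoint: the index of the
edge, its endpoints, and the version of the split. An entry of an older version is void. -/
structure Piece (n : ℕ) where
  edge : ℕ
  u : Fin n
  v : Fin n
  ver : ℕ

/-- State of the moat growing. Clusters are named by one of their vertices (`label`). Every cluster
has its own clock, which runs only while the cluster is active; `clock r` is its value at the global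
time `start r`, and the cluster dies when its clock reaches `death r`. The moat around the vertex
`u` has width `base u` plus the clock of the cluster of `u`. The keys of `parts r` refer to the
clock of `r`, those of `queue` to the global time. An entry of `queue` is void unless it carries
the current `stamp` of its cluster. -/
structure Moat (n : ℕ) where
  now : ℤ
  label : Fin n → Fin n
  members : Fin n → List (Fin n)
  size : Fin n → ℕ
  base : Fin n → ℤ
  active : Fin n → Bool
  clock : Fin n → ℤ
  start : Fin n → ℤ
  death : Fin n → ℤ
  parts : Fin n → Heap (Piece n)
  stamp : Fin n → ℕ
  ver : ℕ → ℕ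
  queue : Heap (Fin n × ℕ)
  alive : ℕ
  forest : List (Fin n × Fin n)

namespace Moat

variable {n : ℕ}

/-- The present value of the clock of a cluster. -/
def time (s : Moat n) (r : Fin n) : ℤ :=
  if s.active r then s.clock r + (s.now - s.start r) else s.clock r

/-- The width of the moats around `u`. -/
def width (s : Moat n) (u : Fin n) : ℤ := s.base u + s.time (s.label u)

/-- What is left of the cost of an edge. -/
def slack (cost : ℕ) (s : Moat n) (u v : Fin n) : ℤ := cost - s.width u - s.width v

/-- Announce the next event of the cluster `r` in the global queue. -/
def schedule (s : Moat n) (r : Fin n) : Comp (Moat n) :=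
  if s.active r then do
    let key ← step (s.start r + ((s.parts r).minKey (s.death r) - s.clock r))
    let q ← s.queue.push key (r, s.stamp r + 1)
    step { s with queue := q, stamp := Function.update s.stamp r (s.stamp r + 1) }
  else step s

/-- Give the edge part `e` at the endpoint `u` the further allowance `h`. -/
def addPart (s : Moat n) (e : Piece n) (u : Fin n) (h : ℤ) : Comp (Moat n) := do
  let r ← step (s.label u)
  let hp ← (s.parts r).push (s.time r + h) e
  step { s with parts := Function.update s.parts r hp }

/-- Split the slack `sl` of an edge into two halves. -/
def split (s : Moat n) (e : Piece n) (sl : ℤ) : Comp (Moat n) := do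
  let e' ← step { e with ver := s.ver e.edge + 1 }
  let s ← step { s with ver := Function.update s.ver e.edge (s.ver e.edge + 1) }
  let s ← s.addPart e' e.u (sl / 2)
  let s ← s.addPart e' e.v (sl / 2)
  let s ← s.schedule (s.label e.u)
  s.schedule (s.label e.v)

/-- Merge the cluster `a` into the cluster `b`: the vertices of `a` are relabelled, and the keys of
its edge parts are translated to the clock of `b`. -/
def absorb (s : Moat n) (a b : Fin n) : Comp (Moat n) := do
  let d ← step (s.time b - s.time a)
  let left ← step ((s.death a - s.time a) + (s.death b - s.time b))
  let alive ← step (if s.active a && s.active b then s.alive - 1 else s.alive)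
  let hp ← Heap.meld ((s.parts a).shift d) (s.parts b)
  let s' ← fold (fun (s : Moat n) v => step
      { s with
        label := Function.update s.label v b
        base := Function.update s.base v (s.base v - d)
        members := Function.update s.members b (v :: s.members b) }) s (s.members a)
  step
    { s' with
      size := Function.update s.size b (s.size a + s.size b)
      clock := Function.update s.clock b (s.time b)
      start := Function.update s.start b s.now
      death := Function.update s.death b (s.time b + left)
      active := Function.update (Function.update s.active b (decide (0 < left))) a false
      parts := Function.update s.parts b hp
      stamp := Function.update s.stamp a (s.stamp a + 1)
      alive := alive }

/-- The edge `u v` is tight: it joins the forest, and the smaller of the two clusters is merged into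
the larger one. -/
def link (s : Moat n) (u v : Fin n) : Comp (Moat n) := do
  let a ← step (s.label u)
  let b ← step (s.label v)
  let s ← step { s with forest := (u, v) :: s.forest }
  if s.size a ≤ s.size b then do
    let s ← s.absorb a b
    s.schedule b
  else do
    let s ← s.absorb b a
    s.schedule a

/-- The prize of the cluster `r` is used up. -/
def kill (s : Moat n) (r : Fin n) : Comp (Moat n) :=
  step
    { s with
      clock := Function.update s.clock r (s.time r)
      active := Function.update s.active r false
      alive := s.alive - 1
      stamp := Function.update s.stamp r (s.stamp r + 1) }

/-- The event of an edge part that was stored in the cluster `r`. -/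
def edgeEvent (cost : ℕ) (s : Moat n) (r : Fin n) (e : Piece n) : Comp (Moat n) := do
  let void ← step (decide (e.ver ≠ s.ver e.edge ∨ s.label e.u = s.label e.v))
  if void then s.schedule r
  else do
    let sl ← step (s.slack cost e.u e.v)
    if sl ≤ 1 then s.link e.u e.v else s.split e sl

/-- Process the next event; stop when at most one cluster is active. -/
def event (cost : ℕ) (s : Moat n) : Comp (Moat n ⊕ Moat n) := do
  let fin ← step (decide (s.alive ≤ 1))
  if fin then pure (Sum.inl s)
  else do
    match ← s.queue.pop with
    | none => pure (Sum.inl s)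
    | some (key, (r, st), q) => do
      let s ← step { s with queue := q }
      let void ← step (decide (st ≠ s.stamp r) || !s.active r)
      if void then pure (Sum.inr s)
      else do
        let s ← step { s with now := max s.now key }
        let dead ← step (decide (s.death r ≤ s.time r))
        if dead then do
          let s ← s.kill r
          pure (Sum.inr s)
        else do
          match ← (s.parts r).pop with
          | none => do
            let s ← s.kill r
            pure (Sum.inr s)
          | some (_, e, hp) => do
            let s ← step { s with parts := Function.update s.parts r hp }
            let s ← edgeEvent cost s r e
            pure (Sum.inr s)

/-- Every vertex in `dom` is a cluster of its own. -/
def init (dom : List (Fin n)) (edges : List (Fin n × Fin n)) (p : Fin n → ℕ) (cost : ℕ) :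
    Comp (Moat n) := do
  let label ← fold (fun (g : Fin n → Fin n) v => step (Function.update g v v)) id dom
  let members ← fold (fun (g : Fin n → List (Fin n)) v => step (Function.update g v [v]))
    (fun _ => []) dom
  let size ← alloc dom 1
  let base ← alloc dom 0
  let active ← fold (fun (g : Fin n → Bool) v => step (Function.update g v (decide (0 < p v))))
    (fun _ => false) dom
  let clock ← alloc dom 0
  let start ← alloc dom 0
  let death ← fold (fun (g : Fin n → ℤ) v => step (Function.update g v (p v))) (fun _ => 0) dom
  let parts ← alloc dom Heap.nil
  let stamp ← alloc dom 0
  let alive ← fold (fun (k : ℕ) v => step (if 0 < p v then k + 1 else k)) 0 dom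
  let s ← step
    { now := 0, label, members, size, base, active, clock, start, death, parts, stamp
      ver := fun _ => 0, queue := Heap.nil, alive, forest := [] }
  let (s, _) ← fold (fun (x : Moat n × ℕ) (uv : Fin n × Fin n) => do
      let e ← step { edge := x.2, u := uv.1, v := uv.2, ver := 0 }
      let s ← step { x.1 with ver := Function.update x.1.ver x.2 0 }
      let s ← s.addPart e uv.1 (cost / 2)
      let s ← s.addPart e uv.2 (cost / 2)
      step (s, x.2 + 1)) (s, 0) edges
  fold (fun (s : Moat n) v => s.schedule v) s dom

end Moat

/-- A rooted tree: its vertices with their parents, every parent before its children. -/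
abbrev Tree (n : ℕ) := List (Fin n × Option (Fin n))

variable {n : ℕ}

/-- Depth-first traversal of a forest; the vertices and their parents in reverse preorder. -/
def traverse (dom : List (Fin n)) (forest : List (Fin n × Fin n)) : Comp (Tree n) := do
  let adj ← alloc dom ([] : List (Fin n))
  let adj ← fold (fun (g : Fin n → List (Fin n)) (uv : Fin n × Fin n) => do
      let g ← step (Function.update g uv.1 (uv.2 :: g uv.1))
      step (Function.update g uv.2 (uv.1 :: g uv.2))) adj forest
  let seen ← alloc dom false
  let stack ← fold (fun (st : Tree n) v => step ((v, none) :: st)) [] dom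
  loop (fun (x : Tree n × (Fin n → Bool) × Tree n) => do
      match x with
      | ([], _, order) => step (Sum.inl order)
      | ((v, par) :: st, seen, order) =>
        let old ← step (seen v)
        if old then pure (Sum.inr (st, seen, order))
        else do
          let st ← fold (fun (st : Tree n) w => step ((w, some v) :: st)) st (adj v)
          step (Sum.inr (st, Function.update seen v true, (v, par) :: order)))
    (stack, seen, [])

/-- Strong pruning: the subtree `F` of the forest of least `c(F) + 2 p(V \ F)`. Bottom up, a branch
is kept if its doubled net prize exceeds the cost of the edge to its parent. -/
def prune (dom : List (Fin n)) (p : Fin n → ℕ) (cost : ℕ) (forest : List (Fin n × Fin n)) :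
    Comp (Tree n) := do
  let order ← traverse dom forest
  let worth ← fold (fun (g : Fin n → ℕ) v => step (Function.update g v (2 * p v)))
    (fun _ => 0) dom
  let keep ← alloc dom false
  let (_, keep, best) ← fold
    (fun (x : (Fin n → ℕ) × (Fin n → Bool) × Option (Fin n × ℕ)) vp => do
      let (worth, keep, best) := x
      let best ← step (match best with
        | none => some (vp.1, worth vp.1)
        | some (u, w) => if w < worth vp.1 then some (vp.1, worth vp.1) else some (u, w))
      match vp.2 with
      | none => step (worth, keep, best)
      | some u =>
        if cost < worth vp.1 then
          step (Function.update worth u (worth u + (worth vp.1 - cost)),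
            Function.update keep vp.1 true, best)
        else step (worth, keep, best))
    (worth, keep, none) order
  match best with
  | none => step []
  | some (root, _) => do
    let pre ← fold (fun (l : Tree n) vp => step (vp :: l)) [] order
    let inside ← alloc dom false
    let (_, tree) ← fold
      (fun (x : (Fin n → Bool) × Tree n) vp => do
        let (inside, tree) := x
        if vp.1 = root then
          step (Function.update inside vp.1 true, (vp.1, none) :: tree)
        else
          match vp.2 with
          | none => step (inside, tree)
          | some u =>
            if inside u && keep vp.1 then
              step (Function.update inside vp.1 true, vp :: tree)
            else step (inside, tree))
      (inside, []) pre
    fold (fun (l : Tree n) vp => step (vp :: l)) [] tree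

/-- The prize-collecting Steiner tree algorithm. -/
def pcst (dom : List (Fin n)) (edges : List (Fin n × Fin n)) (p : Fin n → ℕ) (cost : ℕ) :
    Comp (Tree n) := do
  let s ← Moat.init dom edges p cost
  let s ← loop (Moat.event cost) s
  prune dom p cost s.forest

/-- Number of edges of a tree. -/
def treeCost (F : Tree n) : Comp ℕ := do
  let k ← fold (fun (k : ℕ) _ => step (k + 1)) 0 F
  step (k - 1)

/-- Sum of the prizes over a list of vertices. -/
def prize (p : Fin n → ℕ) (l : List (Fin n)) : Comp ℕ :=
  fold (fun (k : ℕ) v => step (k + p v)) 0 l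

/-- The vertices of a tree. -/
def vertices (F : Tree n) : Comp (List (Fin n)) :=
  fold (fun (l : List (Fin n)) vp => step (vp.1 :: l)) [] F

/-!
# Head and tail projections

The projections of Hegde, Indyk and Schmidt for connected sets of at most `k + 1` vertices (trees
with at most `k` edges): bisection over the ratio of edge cost and prizes, with a prize-collecting
Steiner tree computation in every round. The prizes are the squared entries of the projected vector,
held in fixed-point precision with `O(log n)` bits.
-/

/-- The endpoints of the edges. -/
def support (n : ℕ) (edges : List (Fin n × Fin n)) : Comp (List (Fin n)) := do
  let mark ← tabulate false (fun _ : Fin n => step false)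
  let mark ← fold (fun (g : Fin n → Bool) (uv : Fin n × Fin n) => do
      let g ← step (Function.update g uv.1 true)
      step (Function.update g uv.2 true)) mark edges
  fold (fun (l : List (Fin n)) v => step (if mark v then v :: l else l)) [] (List.finRange n)

/-- The prizes `z v ^ 2` in units of `max z ^ 2 / n ^ q`, multiplied by `n ^ 2` so that the
bisection below can run over integers. -/
def quantize (q : ℕ) (z : Fin n → ℝ) : Comp (Fin n → ℕ) := do
  let top ← fold (fun (m : ℝ) v => step (max m (z v ^ 2))) 0 (List.finRange n)
  let scale ← step (n ^ q : ℕ)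
  tabulate 0 (fun v => step (n ^ 2 * ⌊(scale : ℝ) * (z v ^ 2 / top)⌋₊))

/-- Total prize and least positive prize (`0` if there is none). -/
def prizeRange (dom : List (Fin n)) (p : Fin n → ℕ) : Comp (ℕ × ℕ) :=
  fold (fun (x : ℕ × ℕ) v => step
    (x.1 + p v, if 0 < p v ∧ (x.2 = 0 ∨ p v < x.2) then p v else x.2)) (0, 0) dom

/-- Euler tour of a tree; the flag marks the first visit of a vertex. -/
def eulerTour (dom : List (Fin n)) (F : Tree n) : Comp (List (Fin n × Bool)) := do
  let child ← alloc dom ([] : List (Fin n))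
  let (child, roots) ← fold
    (fun (x : (Fin n → List (Fin n)) × List (Fin n × Bool)) (vp : Fin n × Option (Fin n)) =>
      match vp.2 with
      | none => step (x.1, (vp.1, true) :: x.2)
      | some u => step (Function.update x.1 u (vp.1 :: x.1 u), x.2)) (child, []) F
  loop (fun (x : List (Fin n × Bool) × List (Fin n × Bool)) => do
      match x with
      | ([], tour) => step (Sum.inl tour)
      | ((v, first) :: st, tour) =>
        let tour ← step ((v, first) :: tour)
        if first then do
          let st ← fold (fun (st : List (Fin n × Bool)) c => step ((c, true) :: (v, false) :: st))
            st (child v)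
          pure (Sum.inr (st, tour))
        else pure (Sum.inr (st, tour)))
    (roots, [])

/-- Cut the Euler tour of a tree into pieces with at most `k` edges, and return the piece that
collects the largest prize. -/
def pruneTree (dom : List (Fin n)) (p : Fin n → ℕ) (k : ℕ) (F : Tree n) : Comp (List (Fin n)) := do
  let c ← treeCost F
  if c ≤ k then vertices F
  else do
    let tour ← eulerTour dom F
    let (cur, _, val, best, bestVal) ← fold
      (fun (x : List (Fin n) × ℕ × ℕ × List (Fin n) × ℕ) (vf : Fin n × Bool) => do
        let (cur, len, val, best, bestVal) := x
        let gain ← step (if vf.2 then p vf.1 else 0)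
        if len ≤ k then step (vf.1 :: cur, len + 1, val + gain, best, bestVal)
        else if bestVal < val then step ([vf.1], 1, gain, cur, val)
        else step ([vf.1], 1, gain, best, bestVal))
      ([], 0, 0, [], 0) tour
    step (if bestVal < val then cur else best)

/-- The better one of a connected set and the best single vertex. -/
def orSingle (p : Fin n → ℕ) (l : List (Fin n)) : Comp (List (Fin n)) := do
  let best ← fold (fun (x : Option (Fin n)) v => step (match x with
    | none => some v
    | some u => if p u < p v then some v else some u)) none (List.finRange n)
  let val ← prize p l
  match best with
  | none => step l
  | some v => step (if val < p v then [v] else l)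

/-- Head projection: a connected set of bounded size that carries much of the prize. The bisection
keeps `lo < hi`, where the tree for the edge cost `lo` has more than `2 k` edges, and the tree for
`hi` has not. -/
def headSet (edges : List (Fin n × Fin n)) (k : ℕ) (p : Fin n → ℕ) : Comp (List (Fin n)) := do
  let dom ← support n edges
  let (total, least) ← prizeRange dom p
  let lo ← step (least / (2 * k))
  let F ← pcst dom edges p lo
  let c ← treeCost F
  if c ≤ 2 * k then do
    let S ← vertices F
    orSingle p S
  else do
    let (lo, hi) ← loop (fun (x : ℕ × ℕ) => do
        let (lo, hi) := x
        if hi ≤ lo + 1 then step (Sum.inl (lo, hi))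
        else do
          let mid ← step ((lo + hi) / 2)
          let F ← pcst dom edges p mid
          let c ← treeCost F
          if 2 * k < c then step (Sum.inr (mid, hi)) else step (Sum.inr (lo, mid)))
      (lo, 4 * total)
    let Fl ← pcst dom edges p lo
    let Fr ← pcst dom edges p hi
    let Sl ← pruneTree dom p k Fl
    let Sr ← vertices Fr
    let vl ← prize p Sl
    let vr ← prize p Sr
    orSingle p (if vr ≤ vl then Sl else Sr)

/-- Tail projection: a connected set of bounded size that misses little of the prize. The tree for
the edge cost `lo` has more than `3 k` edges, the tree for `hi` has fewer than `2 k`. -/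
def tailSet (edges : List (Fin n × Fin n)) (k : ℕ) (p : Fin n → ℕ) : Comp (List (Fin n)) := do
  let dom ← support n edges
  let (total, least) ← prizeRange dom p
  let all ← prize p (List.finRange n)
  let lo ← step (least / (2 * k))
  let F ← pcst dom edges p lo
  let c ← treeCost F
  let S ← vertices F
  let got ← prize p S
  if c ≤ 2 * k ∧ got = all then step S
  else do
    let S ← loop (fun (x : ℕ × ℕ) => do
        let (lo, hi) := x
        if hi ≤ lo + 1 then do
          let F ← pcst dom edges p hi
          let S ← vertices F
          step (Sum.inl S)
        else do
          let mid ← step ((lo + hi) / 2)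
          let F ← pcst dom edges p mid
          let c ← treeCost F
          if 2 * k ≤ c ∧ c ≤ 3 * k then do
            let S ← vertices F
            step (Sum.inl S)
          else if 3 * k < c then step (Sum.inr (mid, hi))
          else step (Sum.inr (lo, mid)))
      (0, 3 * total)
    orSingle p S

/-- Restrict a vector to a set of coordinates. -/
def restrict (z : Fin n → ℝ) (S : List (Fin n)) : Comp (Fin n → ℝ) := do
  let g ← tabulate 0 (fun _ : Fin n => step (0 : ℝ))
  fold (fun (g : Fin n → ℝ) v => step (Function.update g v (z v))) g S

def head (q k : ℕ) (edges : List (Fin n × Fin n)) (z : Fin n → ℝ) : Comp (Fin n → ℝ) := do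
  let p ← quantize q z
  let S ← headSet edges k p
  restrict z S

def tail (q k : ℕ) (edges : List (Fin n × Fin n)) (b : Fin n → ℝ) : Comp (Fin n → ℝ) := do
  let p ← quantize q b
  let S ← tailSet edges k p
  restrict b S

/-! # The likelihood ratio statistic and its relaxation -/

/-- A keyword co-occurrence graph on `n` keywords, given by the list of its edges, with the daily
frequencies `a t v`, `b t v` on the days `t = 1, …, T` and their expectations. -/
structure Instance (n T : ℕ) where
  graph : SimpleGraph (Fin n)
  edges : List (Fin n × Fin n)
  nodup : edges.Nodup
  mem_edges : ∀ u v, (u, v) ∈ edges ↔ u < v ∧ graph.Adj u v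
  a : ℕ → Fin n → ℕ
  b : ℕ → Fin n → ℕ
  lamA : Fin n → ℝ
  lamB : Fin n → ℝ
  lamA_pos : ∀ v, 0 < lamA v
  lamB_pos : ∀ v, 0 < lamB v

/-- A time window `{first, …, last}`. -/
structure Window where
  first : ℕ
  last : ℕ

namespace Window

/-- The days of the window. -/
def days (R : Window) : List ℕ := List.range' R.first (R.last + 1 - R.first)

/-- The number of days. -/
def card (R : Window) : ℕ := R.last + 1 - R.first

end Window

def dot (x y : Fin n → ℝ) : Comp ℝ :=
  fold (fun (s : ℝ) v => step (s + x v * y v)) 0 (List.finRange n)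

/-- The frequencies of the keywords, summed over the window. -/
def windowSum (c : ℕ → Fin n → ℕ) (R : Window) : Comp (Fin n → ℝ) :=
  tabulate 0 (fun v => fold (fun (s : ℝ) t => step (s + c t v)) 0 R.days)

/-- One half of the relaxed statistic as a function of `c = Pᵀ x` and `m = |R| Λᵀ x`. -/
def halfStat (c m : ℝ) : ℝ := c * Real.log (c / m) + m - c

/-- The relaxed statistic at `x`, given the vectors `P` and `Q` of the window. -/
def relaxedStat {T : ℕ} (I : Instance n T) (R : Window) (P Q x : Fin n → ℝ) : Comp ℝ := do
  let pa ← dot P x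
  let la ← dot I.lamA x
  let pb ← dot Q x
  let lb ← dot I.lamB x
  step (halfStat pa (R.card * la) + halfStat pb (R.card * lb))

/-- The gradient of the relaxed statistic at `x`, given the vectors `P` and `Q` of the window. -/
def gradient {T : ℕ} (I : Instance n T) (R : Window) (P Q x : Fin n → ℝ) :
    Comp (Fin n → ℝ) := do
  let pa ← dot P x
  let la ← dot I.lamA x
  let pb ← dot Q x
  let lb ← dot I.lamB x
  let ca ← step (Real.log (pa / (R.card * la)))
  let da ← step (R.card - pa / la)
  let cb ← step (Real.log (pb / (R.card * lb)))
  let db ← step (R.card - pb / lb)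
  tabulate 0 (fun v => step (ca * P v + da * I.lamA v + cb * Q v + db * I.lamB v))

/-- The statistic `F(S, R)` of a set `S` of keywords. -/
def score {T : ℕ} (I : Instance n T) (R : Window) (S : Fin n → Bool) : Comp ℝ := do
  let P ← windowSum I.a R
  let Q ← windowSum I.b R
  let x ← tabulate 0 (fun v => step (if S v then (1 : ℝ) else 0))
  relaxedStat I R P Q x

/-! # Relaxed-GraphMP and GraphDPD -/

/-- The parameters left open by the pseudocode. -/
structure Settings (n : ℕ) where
  /-- cap on the number of iterations of Relaxed-GraphMP -/
  t : ℕ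
  /-- number of iterations of the gradient ascent -/
  l : ℕ
  /-- bound on the number of edges of a tree in the head and tail projections -/
  k : ℕ
  /-- step size of the gradient ascent -/
  eta : ℝ
  /-- initial vector -/
  x₀ : Fin n → ℝ
  /-- halting condition: a test of the number of iterations done, the squared distance of the last
  two iterates, and the values of the relaxed statistic there -/
  halt : ℕ → ℝ → ℝ → ℝ → Bool
  /-- significance level -/
  alpha : ℝ

/-- Projected gradient ascent for the relaxed statistic over the vectors in `[0,1]ⁿ` with support
in `Om`, with `m` iterations. -/
def ascent {T : ℕ} (I : Instance n T) (R : Window) (P Q : Fin n → ℝ) (eta : ℝ)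
    (Om : Fin n → Bool) : ℕ → (Fin n → ℝ) → Comp (Fin n → ℝ)
  | 0, x => step x
  | m + 1, x => do
    let d ← gradient I R P Q x
    let x ← tabulate 0 (fun v => step (if Om v then max 0 (min 1 (x v + eta * d v)) else 0))
    ascent I R P Q eta Om m x

/-- One iteration of Relaxed-GraphMP: gradient, head projection, union of the supports, gradient
ascent, tail projection, halting condition. -/
def iteration {T : ℕ} (q : ℕ) (I : Instance n T) (s : Settings n) (R : Window) (i : ℕ)
    (x : Fin n → ℝ) : Comp ((Fin n → ℝ) × Bool) := do
  let P ← windowSum I.a R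
  let Q ← windowSum I.b R
  let d ← gradient I R P Q x
  let g ← head q s.k I.edges d
  let Om ← tabulate false (fun v => step (decide (g v ≠ 0) || decide (x v ≠ 0)))
  let y ← tabulate 0 (fun v => step (max 0 (min 1 (x v))))
  let b ← ascent I R P Q s.eta Om s.l y
  let x' ← tail q s.k I.edges b
  let dist ← fold (fun (r : ℝ) v => step (r + (x' v - x v) ^ 2)) 0 (List.finRange n)
  let f ← relaxedStat I R P Q x
  let f' ← relaxedStat I R P Q x'
  step (x', s.halt (i + 1) dist f f')

/-- Iterate until the halting condition holds, but at most `m` times. -/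
def iterate {T : ℕ} (q : ℕ) (I : Instance n T) (s : Settings n) (R : Window) :
    ℕ → ℕ → (Fin n → ℝ) → Comp (Fin n → ℝ)
  | 0, _, x => step x
  | m + 1, i, x => do
    let (x, halted) ← iteration q I s R i x
    if halted then step x else iterate q I s R m (i + 1) x

/-- Relaxed-GraphMP: the support of the last iterate. -/
def relaxedGraphMP {T : ℕ} (q : ℕ) (I : Instance n T) (s : Settings n) (R : Window) :
    Comp (Fin n → Bool) := do
  let x ← iterate q I s R s.t 0 s.x₀
  tabulate false (fun v => step (decide (x v ≠ 0)))

/-- A replica of the data set with the frequencies `ω t v`, which are copied day by day. -/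
def replica {T : ℕ} (I : Instance n T) (ω : ℕ → Fin n → ℕ × ℕ) : Comp (Instance n T) := do
  let (a, b) ← fold (fun (x : (ℕ → Fin n → ℕ) × (ℕ → Fin n → ℕ)) t => do
      let at' ← tabulate 0 (fun v => step (ω t v).1)
      let bt' ← tabulate 0 (fun v => step (ω t v).2)
      step (Function.update x.1 t at', Function.update x.2 t bt'))
    (fun _ _ => 0, fun _ _ => 0) (List.range' 1 T)
  step { I with a := a, b := b }

/-- Randomization test with `N` replicas: the fraction of data sets, the observed one included, for
which the set found by Relaxed-GraphMP in the window `R` scores at least `F(S, R)`. The draws `ω j`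
of the replica `j` are the outcomes of Poisson variables under the null hypothesis. -/
def getPValue {T : ℕ} (N q : ℕ) (I : Instance n T) (s : Settings n)
    (ω : ℕ → ℕ → Fin n → ℕ × ℕ) (S : Fin n → Bool) (R : Window) : Comp ℝ := do
  let obs ← score I R S
  let c ← fold (fun (c : ℕ) j => do
      let J ← replica I (ω j)
      let S' ← relaxedGraphMP q J s R
      let f ← score J R S'
      step (if obs ≤ f then c + 1 else c)) 1 (List.range N)
  step ((c : ℝ) / (N + 1))

/-- GraphDPD: all significant clusters over all time windows. The integer `q` fixes the precision
of the projections, `N` is the number of replicas in the randomization test, and `ω i j` holds the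
random draws for the window `{i, …, j}`. -/
def graphDPD {T : ℕ} (N q : ℕ) (I : Instance n T) (s : Settings n)
    (ω : ℕ → ℕ → ℕ → ℕ → Fin n → ℕ × ℕ) : Comp (List ((Fin n → Bool) × Window)) :=
  fold (fun (O : List ((Fin n → Bool) × Window)) i =>
    fold (fun (O : List ((Fin n → Bool) × Window)) j => do
      let R ← step { first := i, last := j }
      let S ← relaxedGraphMP q I s R
      let pv ← getPValue N q I s (ω i j) S R
      if pv ≤ s.alpha then step ((S, R) :: O) else step O)
      O (List.range' (i + 1) (T - i)))
    [] (List.range' 1 T)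

end

end GraphDPD

/-! The running time is essentially a product: O(T^2) windows, N + 1 searches in each (the data and
N replicas), at most t iterations per search. An iteration spends O(nT) on window sums, O(nl) on the
gradient ascent, and runs one head and one tail projection. The substance is that a projection costs
O(n + |E| log^3 n).

Quantized prizes are integers bounded by a power of n, so all edge costs tried by the bisection are
below 2^L with L = O(log n). There are O(L) rounds (`wp_headSet`, `wp_tailSet`), which gives one
logarithm. A round is one prize-collecting Steiner tree computation on the endpoints of edges only,
at most 2|E| vertices; hence n enters linearly and outside the logarithms. A round costs O((|E| L +
1) log n) by three amortisations:

Heaps. The right spine of a leftist heap is logarithmic in its size (`Heap.two_pow_rank_le`), and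
melding walks down right spines (`Heap.wp_meld`). Every heap operation is O(log n).

Events. The potential `Moat.work` counts queue entries, stored edge parts, and three times the
splits still allowed to each edge. Every event that does not end the loop uses up at least one unit
(`Moat.wp_event`). An edge is split at most L times: when a current part of version j expires,
2^(j+1) * (slack - 1) is at most cost - 1 (`Moat.Bound`), and a split occurs only if the slack is at
least 2, so 2^(j+1) < 2^L (`Moat.wp_split`). This needs the popped part to have expired, which is
why `Moat.Inv` requires every valid announcement in the queue to be `Moat.Due` at its key.

Relabelling. The smaller cluster is merged into the larger, so the size at least doubles around each
relabelled vertex (`Moat.Inv.relabels_absorbed`).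

No approximation guarantee and no acyclicity of the forest enters. The one structural fact needed
downstream is that a returned tree lists each vertex once: it makes the Euler tour, which keeps no
marks, terminate (`wp_eulerTour`). `exists_projection_bound` then chooses L and M and collects the
constants. -/

namespace GraphDPD

/-! ### Calculus of values and step counts -/

noncomputable section

/-- The computation that returns `a` after `k` steps. -/
def ret {α : Type} (a : α) (k : ℕ) : Comp α := Part.some (a, k)

/-- The partial value of a computation. -/
def Comp.run {α : Type} (m : Comp α) : Part (α × ℕ) := m

/-- The computation terminates, and its value and its number of steps satisfy `P`. -/
def Comp.Wp {α : Type} (m : Comp α) (P : α → ℕ → Prop) : Prop :=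
  ∃ a k, (a, k) ∈ m.run ∧ P a k

namespace Comp

variable {α β σ : Type}

theorem step_eq (a : α) : step a = ret a 1 := rfl

@[simp] theorem wp_ret (a : α) (k : ℕ) (P : α → ℕ → Prop) : (ret a k).Wp P ↔ P a k := by
  unfold Wp ret
  constructor
  · rintro ⟨a', k', h, hP⟩
    obtain ⟨rfl, rfl⟩ := Prod.mk.inj (Part.mem_some_iff.1 h)
    exact hP
  · intro h
    exact ⟨a, k, Part.mem_some _, h⟩

@[simp] theorem wp_step (a : α) (P : α → ℕ → Prop) : (step a).Wp P ↔ P a 1 := wp_ret a 1 P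

@[simp] theorem wp_pure (a : α) (P : α → ℕ → Prop) : (pure a : Comp α).Wp P ↔ P a 0 :=
  wp_ret a 0 P

theorem mem_bind (m : Comp α) (f : α → Comp β) (b : β) (k : ℕ) :
    (b, k) ∈ (m >>= f : Comp β).run ↔
      ∃ a k₁ k₂, (a, k₁) ∈ m.run ∧
        (b, k₂) ∈ (f a).run ∧ k = k₁ + k₂ := by
  refine (Part.mem_bind_iff (f := m.run)
    (g := fun p => Part.map (fun q => (q.1, p.2 + q.2)) (f p.1).run)).trans ?_
  constructor
  · rintro ⟨⟨a, k₁⟩, h, h'⟩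
    obtain ⟨⟨b', k₂⟩, h₂, h₃⟩ := (Part.mem_map_iff _).1 h'
    obtain ⟨rfl, rfl⟩ := Prod.mk.inj h₃
    exact ⟨a, k₁, k₂, h, h₂, rfl⟩
  · rintro ⟨a, k₁, k₂, h, h₂, rfl⟩
    exact ⟨(a, k₁), h, (Part.mem_map_iff _).2 ⟨(b, k₂), h₂, rfl⟩⟩

-- As a simp lemma, together with `wp_step` and `wp_pure`, this executes straight-line code
-- symbolically; only folds, loops and subroutines are left for `Wp.mono`.
@[simp] theorem wp_bind (m : Comp α) (f : α → Comp β) (P : β → ℕ → Prop) :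
    (m >>= f).Wp P ↔ m.Wp fun a k => (f a).Wp fun b k' => P b (k + k') := by
  unfold Wp
  constructor
  · rintro ⟨b, k, h, hP⟩
    obtain ⟨a, k₁, k₂, h₁, h₂, rfl⟩ := (mem_bind m f b k).1 h
    exact ⟨a, k₁, h₁, b, k₂, h₂, hP⟩
  · rintro ⟨a, k₁, h₁, b, k₂, h₂, hP⟩
    exact ⟨b, k₁ + k₂, (mem_bind m f b _).2 ⟨a, k₁, k₂, h₁, h₂, rfl⟩, hP⟩

theorem Wp.mono {m : Comp α} {P Q : α → ℕ → Prop} (h : m.Wp P) (hPQ : ∀ a k, P a k → Q a k) :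
    m.Wp Q := by
  obtain ⟨a, k, hm, hP⟩ := h
  exact ⟨a, k, hm, hPQ a k hP⟩

theorem Wp.runsWithin {m : Comp α} {c : ℝ} (h : m.Wp fun _ k => (k : ℝ) ≤ c) : m.RunsWithin c := by
  obtain ⟨a, k, hm, hP⟩ := h
  exact ⟨a, k, hm, hP⟩

theorem ret_bind_ret (a : α) (k : ℕ) (f : α → Comp β) (b : β) (k' : ℕ) (h : f a = ret b k') :
    (ret a k >>= f) = ret b (k + k') := by
  change Part.bind (Part.some (a, k)) _ = _
  rw [Part.bind_some, h]
  rfl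

/-- A loop over a list whose body costs at most `b` steps and maintains an invariant. -/
theorem wp_fold_le {f : σ → α → Comp σ} (I : List α → σ → Prop) (b : ℕ)
    (hf : ∀ l x s, I (x :: l) s → (f s x).Wp fun s' k => I l s' ∧ k ≤ b) :
    ∀ (l : List α) (s : σ), I l s →
      (fold f s l).Wp fun s' k => I [] s' ∧ k ≤ (b + 1) * l.length + 1
  | [], s, h => by simpa [fold] using h
  | x :: l, s, h => by
    have ih := wp_fold_le I b hf l
    simp only [fold, wp_bind, wp_step]
    refine (hf l x s h).mono fun s' k hk => ?_
    refine (ih s' hk.1).mono fun s'' k' hk' => ⟨hk'.1, ?_⟩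
    have := hk'.2
    have := hk.2
    simp only [List.length_cons]
    nlinarith

/-- A body of constant cost makes the whole fold a single `ret`, so that its value can be studied as
a pure `List.foldl`. -/
theorem fold_ret (g : σ → α → σ) (c : ℕ) :
    ∀ (l : List α) (s : σ),
      fold (fun s x => ret (g s x) c) s l = ret (l.foldl g s) ((c + 1) * l.length + 1)
  | [], s => rfl
  | x :: l, s => by
    have ih := fold_ret g c l
    simp only [fold, step_eq]
    rw [ret_bind_ret _ _ _ (l.foldl g (g s x)) (c + ((c + 1) * l.length + 1))]
    · simp only [List.foldl_cons, List.length_cons]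
      congr 1
      ring
    · exact ret_bind_ret _ _ (fun s => fold (fun s x => ret (g s x) c) s l) _ _ (ih _)

theorem fold_step (g : σ → α → σ) (l : List α) (s : σ) :
    fold (fun s x => step (g s x)) s l = ret (l.foldl g s) (2 * l.length + 1) :=
  fold_ret g 1 l s

theorem wp_tabulate {n : ℕ} {d : β} {f : Fin n → Comp β} (P : Fin n → β → Prop) (b : ℕ)
    (hf : ∀ v, (f v).Wp fun y k => P v y ∧ k ≤ b) :
    (tabulate d f).Wp fun g k => (∀ v, P v (g v)) ∧ k ≤ (b + 2) * n + 1 := by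
  unfold tabulate
  refine (wp_fold_le (fun l (g : Fin n → β) => ∀ v, v ∈ l ∨ P v (g v)) (b + 1) ?_
    (List.finRange n) _ ?_).mono ?_
  · intro l x g hg
    simp only [wp_bind, wp_step]
    refine (hf x).mono fun y k hk => ⟨fun v => ?_, by omega⟩
    by_cases hv : v = x
    · subst hv
      simpa using Or.inr hk.1
    · have := hg v
      simp only [List.mem_cons, hv, false_or] at this
      simpa [Function.update_of_ne hv] using this
  · intro v
    exact Or.inl (List.mem_finRange v)
  · rintro g k ⟨h, hk⟩
    refine ⟨fun v => by simpa using h v, by simpa using hk⟩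

/-- The potential method: each pass is paid for, with its overhead of one step, by the drop of `Φ`.
Since every pass costs at least one, the same inequality yields termination. -/
theorem wp_loop {body : σ → Comp (β ⊕ σ)} (I : σ → Prop) (Φ : σ → ℕ) (Q : β → Prop)
    (h : ∀ s, I s → (body s).Wp fun r k => match r with
      | Sum.inl b => Q b ∧ k + 1 ≤ Φ s
      | Sum.inr s' => I s' ∧ Φ s' + k + 1 ≤ Φ s) (s : σ) (hs : I s) :
    (loop body s).Wp fun b k => Q b ∧ k ≤ Φ s := by
  -- The fixed point carries the steps made so far in its state, so the induction must allow an
  -- arbitrary starting value `c`.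
  have key : ∀ (m : ℕ) (s : σ) (c : ℕ), I s → Φ s ≤ m → ∃ b k,
      (b, c + k) ∈ PFun.fix (α := σ × ℕ) (β := β × ℕ)
        (fun p => Part.map
          (fun q : (β ⊕ σ) × ℕ =>
            Sum.map (fun b => (b, p.2 + q.2 + 1)) (fun s' => (s', p.2 + q.2 + 1)) q.1)
          (body p.1)) (s, c) ∧ Q b ∧ k ≤ Φ s := by
    intro m
    induction m with
    | zero =>
      intro s c hs hm
      obtain ⟨r, k, -, hP⟩ := h s hs
      rcases r with b | s'
      · have := hP.2
        omega
      · have := hP.2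
        omega
    | succ m ih =>
      intro s c hs hm
      obtain ⟨r, k, hk, hP⟩ := h s hs
      rcases r with b | s'
      · refine ⟨b, k + 1, PFun.mem_fix_iff.2 ?_, hP.1, hP.2⟩
        exact Or.inl ((Part.mem_map_iff _).2 ⟨(Sum.inl b, k), hk, rfl⟩)
      · obtain ⟨b, k', h₁, h₂, h₃⟩ := ih s' (c + k + 1) hP.1 (by have := hP.2; omega)
        refine ⟨b, k + 1 + k', PFun.mem_fix_iff.2 ?_, h₂, by have := hP.2; omega⟩
        refine Or.inr ⟨(s', c + k + 1), (Part.mem_map_iff _).2 ⟨(Sum.inr s', k), hk, rfl⟩, ?_⟩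
        rwa [show c + (k + 1 + k') = c + k + 1 + k' by ring]
  obtain ⟨b, k, hk, hQ⟩ := key (Φ s) s 0 hs le_rfl
  rw [zero_add] at hk
  exact ⟨b, k, hk, hQ⟩

end Comp

/-! # Heaps -/

namespace Heap

variable {α : Type}

@[simp] theorem rank_nil : (nil : Heap α).rank = 0 := rfl

@[simp] theorem rank_node (rk : ℕ) (k : ℤ) (v : α) (o : ℤ) (l r : Heap α) :
    (node rk k v o l r).rank = rk := rfl

/-- The entries with their keys. -/
def entries : Heap α → Multiset (ℤ × α)
  | nil => 0
  | node _ k v o l r => (k, v) ::ₘ (entries l + entries r).map fun p => (p.1 + o, p.2)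

/-- Leftist and heap ordered. -/
def WF : Heap α → Prop
  | nil => True
  | node rk k _ o l r => rk = r.rank + 1 ∧ r.rank ≤ l.rank ∧
      (∀ p ∈ l.entries + r.entries, k ≤ p.1 + o) ∧ WF l ∧ WF r

theorem card_entries : ∀ h : Heap α, h.entries.card = h.size
  | nil => rfl
  | node _ _ _ _ l r => by simp [entries, size, card_entries l, card_entries r]

theorem entries_shift (d : ℤ) (h : Heap α) :
    (h.shift d).entries = h.entries.map fun p => (p.1 + d, p.2) := by
  cases h with
  | nil => rfl
  | node rk k v o l r =>
    simp only [shift, entries, Multiset.map_cons, Multiset.map_map, Function.comp_def, add_assoc]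

theorem rank_shift (d : ℤ) (h : Heap α) : (h.shift d).rank = h.rank := by
  cases h <;> rfl

theorem WF.shift {h : Heap α} (hh : h.WF) (d : ℤ) : (h.shift d).WF := by
  cases h with
  | nil => trivial
  | node rk k v o l r =>
    obtain ⟨h₁, h₂, h₃, h₄⟩ := hh
    exact ⟨h₁, h₂, fun p hp => by have := h₃ p hp; linarith, h₄⟩

/-- The left child has at least the rank of the right one, so both subtrees contribute the power of
two belonging to the right rank. -/
theorem two_pow_rank_le : ∀ {h : Heap α}, h.WF → 2 ^ h.rank ≤ h.size + 1
  | nil, _ => by simp [size]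
  | node rk k v o l r, hh => by
    obtain ⟨h₁, h₂, -, h₄, h₅⟩ := hh
    have hl := two_pow_rank_le h₄
    have hr := two_pow_rank_le h₅
    have : 2 ^ r.rank ≤ 2 ^ l.rank := Nat.pow_le_pow_right two_pos h₂
    simp only [rank_node, size, h₁, pow_succ]
    omega

theorem WF.rank_le {h : Heap α} (hh : h.WF) {M : ℕ} (hM : h.size ≤ M) :
    h.rank ≤ Nat.log 2 (M + 1) :=
  Nat.le_log_of_pow_le one_lt_two ((two_pow_rank_le hh).trans (by omega))

theorem WF.make {k : ℤ} {v : α} {o : ℤ} {a b : Heap α} (ha : a.WF) (hb : b.WF)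
    (h : ∀ p ∈ a.entries + b.entries, k ≤ p.1 + o) : (make k v o a b).WF := by
  unfold Heap.make
  split_ifs with hr
  · exact ⟨rfl, hr, h, ha, hb⟩
  · exact ⟨rfl, by omega, by rwa [add_comm], hb, ha⟩

theorem entries_make (k : ℤ) (v : α) (o : ℤ) (a b : Heap α) :
    (make k v o a b).entries =
      (k, v) ::ₘ (a.entries + b.entries).map fun p => (p.1 + o, p.2) := by
  unfold make
  split_ifs
  · rfl
  · simp only [entries, add_comm b.entries]

theorem WF.key_le {rk : ℕ} {k : ℤ} {v : α} {o : ℤ} {l r : Heap α} (h : (node rk k v o l r).WF) :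
    ∀ p ∈ (node rk k v o l r).entries, k ≤ p.1 := by
  intro p hp
  simp only [entries, Multiset.mem_cons, Multiset.mem_map] at hp
  rcases hp with rfl | ⟨p', hp', rfl⟩
  · exact le_rfl
  · exact h.2.2.1 p' hp'

/-- Each call descends one step on the right spine of one of the heaps, which lowers the sum of the
ranks by one. The other heap is moved below a node with pending shift `o`; shifting it by `-o` first
keeps its effective keys. -/
theorem wp_meld (a b : Heap α) (ha : a.WF) (hb : b.WF) :
    (meld a b).Wp fun h c => h.WF ∧ h.entries = a.entries + b.entries ∧
      c ≤ a.rank + b.rank + 1 := by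
  induction a, b using meld.induct with
  | case1 b => simp [meld, hb, entries]
  | case2 rk k v o l r => simp [meld, ha, entries]
  | case3 rk₁ k₁ v₁ o₁ l₁ r₁ rk₂ k₂ v₂ o₂ l₂ r₂ hk ih =>
    rw [meld]
    simp only [hk, if_true, Comp.wp_bind, Comp.wp_step]
    refine (ih ha.2.2.2.2 (hb.shift _)).mono ?_
    rintro c k ⟨h₁, h₂, h₃⟩
    refine ⟨ha.2.2.2.1.make h₁ ?_, ?_, ?_⟩
    · intro p hp
      rw [h₂, ← add_assoc, Multiset.mem_add] at hp
      rcases hp with hp | hp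
      · exact ha.2.2.1 p hp
      · rw [entries_shift, Multiset.mem_map] at hp
        obtain ⟨p', hp', rfl⟩ := hp
        have := hb.key_le p' hp'
        simp only [neg_add_cancel_right]
        omega
    · rw [entries_make, h₂, entries_shift]
      conv_rhs => rw [entries]
      simp [Multiset.map_map, add_assoc]
    · have := ha.1
      simp only [rank_shift, rank_node] at h₃ ⊢
      omega
  | case4 rk₁ k₁ v₁ o₁ l₁ r₁ rk₂ k₂ v₂ o₂ l₂ r₂ hk ih =>
    rw [meld]
    simp only [hk, if_false, Comp.wp_bind, Comp.wp_step]
    refine (ih hb.2.2.2.2 (ha.shift _)).mono ?_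
    rintro c k ⟨h₁, h₂, h₃⟩
    refine ⟨hb.2.2.2.1.make h₁ ?_, ?_, ?_⟩
    · intro p hp
      rw [h₂, ← add_assoc, Multiset.mem_add] at hp
      rcases hp with hp | hp
      · exact hb.2.2.1 p hp
      · rw [entries_shift, Multiset.mem_map] at hp
        obtain ⟨p', hp', rfl⟩ := hp
        have := ha.key_le p' hp'
        simp only [neg_add_cancel_right]
        omega
    · rw [entries_make, h₂, entries_shift, add_comm (entries (node rk₁ k₁ v₁ o₁ l₁ r₁))]
      conv_rhs => rw [entries]
      simp [Multiset.map_map, add_assoc]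
    · have := hb.1
      simp only [rank_shift, rank_node] at h₃ ⊢
      omega

/-- The cost of an operation on heaps with at most `M` entries. -/
def opCost (M : ℕ) : ℕ := 2 * Nat.log 2 (M + 1) + 3

theorem wp_meld_le {a b : Heap α} (ha : a.WF) (hb : b.WF) {M : ℕ} (hM : a.size ≤ M)
    (hM' : b.size ≤ M) :
    (meld a b).Wp fun h c => h.WF ∧ h.entries = a.entries + b.entries ∧ c ≤ opCost M := by
  refine (wp_meld a b ha hb).mono fun h c hc => ⟨hc.1, hc.2.1, ?_⟩
  have := ha.rank_le hM
  have := hb.rank_le hM'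
  have := hc.2.2
  unfold opCost
  omega

theorem wp_push (k : ℤ) (v : α) {h : Heap α} (hh : h.WF) {M : ℕ} (hM : h.size ≤ M) :
    (push k v h).Wp fun h' c => h'.WF ∧ h'.entries = (k, v) ::ₘ h.entries ∧ c ≤ opCost M := by
  refine (wp_meld (node 1 k v 0 nil nil) h (by simp [WF, entries]) hh).mono ?_
  rintro h' c ⟨h₁, h₂, h₃⟩
  refine ⟨h₁, by simpa [entries] using h₂, ?_⟩
  have := hh.rank_le hM
  simp only [rank_node] at h₃
  unfold opCost
  omega

theorem wp_pop {h : Heap α} (hh : h.WF) {M : ℕ} (hM : h.size ≤ M) :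
    h.pop.Wp fun r c => c ≤ opCost M ∧ match r with
      | none => h.entries = 0
      | some (k, v, h') => h'.WF ∧ h.entries = (k, v) ::ₘ h'.entries ∧
          ∀ p ∈ h.entries, k ≤ p.1 := by
  cases h with
  | nil => simp [pop, entries, opCost]
  | node rk k v o l r =>
    simp only [pop, Comp.wp_bind, Comp.wp_step]
    refine (wp_meld _ _ (hh.2.2.2.1.shift o) (hh.2.2.2.2.shift o)).mono ?_
    rintro h' c ⟨h₁, h₂, h₃⟩
    refine ⟨?_, h₁, ?_, hh.key_le⟩
    · have := hh.2.2.2.1.rank_le (M := M) (by simp only [size] at hM; omega)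
      have := hh.2.2.2.2.rank_le (M := M) (by simp only [size] at hM; omega)
      simp only [rank_shift] at h₃
      unfold opCost
      omega
    · rw [h₂, entries_shift, entries_shift, entries, Multiset.map_add]

/-- Makes a fresh announcement `Due`: its key is realised either by the death of the cluster or by
an actual entry of its heap. -/
theorem minKey_eq (d : ℤ) (h : Heap α) :
    h.minKey d = d ∨ ∃ p ∈ h.entries, p.1 = h.minKey d := by
  cases h with
  | nil => exact Or.inl rfl
  | node rk k v o l r =>
    rcases min_choice d k with h | h
    · exact Or.inl h
    · exact Or.inr ⟨(k, v), by simp [entries], h.symm⟩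

end Heap

end

/-! ### Invariants of the moat growing -/

noncomputable section

namespace Moat

variable {n : ℕ}

/-- What an edge part of version `j` that expires at the key `k` says about the slack of its edge:
if the slack was halved `j + 1` times, and only the moat around `y` grew in addition. -/
def Bound (cost : ℕ) (s : Moat n) (k : ℤ) (j : ℕ) (x y : Fin n) : Prop :=
  2 ^ (j + 1) * (cost - (s.base x + k) - s.width y - 1) ≤ (cost : ℤ) - 1

/-- Invariant of the edge parts stored in the cluster `r`. -/
structure PieceOk (dom : List (Fin n)) (cost E : ℕ) (s : Moat n) (r : Fin n) (k : ℤ)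
    (e : Piece n) : Prop where
  u_mem : e.u ∈ dom
  v_mem : e.v ∈ dom
  edge_lt : e.edge < E
  ver_le : e.ver ≤ s.ver e.edge
  label : s.label e.u = r ∨ s.label e.v = r
  bound : e.ver = s.ver e.edge → s.label e.u ≠ s.label e.v →
    (s.label e.u = r → Bound cost s k e.ver e.u e.v) ∧
    (s.label e.v = r → Bound cost s k e.ver e.v e.u)

/-- When its clock shows `t`, the cluster `r` is dead or one of its edge parts has expired. -/
def Due (s : Moat n) (r : Fin n) (t : ℤ) : Prop :=
  s.death r ≤ t ∨ ∃ p ∈ (s.parts r).entries, p.1 ≤ t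

/-- Invariant of the moat growing; the clusters in `X` may lack an announcement in the queue. -/
structure Inv (dom : List (Fin n)) (cost E L : ℕ) (X : Fin n → Prop) (s : Moat n) : Prop where
  label_mem : ∀ v ∈ dom, s.label v ∈ dom
  label_label : ∀ v ∈ dom, s.label (s.label v) = s.label v
  mem_members : ∀ r ∈ dom, s.label r = r → ∀ v, v ∈ s.members r ↔ v ∈ dom ∧ s.label v = r
  nodup_members : ∀ r ∈ dom, s.label r = r → (s.members r).Nodup
  size_eq : ∀ r ∈ dom, s.label r = r → s.size r = (s.members r).length
  parts_wf : ∀ r, (s.parts r).WF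
  queue_wf : s.queue.WF
  piece : ∀ r, s.label r = r → ∀ p ∈ (s.parts r).entries, PieceOk dom cost E s r p.1 p.2
  active_live : ∀ r, s.active r → r ∈ dom ∧ s.label r = r
  start_le : ∀ r, s.active r → s.start r ≤ s.now
  stamp_le : ∀ p ∈ s.queue.entries, p.2.2 ≤ s.stamp p.2.1
  due : ∀ p ∈ s.queue.entries, p.2.2 = s.stamp p.2.1 → s.active p.2.1 → ¬ X p.2.1 →
    s.Due p.2.1 (s.clock p.2.1 + (p.1 - s.start p.2.1))
  ver_le : ∀ i, s.ver i ≤ L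

/-- The number of edge parts in the heaps of the clusters. -/
def partCount (s : Moat n) : ℕ := ∑ r with s.label r = r, (s.parts r).size

/-- A bound on the number of events to come. -/
def work (E L : ℕ) (s : Moat n) : ℕ :=
  s.queue.size + s.partCount + 3 * ∑ i ∈ Finset.range E, (L - s.ver i)

/-- A bound on the number of times that vertices are going to be relabelled. -/
def relabels (dom : List (Fin n)) (s : Moat n) : ℕ :=
  ∑ v ∈ dom.toFinset, (Nat.log 2 dom.length - Nat.log 2 (s.size (s.label v)))

theorem Due.mono {s : Moat n} {r : Fin n} {t t' : ℤ} (h : s.Due r t) (ht : t ≤ t') :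
    s.Due r t' := by
  rcases h with h | ⟨p, hp, h⟩
  · exact Or.inl (h.trans ht)
  · exact Or.inr ⟨p, hp, h.trans ht⟩

/-- Moats never shrink, and wider moats only lessen the left-hand side of `Bound`. A translation of
the key by a merger is harmless because `base x` moves the opposite way. -/
theorem Bound.mono {cost : ℕ} {s s' : Moat n} {k k' : ℤ} {j : ℕ} {x y : Fin n}
    (h : Bound cost s k j x y) (hx : s.base x + k ≤ s'.base x + k')
    (hy : s.width y ≤ s'.width y) : Bound cost s' k' j x y := by
  unfold Bound at *
  refine le_trans ?_ h
  have : (0 : ℤ) ≤ 2 ^ (j + 1) := by positivity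
  exact mul_le_mul_of_nonneg_left (by linarith) this

theorem PieceOk.of_width {dom : List (Fin n)} {cost E : ℕ} {s s' : Moat n} {r : Fin n} {k : ℤ}
    {e : Piece n} (h : PieceOk dom cost E s r k e) (hl : s'.label = s.label)
    (hv : s'.ver = s.ver) (hb : s'.base = s.base) (hw : ∀ x, s.width x ≤ s'.width x) :
    PieceOk dom cost E s' r k e := by
  refine ⟨h.u_mem, h.v_mem, h.edge_lt, hv ▸ h.ver_le, hl ▸ h.label, ?_⟩
  rw [hl, hv]
  intro h₁ h₂
  obtain ⟨h₃, h₄⟩ := h.bound h₁ h₂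
  exact ⟨fun h => (h₃ h).mono (by rw [hb]) (hw _), fun h => (h₄ h).mono (by rw [hb]) (hw _)⟩

/-- Exemptions matter for active clusters only. This settles the case where `schedule` does nothing
because the cluster is inactive. -/
theorem Inv.imp {dom : List (Fin n)} {cost E L : ℕ} {X Y : Fin n → Prop} {s : Moat n}
    (h : Inv dom cost E L X s) (hXY : ∀ r, s.active r → X r → Y r) : Inv dom cost E L Y s :=
  { h with due := fun p hp h₁ h₂ h₃ => h.due p hp h₁ h₂ fun hx => h₃ (hXY _ h₂ hx) }

theorem Inv.setQueue {dom : List (Fin n)} {cost E L : ℕ} {X : Fin n → Prop} {s : Moat n}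
    (h : Inv dom cost E L X s) {q : Heap (Fin n × ℕ)} (hq : q.WF)
    (hs : ∀ p ∈ q.entries, p ∈ s.queue.entries) : Inv dom cost E L X { s with queue := q } :=
  { h with
    queue_wf := hq
    stamp_le := fun p hp => h.stamp_le p (hs p hp)
    due := fun p hp => h.due p (hs p hp)
    piece := fun r hr p hp => (h.piece r hr p hp).of_width rfl rfl rfl fun _ => le_rfl }

theorem Inv.setForest {dom : List (Fin n)} {cost E L : ℕ} {X : Fin n → Prop} {s : Moat n}
    (h : Inv dom cost E L X s) (F : List (Fin n × Fin n)) :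
    Inv dom cost E L X { s with forest := F } :=
  { h with piece := fun r hr p hp => (h.piece r hr p hp).of_width rfl rfl rfl fun _ => le_rfl }

theorem Inv.setNow {dom : List (Fin n)} {cost E L : ℕ} {X : Fin n → Prop} {s : Moat n}
    (h : Inv dom cost E L X s) (key : ℤ) :
    Inv dom cost E L X { s with now := max s.now key } := by
  have hw : ∀ x, s.width x ≤ ({ s with now := max s.now key } : Moat n).width x := by
    intro x
    unfold width time
    dsimp only
    split_ifs <;> simp
  exact
    { h with
      start_le := fun r hr => (h.start_le r hr).trans (le_max_left _ _)
      piece := fun r hr p hp => (h.piece r hr p hp).of_width rfl rfl rfl hw }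

/-- The state after `kill`. -/
def killed (s : Moat n) (r : Fin n) : Moat n :=
  { s with
    clock := Function.update s.clock r (s.time r)
    active := Function.update s.active r false
    alive := s.alive - 1
    stamp := Function.update s.stamp r (s.stamp r + 1) }

theorem kill_eq (s : Moat n) (r : Fin n) : s.kill r = step (s.killed r) := rfl

/-- The clock is frozen at its present value, so all widths persist. -/
theorem Inv.killed {dom : List (Fin n)} {cost E L : ℕ} {X : Fin n → Prop} {s : Moat n}
    (h : Inv dom cost E L X s) (r : Fin n) : Inv dom cost E L X (s.killed r) := by
  have ht : ∀ x, (s.killed r).time x = s.time x := by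
    intro x
    by_cases hx : x = r
    · subst hx
      simp [time, Moat.killed]
    · simp [time, Moat.killed, Function.update_of_ne hx]
  have ha : ∀ x, (s.killed r).active x → x ≠ r ∧ s.active x := by
    intro x hx
    by_cases hxr : x = r
    · subst hxr
      simp [Moat.killed] at hx
    · exact ⟨hxr, by simpa [Moat.killed, Function.update_of_ne hxr] using hx⟩
  refine
    { h with
      active_live := fun x hx => h.active_live x (ha x hx).2
      start_le := fun x hx => h.start_le x (ha x hx).2
      piece := fun x hx p hp => (h.piece x hx p hp).of_width rfl rfl rfl fun y =>
        (by unfold width; rw [ht]; exact le_rfl)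
      stamp_le := fun p hp => ?_
      due := fun p hp h₁ h₂ h₃ => ?_ }
  · have := h.stamp_le p hp
    by_cases hr : p.2.1 = r
    · simp only [Moat.killed, hr, Function.update_self]
      rw [hr] at this
      omega
    · simpa [Moat.killed, Function.update_of_ne hr] using this
  · obtain ⟨hr, h₂⟩ := ha _ h₂
    simp only [Moat.killed, Function.update_of_ne hr] at h₁ ⊢
    exact h.due p hp h₁ h₂ h₃

/-- Adding entries preserves `Due`. Removing one may take away the witness of an announcement, so in
that case `r` must be exempt until it is scheduled again. -/
theorem Inv.setParts {dom : List (Fin n)} {cost E L : ℕ} {X : Fin n → Prop} {s : Moat n}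
    (h : Inv dom cost E L X s) {r : Fin n} {hp : Heap (Piece n)} (hwf : hp.WF)
    (hs : s.label r = r → ∀ p ∈ hp.entries, p ∈ (s.parts r).entries ∨
      PieceOk dom cost E s r p.1 p.2)
    (hX : X r ∨ ∀ p ∈ (s.parts r).entries, p ∈ hp.entries) :
    Inv dom cost E L X { s with parts := Function.update s.parts r hp } := by
  refine
    { h with
      parts_wf := fun x => ?_
      piece := fun x hx p hp' => ?_
      due := fun p hp' h₁ h₂ h₃ => ?_ }
  · by_cases hx : x = r
    · subst hx
      simpa using hwf
    · simpa [Function.update_of_ne hx] using h.parts_wf x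
  · suffices PieceOk dom cost E s x p.1 p.2 from this.of_width rfl rfl rfl fun _ => le_rfl
    by_cases hxr : x = r
    · subst hxr
      simp only [Function.update_self] at hp'
      exact (hs hx p hp').elim (fun h' => h.piece x hx p h') id
    · simp only [Function.update_of_ne hxr] at hp'
      exact h.piece x hx p hp'
  · have := h.due p hp' h₁ h₂ h₃
    unfold Due at this ⊢
    by_cases hr : p.2.1 = r
    · rcases hX with hX | hX
      · exact absurd (hr ▸ hX) h₃
      · refine this.imp id ?_
        rintro ⟨p', hp', hk⟩
        refine ⟨p', ?_, hk⟩
        simp only [hr, Function.update_self]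
        exact hX p' (hr ▸ hp')
    · simpa [Function.update_of_ne hr] using this

/-- All stored parts of the edge become outdated, since their versions are at most the old one;
their bounds hold vacuously from then on. -/
theorem Inv.incVer {dom : List (Fin n)} {cost E L : ℕ} {X : Fin n → Prop} {s : Moat n}
    (h : Inv dom cost E L X s) {i : ℕ} (hi : s.ver i < L) :
    Inv dom cost E L X { s with ver := Function.update s.ver i (s.ver i + 1) } := by
  refine
    { h with
      ver_le := fun j => ?_
      piece := fun x hx p hp => ?_ }
  · have h' := h.piece x hx p hp
    refine ⟨h'.u_mem, h'.v_mem, h'.edge_lt, ?_, h'.label, ?_⟩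
    · have := h'.ver_le
      by_cases hj : p.2.edge = i
      · rw [hj] at this
        simp only [hj, Function.update_self]
        omega
      · simpa [Function.update_of_ne hj] using this
    · have := h'.ver_le
      by_cases hj : p.2.edge = i
      · rw [hj] at this
        simp only [hj, Function.update_self]
        intro h₁
        omega
      · simp only [Function.update_of_ne hj]
        exact h'.bound
  · by_cases hj : j = i
    · subst hj
      simpa using hi
    · simpa [Function.update_of_ne hj] using h.ver_le j

/-- The new stamp exceeds that of every older entry for `r` (`stamp_le`). Only the new announcement
has to be `Due`, and it is so by `Heap.minKey_eq`; this lifts the exemption of `r`. -/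
theorem wp_schedule {dom : List (Fin n)} {cost E L : ℕ} {X : Fin n → Prop} {s : Moat n}
    (h : Inv dom cost E L X s) (r : Fin n) {M : ℕ} (hM : s.queue.size ≤ M) :
    (s.schedule r).Wp fun s' k => k ≤ Heap.opCost M + 2 ∧
      (∃ q st, s' = { s with queue := q, stamp := st }) ∧
      Inv dom cost E L (fun x => X x ∧ x ≠ r) s' ∧ s'.queue.size ≤ s.queue.size + 1 := by
  unfold schedule
  split_ifs with hr
  · simp only [Comp.wp_bind, Comp.wp_step]
    refine (Heap.wp_push _ _ h.queue_wf hM).mono ?_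
    rintro q k ⟨h₁, h₂, h₃⟩
    refine ⟨by omega, ⟨_, _, rfl⟩, ?_, ?_⟩
    · refine
        { h with
          queue_wf := h₁
          piece := fun x hx p hp => (h.piece x hx p hp).of_width rfl rfl rfl fun _ => le_rfl
          stamp_le := fun p hp => ?_
          due := fun p hp h₄ h₅ h₆ => ?_ }
      · rw [h₂, Multiset.mem_cons] at hp
        rcases hp with rfl | hp
        · simp
        · have := h.stamp_le p hp
          by_cases hpr : p.2.1 = r
          · simp only [hpr, Function.update_self]
            rw [hpr] at this
            omega
          · simpa [Function.update_of_ne hpr] using this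
      · rw [h₂, Multiset.mem_cons] at hp
        rcases hp with rfl | hp
        · unfold Due
          simp only [add_sub_cancel_left]
          rw [show s.clock r + (Heap.minKey (s.death r) (s.parts r) - s.clock r) =
            Heap.minKey (s.death r) (s.parts r) by ring]
          rcases Heap.minKey_eq (s.death r) (s.parts r) with h' | ⟨p, hp, h'⟩
          · exact Or.inl h'.ge
          · exact Or.inr ⟨p, hp, h'.le⟩
        · by_cases hpr : p.2.1 = r
          · have := h.stamp_le p hp
            simp only [hpr, Function.update_self] at h₄
            rw [hpr] at this
            omega
          · simp only [Function.update_of_ne hpr] at h₄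
            exact h.due p hp h₄ h₅ fun hx => h₆ ⟨hx, hpr⟩
    · simp [← Heap.card_entries, h₂]
  · simp only [Comp.wp_step]
    refine ⟨by omega, ⟨s.queue, s.stamp, rfl⟩, h.imp ?_, by omega⟩
    rintro x hx hX
    exact ⟨hX, fun h => hr (h ▸ hx)⟩

theorem wp_addPart {dom : List (Fin n)} {cost E L : ℕ} {X : Fin n → Prop} {s : Moat n}
    (h : Inv dom cost E L X s) {e : Piece n} {u : Fin n} {d : ℤ}
    (he : PieceOk dom cost E s (s.label u) (s.time (s.label u) + d) e) {M : ℕ}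
    (hM : (s.parts (s.label u)).size ≤ M) :
    (s.addPart e u d).Wp fun s' k => k ≤ Heap.opCost M + 2 ∧
      (∃ ps, s' = { s with parts := ps }) ∧
      Inv dom cost E L X s' ∧ s'.partCount ≤ s.partCount + 1 := by
  unfold addPart
  simp only [Comp.wp_bind, Comp.wp_step]
  refine (Heap.wp_push _ _ (h.parts_wf _) hM).mono ?_
  rintro hp k ⟨h₁, h₂, h₃⟩
  refine ⟨by omega, ⟨_, rfl⟩, ?_, ?_⟩
  · refine h.setParts h₁ (fun _ p hp' => ?_) (Or.inr fun p hp' => ?_)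
    · rw [h₂, Multiset.mem_cons] at hp'
      rcases hp' with rfl | hp'
      · exact Or.inr he
      · exact Or.inl hp'
    · rw [h₂]
      exact Multiset.mem_cons_of_mem hp'
  · unfold partCount
    dsimp only
    have hs : hp.size = (s.parts (s.label u)).size + 1 := by simp [← Heap.card_entries, h₂]
    have : ∀ r, (Function.update s.parts (s.label u) hp r).size =
        (s.parts r).size + if r = s.label u then 1 else 0 := by
      intro r
      by_cases hr : r = s.label u
      · subst hr
        simp [hs]
      · simp [hr]
    rw [Finset.sum_congr rfl fun r _ => this r, Finset.sum_add_distrib]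
    refine Nat.add_le_add_left ?_ _
    rw [Finset.sum_ite_eq']
    split_ifs <;> simp

theorem size_le_partCount (s : Moat n) {r : Fin n} (hr : s.label r = r) :
    (s.parts r).size ≤ s.partCount :=
  Finset.single_le_sum (f := fun r => (s.parts r).size) (fun _ _ => Nat.zero_le _) (by simp [hr])

end Moat

end

/-! ### Merging two clusters -/

noncomputable section

namespace Moat

variable {n : ℕ}

/-- Without repetitions the shift of `base` hits each vertex exactly once. -/
theorem foldl_relabel (b : Fin n) (d : ℤ) : ∀ (l : List (Fin n)) (s : Moat n), l.Nodup →
    l.foldl (fun (s : Moat n) v =>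
      { s with
        label := Function.update s.label v b
        base := Function.update s.base v (s.base v - d)
        members := Function.update s.members b (v :: s.members b) }) s =
    { s with
      label := fun x => if x ∈ l then b else s.label x
      base := fun x => if x ∈ l then s.base x - d else s.base x
      members := Function.update s.members b (l.reverse ++ s.members b) }
  | [], s, _ => by simp
  | v :: l, s, h => by
    rw [List.nodup_cons] at h
    rw [List.foldl_cons, foldl_relabel b d l _ h.2]
    congr 1
    · funext x
      by_cases hx : x = v <;> simp [hx]
    · simp
    · funext x
      by_cases hx : x = v
      · subst hx
        simp [h.1]
      · simp [hx]

/-- The state after `absorb`, where `hp` is the heap of the merged cluster. -/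
def absorbed (s : Moat n) (a b : Fin n) (hp : Heap (Piece n)) : Moat n :=
  { s with
    label := fun x => if x ∈ s.members a then b else s.label x
    base := fun x => if x ∈ s.members a then s.base x - (s.time b - s.time a) else s.base x
    members := Function.update s.members b ((s.members a).reverse ++ s.members b)
    size := Function.update s.size b (s.size a + s.size b)
    clock := Function.update s.clock b (s.time b)
    start := Function.update s.start b s.now
    death := Function.update s.death b
      (s.time b + ((s.death a - s.time a) + (s.death b - s.time b)))
    active := Function.update (Function.update s.active b
      (decide (0 < (s.death a - s.time a) + (s.death b - s.time b)))) a false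
    parts := Function.update s.parts b hp
    stamp := Function.update s.stamp a (s.stamp a + 1)
    alive := if s.active a && s.active b then s.alive - 1 else s.alive }

section Absorb

variable {dom : List (Fin n)} {cost E L : ℕ} {X : Fin n → Prop} {s : Moat n} {a b : Fin n}
  {hp : Heap (Piece n)}

theorem Inv.label_absorbed (h : Inv dom cost E L X s) (ha : a ∈ dom) (hla : s.label a = a)
    {x : Fin n} (hx : x ∈ dom) :
    (s.absorbed a b hp).label x = if s.label x = a then b else s.label x := by
  simp [absorbed, h.mem_members a ha hla, hx]

theorem Inv.time_absorbed (hab : a ≠ b) {r : Fin n} (hr : r ≠ a) :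
    (s.absorbed a b hp).time r = s.time r := by
  by_cases hrb : r = b
  · subst hrb
    simp [time, absorbed, Function.update_of_ne hr]
  · simp [time, absorbed, Function.update_of_ne hr, Function.update_of_ne hrb]

/-- A vertex of `a` changes over to the clock of `b`, and its `base` drops by the difference of the
two clocks, so its width does not jump. -/
theorem Inv.width_absorbed (h : Inv dom cost E L X s) (ha : a ∈ dom) (hla : s.label a = a)
    (hab : a ≠ b) {x : Fin n} (hx : x ∈ dom) :
    (s.absorbed a b hp).width x = s.width x := by
  unfold width
  rw [h.label_absorbed ha hla hx]
  by_cases hxa : s.label x = a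
  · rw [if_pos hxa, Inv.time_absorbed hab hab.symm]
    simp only [absorbed, h.mem_members a ha hla, hx, hxa, and_self, if_true]
    ring
  · rw [if_neg hxa, Inv.time_absorbed hab hxa]
    simp [absorbed, h.mem_members a ha hla, hx, hxa]

/-- The merged cluster has new `clock`, `start`, `death` and heap, so old announcements for `b` mean
nothing and `b` becomes exempt. Since `a` is inactive afterwards, no other exemption is needed. -/
theorem Inv.absorbed (h : Inv dom cost E L X s) (ha : a ∈ dom) (hla : s.label a = a)
    (hb : b ∈ dom) (hlb : s.label b = b) (hab : a ≠ b) (hX : ∀ r, X r → r = a ∨ r = b)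
    (hwf : hp.WF)
    (hhp : hp.entries = ((s.parts a).shift (s.time b - s.time a)).entries + (s.parts b).entries) :
    Inv dom cost E L (fun r => r = b) (s.absorbed a b hp) := by
  have hl : ∀ x ∈ dom, (s.absorbed a b hp).label x = if s.label x = a then b else s.label x :=
    fun x hx => h.label_absorbed ha hla hx
  have hlive : ∀ r, (s.absorbed a b hp).label r = r → r ≠ a ∧ s.label r = r := by
    intro r hr
    by_cases hra : r ∈ s.members a
    · simp only [Moat.absorbed, hra, if_true] at hr
      subst hr
      exact absurd (hlb ▸ ((h.mem_members a ha hla b).1 hra).2).symm hab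
    · have hr' : s.label r = r := by simpa [Moat.absorbed, hra] using hr
      refine ⟨?_, hr'⟩
      rintro rfl
      exact hra ((h.mem_members r ha hla r).2 ⟨ha, hla⟩)
  have hact : ∀ r, (s.absorbed a b hp).active r → r ≠ a ∧ (r = b ∨ s.active r) := by
    intro r hr
    by_cases hra : r = a
    · subst hra
      simp [Moat.absorbed] at hr
    · refine ⟨hra, ?_⟩
      by_cases hrb : r = b
      · exact Or.inl hrb
      · exact Or.inr (by
          simpa [Moat.absorbed, Function.update_of_ne hra, Function.update_of_ne hrb] using hr)
  have hmem : ∀ r, r ≠ b → (s.absorbed a b hp).members r = s.members r := fun r hr => by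
    simp [Moat.absorbed, Function.update_of_ne hr]
  have hmemb : (s.absorbed a b hp).members b = (s.members a).reverse ++ s.members b := by
    simp [Moat.absorbed]
  have hma := h.mem_members a ha hla
  have hmb := h.mem_members b hb hlb
  refine
    { label_mem := fun v hv => ?_
      label_label := fun v hv => ?_
      mem_members := fun r hr hr' v => ?_
      nodup_members := fun r hr hr' => ?_
      size_eq := fun r hr hr' => ?_
      parts_wf := fun r => ?_
      queue_wf := h.queue_wf
      piece := fun r hr p hpe => ?_
      active_live := fun r hr => ?_
      start_le := fun r hr => ?_
      stamp_le := fun p hp => ?_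
      due := fun p hp h₁ h₂ h₃ => ?_
      ver_le := h.ver_le }
  · rw [hl v hv]
    split_ifs
    exacts [hb, h.label_mem v hv]
  · have hv' : s.label v ∈ dom := h.label_mem v hv
    rw [hl v hv]
    split_ifs with hva
    · rw [hl b hb, hlb, if_neg hab.symm]
    · rw [hl _ hv', h.label_label v hv, if_neg hva]
  · obtain ⟨hra, hlr⟩ := hlive r hr'
    by_cases hrb : r = b
    · subst hrb
      rw [hmemb, List.mem_append, List.mem_reverse, hma, hmb]
      constructor
      · rintro (⟨hv, hv'⟩ | ⟨hv, hv'⟩)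
        · exact ⟨hv, by rw [hl v hv, if_pos hv']⟩
        · exact ⟨hv, by rw [hl v hv, hv', if_neg hab.symm]⟩
      · rintro ⟨hv, hv'⟩
        rw [hl v hv] at hv'
        by_cases hva : s.label v = a
        · exact Or.inl ⟨hv, hva⟩
        · exact Or.inr ⟨hv, by rwa [if_neg hva] at hv'⟩
    · rw [hmem r hrb, h.mem_members r hr hlr]
      refine and_congr_right fun hv => ?_
      rw [hl v hv]
      by_cases hva : s.label v = a
      · rw [if_pos hva, hva]
        exact ⟨fun h => absurd h.symm hra, fun h => absurd h.symm hrb⟩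
      · rw [if_neg hva]
  · obtain ⟨hra, hlr⟩ := hlive r hr'
    by_cases hrb : r = b
    · subst hrb
      rw [hmemb, List.nodup_append']
      refine ⟨List.nodup_reverse.2 (h.nodup_members a ha hla), h.nodup_members r hb hlb, ?_⟩
      intro x hx hx'
      rw [List.mem_reverse, hma] at hx
      rw [hmb] at hx'
      exact hab (hx.2.symm.trans hx'.2)
    · rw [hmem r hrb]
      exact h.nodup_members r hr hlr
  · obtain ⟨hra, hlr⟩ := hlive r hr'
    by_cases hrb : r = b
    · subst hrb
      rw [hmemb]
      simp [Moat.absorbed, h.size_eq a ha hla, h.size_eq r hb hlb]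
    · rw [hmem r hrb]
      simpa [Moat.absorbed, Function.update_of_ne hrb] using h.size_eq r hr hlr
  · by_cases hrb : r = b
    · subst hrb
      simpa [Moat.absorbed] using hwf
    · simpa [Moat.absorbed, Function.update_of_ne hrb] using h.parts_wf r
  · obtain ⟨hra, hlr⟩ := hlive r hr
    -- The part comes from an old cluster `r₀`, where it had the key `k₀`; base plus key is the same
    -- before and after the merger.
    obtain ⟨r₀, k₀, hr₀, hlr₀, hp₀, hk₀, hr₁⟩ : ∃ r₀ k₀, (r₀ = a ∧ r = b ∨ r₀ = r) ∧
        s.label r₀ = r₀ ∧ (k₀, p.2) ∈ (s.parts r₀).entries ∧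
        (∀ x ∈ dom, s.label x = r₀ → (s.absorbed a b hp).base x + p.1 = s.base x + k₀) ∧
        (∀ x ∈ dom, s.label x = r₀ → (s.absorbed a b hp).label x = r) := by
      by_cases hrb : r = b
      · subst hrb
        simp only [Moat.absorbed, Function.update_self, hhp, Multiset.mem_add,
          Heap.entries_shift, Multiset.mem_map] at hpe
        rcases hpe with ⟨p', hp', rfl⟩ | hp'
        · refine ⟨a, p'.1, Or.inl ⟨rfl, rfl⟩, hla, hp', ?_, ?_⟩
          · intro x hx hxa
            simp [Moat.absorbed, hma, hx, hxa]
          · intro x hx hxa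
            rw [hl x hx, if_pos hxa]
        · refine ⟨r, p.1, Or.inr rfl, hlr, hp', ?_, ?_⟩
          · intro x hx hxa
            simp [Moat.absorbed, hma, hxa, hab.symm]
          · intro x hx hxa
            rw [hl x hx, hxa, if_neg hab.symm]
      · have hp' : p ∈ (s.parts r).entries := by
          simpa [Moat.absorbed, Function.update_of_ne hrb] using hpe
        refine ⟨r, p.1, Or.inr rfl, hlr, hp', ?_, ?_⟩
        · intro x hx hxa
          simp [Moat.absorbed, hma, hxa, hra]
        · intro x hx hxa
          rw [hl x hx, hxa, if_neg hra]
    have hP := h.piece r₀ hlr₀ _ hp₀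
    have hne : ∀ x y, x ∈ dom → y ∈ dom → (s.absorbed a b hp).label x ≠ (s.absorbed a b hp).label y →
        s.label x ≠ s.label y := by
      intro x y hx hy hxy hxy'
      rw [hl x hx, hl y hy, hxy'] at hxy
      exact hxy rfl
    have key : ∀ x y, x ∈ dom → y ∈ dom → (s.label x = r₀ ∨ s.label y = r₀) →
        (s.absorbed a b hp).label x ≠ (s.absorbed a b hp).label y →
        (s.absorbed a b hp).label x = r → (s.label x = r₀ → Bound cost s k₀ p.2.ver x y) →
        Bound cost (s.absorbed a b hp) p.1 p.2.ver x y := by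
      intro x y hx hy hor hxy hxr hB
      -- One endpoint lay in `r₀`. If that were `y`, both endpoints would now lie in `r`.
      have hx₀ : s.label x = r₀ := hor.elim id fun hy₀ => absurd (hxr.trans (hr₁ y hy hy₀).symm) hxy
      exact (hB hx₀).mono (hk₀ x hx hx₀).ge (h.width_absorbed ha hla hab hy).ge
    refine ⟨hP.u_mem, hP.v_mem, hP.edge_lt, hP.ver_le, ?_, ?_⟩
    · exact hP.label.imp (hr₁ _ hP.u_mem) (hr₁ _ hP.v_mem)
    · intro hver huv
      obtain ⟨h₁, h₂⟩ := hP.bound hver (hne _ _ hP.u_mem hP.v_mem huv)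
      exact ⟨fun h => key _ _ hP.u_mem hP.v_mem hP.label huv h h₁,
        fun h => key _ _ hP.v_mem hP.u_mem hP.label.symm huv.symm h h₂⟩
  · obtain ⟨hra, hr' | hr'⟩ := hact r hr
    · subst hr'
      exact ⟨hb, by rw [hl r hb, hlb, if_neg hab.symm]⟩
    · obtain ⟨h₁, h₂⟩ := h.active_live r hr'
      exact ⟨h₁, by rw [hl r h₁, h₂, if_neg hra]⟩
  · obtain ⟨hra, hr'⟩ := hact r hr
    by_cases hrb : r = b
    · subst hrb
      simp [Moat.absorbed]
    · simpa [Moat.absorbed, Function.update_of_ne hrb] using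
        h.start_le r (hr'.resolve_left hrb)
  · have := h.stamp_le p hp
    by_cases hpa : p.2.1 = a
    · rw [hpa] at this
      simp only [Moat.absorbed, hpa, Function.update_self]
      omega
    · simpa [Moat.absorbed, Function.update_of_ne hpa] using this
  · obtain ⟨hra, hr'⟩ := hact _ h₂
    have hact' := hr'.resolve_left h₃
    have h₁' : p.2.2 = s.stamp p.2.1 := by
      simpa [Moat.absorbed, Function.update_of_ne hra] using h₁
    have := h.due p hp h₁' hact' fun hx => (hX _ hx).elim hra h₃
    simpa [Due, Moat.absorbed, Function.update_of_ne h₃] using this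

/-- Small to large: a vertex of `a` ends up in a cluster of at least twice the size, so its term
falls by one. The terms of vertices of `b` do not grow. The two clusters are disjoint in `dom`,
which keeps the new logarithm below `Nat.log 2 dom.length`, so the truncated subtraction loses
nothing. -/
theorem Inv.relabels_absorbed (h : Inv dom cost E L X s) (ha : a ∈ dom) (hla : s.label a = a)
    (hb : b ∈ dom) (hlb : s.label b = b) (hab : a ≠ b) (hs : s.size a ≤ s.size b) :
    relabels dom (s.absorbed a b hp) + (s.members a).length ≤ relabels dom s := by
  have hma := h.mem_members a ha hla
  have hmb := h.mem_members b hb hlb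
  have hcard : (s.members a).length = ∑ v ∈ dom.toFinset, if v ∈ s.members a then 1 else 0 := by
    rw [← Finset.card_filter, ← List.toFinset_card_of_nodup (h.nodup_members a ha hla)]
    congr 1
    ext v
    simp [hma]
  have hle : s.size a + s.size b ≤ dom.length := by
    rw [h.size_eq a ha hla, h.size_eq b hb hlb, ← List.length_append]
    refine (List.subperm_of_subset (List.nodup_append'.2
      ⟨h.nodup_members a ha hla, h.nodup_members b hb hlb, ?_⟩) ?_).length_le
    · intro x hx hx'
      rw [hma] at hx
      rw [hmb] at hx'
      exact hab (hx.2.symm.trans hx'.2)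
    · intro x hx
      rw [List.mem_append, hma, hmb] at hx
      exact hx.elim And.left And.left
  have hpos : 0 < s.size a := by
    rw [h.size_eq a ha hla]
    exact List.length_pos_of_mem ((hma a).2 ⟨ha, hla⟩)
  have hlog : Nat.log 2 (s.size a) + 1 ≤ Nat.log 2 (s.size a + s.size b) := by
    refine Nat.le_log_of_pow_le one_lt_two ?_
    have := Nat.pow_log_le_self 2 hpos.ne'
    rw [pow_succ]
    omega
  have hlog' : Nat.log 2 (s.size a + s.size b) ≤ Nat.log 2 dom.length := Nat.log_mono_right hle
  rw [hcard]
  unfold relabels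
  rw [← Finset.sum_add_distrib]
  refine Finset.sum_le_sum fun v hv => ?_
  rw [List.mem_toFinset] at hv
  rw [h.label_absorbed ha hla hv]
  by_cases hva : s.label v = a
  · simp only [hva, if_true, hma, hv, true_and]
    simp only [Moat.absorbed, Function.update_self]
    omega
  · simp only [hva, if_false, hma, and_false, add_zero]
    by_cases hvb : s.label v = b
    · simp only [Moat.absorbed, hvb, Function.update_self]
      have : Nat.log 2 (s.size b) ≤ Nat.log 2 (s.size a + s.size b) :=
        Nat.log_mono_right (by omega)
      omega
    · simp [Moat.absorbed, Function.update_of_ne hvb]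

/-- The heap of `a` stays in the array but is no longer counted, because `a` has ceased to be its
own label; the melded heap has exactly the entries of both. -/
theorem Inv.partCount_absorbed (h : Inv dom cost E L X s) (ha : a ∈ dom) (hla : s.label a = a)
    (hlb : s.label b = b) (hab : a ≠ b)
    (hhp : hp.entries = ((s.parts a).shift (s.time b - s.time a)).entries + (s.parts b).entries) :
    (s.absorbed a b hp).partCount ≤ s.partCount := by
  have hs : hp.size = (s.parts a).size + (s.parts b).size := by
    rw [← Heap.card_entries, hhp, Multiset.card_add, Heap.card_entries, Heap.card_entries,
      Heap.size_shift]
  have hlive : ∀ r, (s.absorbed a b hp).label r = r → r ≠ a ∧ s.label r = r := by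
    intro r hr
    by_cases hra : r ∈ s.members a
    · simp only [Moat.absorbed, hra, if_true] at hr
      subst hr
      exact absurd (hlb ▸ ((h.mem_members a ha hla b).1 hra).2).symm hab
    · have hr' : s.label r = r := by simpa [Moat.absorbed, hra] using hr
      refine ⟨?_, hr'⟩
      rintro rfl
      exact hra ((h.mem_members r ha hla r).2 ⟨ha, hla⟩)
  unfold partCount
  set A : Finset (Fin n) := {r | s.label r = r} with hA
  have haA : a ∈ A := by simp [hA, hla]
  have hbA : b ∈ A.erase a := by simp [hA, hlb, hab.symm]
  rw [← Finset.add_sum_erase A _ haA, ← Finset.add_sum_erase (A.erase a) _ hbA]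
  calc _ ≤ ∑ r ∈ A.erase a, ((s.absorbed a b hp).parts r).size := by
        refine Finset.sum_le_sum_of_subset fun r hr => ?_
        simp only [Finset.mem_filter, Finset.mem_univ, true_and] at hr
        simp [hA, hlive r hr]
    _ = hp.size + ∑ r ∈ (A.erase a).erase b, (s.parts r).size := by
        rw [← Finset.add_sum_erase _ _ hbA]
        congr 1
        · simp [Moat.absorbed]
        · refine Finset.sum_congr rfl fun r hr => ?_
          simp [Moat.absorbed, Function.update_of_ne (Finset.ne_of_mem_erase hr)]
    _ ≤ _ := by omega

end Absorb

theorem wp_absorb {dom : List (Fin n)} {cost E L : ℕ} {X : Fin n → Prop} {s : Moat n} {a b : Fin n}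
    (h : Inv dom cost E L X s) (ha : a ∈ dom) (hla : s.label a = a)
    (hb : b ∈ dom) (hlb : s.label b = b) (hab : a ≠ b) (hX : ∀ r, X r → r = a ∨ r = b)
    (hs : s.size a ≤ s.size b) {M : ℕ} (hM : s.work E L ≤ M) :
    (s.absorb a b).Wp fun s' k =>
      k + 2 * relabels dom s' ≤ Heap.opCost M + 5 + 2 * relabels dom s ∧
      Inv dom cost E L (fun r => r = b) s' ∧ s'.work E L ≤ s.work E L ∧
      s'.forest = s.forest := by
  have hMa := (s.size_le_partCount hla).trans (show s.partCount ≤ M by unfold work at hM; omega)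
  have hMb := (s.size_le_partCount hlb).trans (show s.partCount ≤ M by unfold work at hM; omega)
  unfold absorb
  simp only [Comp.wp_bind, Comp.wp_step, Comp.fold_step, Comp.wp_ret]
  refine (Heap.wp_meld_le ((h.parts_wf a).shift _) (h.parts_wf b)
    (by rwa [Heap.size_shift]) hMb).mono ?_
  rintro hp k ⟨h₁, h₂, h₃⟩
  rw [foldl_relabel _ _ _ _ (h.nodup_members a ha hla)]
  change _ + 2 * relabels dom (s.absorbed a b hp) ≤ _ ∧
    Inv _ _ _ _ _ (s.absorbed a b hp) ∧ (s.absorbed a b hp).work E L ≤ _ ∧ _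
  refine ⟨?_, h.absorbed ha hla hb hlb hab hX h₁ h₂, ?_, rfl⟩
  · have := h.relabels_absorbed (hp := hp) ha hla hb hlb hab hs
    omega
  · have := h.partCount_absorbed ha hla hlb hab h₂
    unfold work
    simp only [Moat.absorbed] at this ⊢
    omega

end Moat

end

/-! ### Amortised cost of an event -/

noncomputable section

namespace Moat

variable {n : ℕ} {dom : List (Fin n)} {cost E L : ℕ} {s : Moat n} {r : Fin n} {e : Piece n}

theorem work_incVer {i : ℕ} (hi : i < E) (hL : s.ver i < L) :
    ({ s with ver := Function.update s.ver i (s.ver i + 1) } : Moat n).work E L + 3 =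
      s.work E L := by
  have h := Finset.add_sum_erase (Finset.range E) (fun j => L - s.ver j) (Finset.mem_range.2 hi)
  have h' := Finset.add_sum_erase (Finset.range E)
    (fun j => L - Function.update s.ver i (s.ver i + 1) j) (Finset.mem_range.2 hi)
  have : ∑ j ∈ (Finset.range E).erase i, (L - Function.update s.ver i (s.ver i + 1) j) =
      ∑ j ∈ (Finset.range E).erase i, (L - s.ver j) :=
    Finset.sum_congr rfl fun j hj => by rw [Function.update_of_ne (Finset.ne_of_mem_erase hj)]
  simp only [Function.update_self, this] at h h'
  simp only [work, partCount]
  omega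

/-- A split adds two parts and at most two queue entries, while the higher version releases three
units of `work`: a net gain of at most one, covered by the queue entry and the part that the event
has already removed. -/
theorem wp_split (h : Inv dom cost E L (fun x => x = r) s) (hu : e.u ∈ dom) (hv : e.v ∈ dom)
    (he : e.edge < E) (hr : s.label e.u = r ∨ s.label e.v = r) (hne : s.label e.u ≠ s.label e.v)
    (hL : cost < 2 ^ L) {sl : ℤ} (hsl : sl = s.slack cost e.u e.v) (h2 : 2 ≤ sl)
    (hB : 2 ^ (s.ver e.edge + 1) * (sl - 1) ≤ (cost : ℤ) - 1) {M : ℕ} (hM : s.work E L ≤ M) :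
    (s.split e sl).Wp fun s' k => k ≤ 4 * Heap.opCost M + 10 ∧
      Inv dom cost E L (fun _ => False) s' ∧ s'.work E L ≤ s.work E L + 1 ∧
      relabels dom s' = relabels dom s ∧ s'.forest = s.forest := by
  -- The slack is at least 2, so the bound gives 2^(ver + 1) ≤ cost - 1 < 2^L: the edge may be split
  -- once more.
  have hver : s.ver e.edge < L := by
    have h₁ : (2 : ℤ) ^ (s.ver e.edge + 1) ≤ 2 ^ (s.ver e.edge + 1) * (sl - 1) :=
      le_mul_of_one_le_right (by positivity) (by linarith)
    have h₂ : (2 : ℤ) ^ (s.ver e.edge + 1) < 2 ^ L := by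
      have : (cost : ℤ) < 2 ^ L := by exact_mod_cast hL
      linarith
    have := (pow_lt_pow_iff_right₀ (one_lt_two : (1 : ℤ) < 2)).1 h₂
    omega
  have hw := work_incVer he hver
  have h₁ := h.incVer (i := e.edge) hver
  unfold split
  simp only [Comp.wp_bind, Comp.wp_step]
  set s₁ : Moat n := { s with ver := Function.update s.ver e.edge (s.ver e.edge + 1) } with hs₁
  set e' : Piece n := { e with ver := s.ver e.edge + 1 } with he'
  -- What remains after one half is used up is the rounded-up half. Counting slack minus one makes
  -- the halving exact despite the rounding.
  have hhalf : 2 * (sl - sl / 2 - 1) ≤ sl - 1 := by omega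
  have hBound : ∀ x y : Fin n, s.slack cost x y = sl →
      Bound cost s₁ (s₁.time (s₁.label x) + sl / 2) e'.ver x y := by
    intro x y hxy
    have hs : sl - sl / 2 - 1 =
        cost - (s₁.base x + (s₁.time (s₁.label x) + sl / 2)) - s₁.width y - 1 := by
      rw [← hxy]
      change _ = (cost : ℤ) - (s.base x + (s.time (s.label x) + _)) - s.width y - 1
      unfold slack width
      ring
    unfold Bound
    rw [← hs]
    calc (2 : ℤ) ^ (e'.ver + 1) * (sl - sl / 2 - 1)
        = 2 ^ (s.ver e.edge + 1) * (2 * (sl - sl / 2 - 1)) := by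
          rw [he']
          ring
      _ ≤ 2 ^ (s.ver e.edge + 1) * (sl - 1) := mul_le_mul_of_nonneg_left hhalf (by positivity)
      _ ≤ _ := hB
  have hBu := hBound e.u e.v hsl.symm
  have hBv := hBound e.v e.u (by rw [hsl]; unfold slack; ring)
  have hlu := h.label_label e.u hu
  have hlv := h.label_label e.v hv
  have hPu : PieceOk dom cost E s₁ (s₁.label e'.u) (s₁.time (s₁.label e'.u) + sl / 2) e' :=
    ⟨hu, hv, he, by simp [hs₁, he'], Or.inl rfl, fun _ _ => ⟨fun _ => hBu,
      fun h => absurd h hne.symm⟩⟩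
  have hw₁ : s₁.queue.size + s₁.partCount + 3 ≤ M := by
    have : s₁.queue.size + s₁.partCount ≤ s₁.work E L := by unfold work; omega
    omega
  refine (wp_addPart h₁ hPu (M := M) ((s₁.size_le_partCount hlu).trans (by omega))).mono ?_
  rintro s₂ k₂ ⟨hk₂, ⟨ps₂, rfl⟩, h₂, hp₂⟩
  set s₂ : Moat n := { s₁ with parts := ps₂ } with hs₂
  have hPv : PieceOk dom cost E s₂ (s₂.label e'.v) (s₂.time (s₂.label e'.v) + sl / 2) e' :=
    ⟨hu, hv, he, by simp [hs₂, hs₁, he'], Or.inr rfl, fun _ _ =>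
      ⟨fun h => absurd h hne, fun _ => hBv⟩⟩
  refine (wp_addPart h₂ hPv (M := M) ((s₂.size_le_partCount hlv).trans (by omega))).mono ?_
  rintro s₃ k₃ ⟨hk₃, ⟨ps₃, rfl⟩, h₃, hp₃⟩
  set s₃ : Moat n := { s₂ with parts := ps₃ } with hs₃
  have hq₃ : s₃.queue.size = s₁.queue.size := rfl
  refine (wp_schedule h₃ (s₃.label e'.u) (M := M) (by omega)).mono ?_
  rintro s₄ k₄ ⟨hk₄, ⟨q₄, st₄, rfl⟩, h₄, hq₄⟩
  set s₄ : Moat n := { s₃ with queue := q₄, stamp := st₄ } with hs₄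
  refine (wp_schedule h₄ (s₄.label e'.v) (M := M) (by omega)).mono ?_
  rintro s₅ k₅ ⟨hk₅, ⟨q₅, st₅, rfl⟩, h₅, hq₅⟩
  refine ⟨by omega, h₅.imp ?_, ?_, rfl, rfl⟩
  · rintro x - ⟨⟨rfl, hx⟩, hx'⟩
    -- The exempt cluster `r` holds one of the endpoints, so one of the two calls of `schedule` has
    -- announced it again.
    exact hr.elim (fun h => hx h.symm) (fun h => hx' h.symm)
  · have hp₄ : s₄.partCount = s₃.partCount := rfl
    unfold work at hw ⊢
    change _ + s₃.partCount + 3 * ∑ i ∈ Finset.range E, (L - s₁.ver i) ≤ _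
    dsimp only at hq₅ ⊢
    omega

theorem wp_link (h : Inv dom cost E L (fun x => x = r) s) {u v : Fin n} (hu : u ∈ dom)
    (hv : v ∈ dom) (hr : s.label u = r ∨ s.label v = r) (hne : s.label u ≠ s.label v)
    {M : ℕ} (hM : s.work E L ≤ M) :
    (s.link u v).Wp fun s' k =>
      k + 2 * relabels dom s' ≤ 2 * Heap.opCost M + 10 + 2 * relabels dom s ∧
      Inv dom cost E L (fun _ => False) s' ∧ s'.work E L ≤ s.work E L + 1 ∧
      s'.forest.length = s.forest.length + 1 := by
  -- Both directions of the merger at once, with `a` the smaller cluster.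
  have key : ∀ a b : Fin n, a ∈ dom → b ∈ dom → s.label a = a → s.label b = b → a ≠ b →
      (r = a ∨ r = b) → s.size a ≤ s.size b →
      (do
        let s ← ({ s with forest := (u, v) :: s.forest } : Moat n).absorb a b
        s.schedule b).Wp fun s' k =>
      k + 2 * relabels dom s' ≤ 2 * Heap.opCost M + 7 + 2 * relabels dom s ∧
      Inv dom cost E L (fun _ => False) s' ∧ s'.work E L ≤ s.work E L + 1 ∧
      s'.forest.length = s.forest.length + 1 := by
    intro a b ha hb hla hlb hab hrab hs
    rw [Comp.wp_bind]
    refine (wp_absorb (h.setForest ((u, v) :: s.forest)) ha hla hb hlb hab (by rintro x rfl; exact hrab)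
      hs (M := M) hM).mono ?_
    rintro s₁ k₁ ⟨hk₁, h₁, hw₁, hf₁⟩
    have hq : s₁.queue.size ≤ M := by
      have : s₁.queue.size ≤ s₁.work E L := by unfold work; omega
      exact this.trans (hw₁.trans hM)
    refine (wp_schedule h₁ b hq).mono ?_
    rintro s₂ k₂ ⟨hk₂, ⟨q₂, st₂, rfl⟩, h₂, hq₂⟩
    refine ⟨?_, h₂.imp ?_, ?_, ?_⟩
    · change _ + 2 * relabels dom s₁ ≤ _
      change k₁ + 2 * relabels dom s₁ ≤ Heap.opCost M + 5 + 2 * relabels dom s at hk₁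
      omega
    · rintro x - ⟨hx, hx'⟩
      exact hx' hx
    · have hws : s₁.work E L ≤ s.work E L := hw₁
      refine le_trans ?_ (Nat.add_le_add_right hws 1)
      unfold work
      change _ + s₁.partCount + 3 * ∑ i ∈ Finset.range E, (L - s₁.ver i) ≤ _
      omega
    · simp [hf₁]
  unfold link
  simp only [Comp.wp_bind, Comp.wp_step]
  have ha := h.label_mem u hu
  have hb := h.label_mem v hv
  have hla := h.label_label u hu
  have hlb := h.label_label v hv
  split_ifs with hs
  · refine (key _ _ ha hb hla hlb hne (hr.imp Eq.symm Eq.symm) hs).mono ?_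
    rintro s' k ⟨h₁, h₂⟩
    exact ⟨by omega, h₂⟩
  · refine (key _ _ hb ha hlb hla hne.symm (hr.symm.imp Eq.symm Eq.symm) (not_le.1 hs).le).mono ?_
    rintro s' k ⟨h₁, h₂⟩
    exact ⟨by omega, h₂⟩

theorem wp_edgeEvent (h : Inv dom cost E L (fun x => x = r) s) {k₀ : ℤ}
    (hP : PieceOk dom cost E s r k₀ e) (hk₀ : k₀ ≤ s.time r) (hL : cost < 2 ^ L)
    {M : ℕ} (hM : s.work E L ≤ M) :
    (edgeEvent cost s r e).Wp fun s' k =>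
      k + 2 * relabels dom s' ≤ 4 * Heap.opCost M + 12 + 2 * relabels dom s ∧
      Inv dom cost E L (fun _ => False) s' ∧ s'.work E L ≤ s.work E L + 1 ∧
      s'.forest.length ≤ s.forest.length + 1 := by
  unfold edgeEvent
  simp only [Comp.wp_bind, Comp.wp_step]
  by_cases hvoid : e.ver ≠ s.ver e.edge ∨ s.label e.u = s.label e.v
  · have hq : s.queue.size ≤ M := le_trans (by unfold work; omega) hM
    simp only [hvoid, decide_true, if_true]
    refine (wp_schedule h r hq).mono ?_
    rintro s' k ⟨hk, ⟨q, st, rfl⟩, h', hq'⟩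
    refine ⟨?_, h'.imp ?_, ?_, Nat.le_succ _⟩
    · change _ + 2 * relabels dom s ≤ _
      omega
    · rintro x - ⟨hx, hx'⟩
      exact hx' hx
    · unfold work
      change _ + s.partCount + 3 * ∑ i ∈ Finset.range E, (L - s.ver i) ≤ _
      omega
  · simp only [hvoid, decide_false, Bool.false_eq_true, if_false, Comp.wp_bind, Comp.wp_step]
    obtain ⟨hver, hne⟩ := not_or.1 hvoid
    rw [not_not] at hver
    -- The part has expired, so the moat on its side is at least as wide as its key foresaw, and the
    -- slack is at most the quantity in `Bound`.
    have hB : 2 ^ (s.ver e.edge + 1) * (s.slack cost e.u e.v - 1) ≤ (cost : ℤ) - 1 := by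
      obtain ⟨h₁, h₂⟩ := hP.bound hver hne
      rw [← hver]
      have hpow : (0 : ℤ) ≤ 2 ^ (e.ver + 1) := by positivity
      rcases hP.label with hl | hl
      · refine le_trans (mul_le_mul_of_nonneg_left ?_ hpow) (h₁ hl)
        simp only [slack]
        have : s.width e.u = s.base e.u + s.time r := by rw [width, hl]
        linarith
      · refine le_trans (mul_le_mul_of_nonneg_left ?_ hpow) (h₂ hl)
        simp only [slack]
        have : s.width e.v = s.base e.v + s.time r := by rw [width, hl]
        linarith
    split_ifs with hsl
    · refine (wp_link h hP.u_mem hP.v_mem hP.label hne hM).mono ?_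
      rintro s' k ⟨h₁, h₂, h₃, h₄⟩
      exact ⟨by omega, h₂, h₃, h₄.le⟩
    · refine (wp_split h hP.u_mem hP.v_mem hP.edge_lt hP.label hne hL rfl (by omega) hB hM).mono ?_
      rintro s' k ⟨h₁, h₂, h₃, h₄, h₅⟩
      exact ⟨by omega, h₂, h₃, by rw [h₅]; omega⟩

/-- An upper bound for the number of steps that the moat growing is still going to take. -/
def potential (dom : List (Fin n)) (E L M : ℕ) (s : Moat n) : ℕ :=
  13 * Heap.opCost M * (s.work E L + 1) + 2 * relabels dom s

/-- Every continuing event lowers `work` by at least one, and one unit pays for six heap operations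
and the constants, the relabelling being paid by `relabels`. An event adds at most one forest edge,
so `work` plus the length of the forest never grows; this bounds the forest without any appeal to
acyclicity. -/
theorem wp_event (h : Inv dom cost E L (fun _ => False) s) (hL : cost < 2 ^ L) {M : ℕ}
    (hM : s.work E L + s.forest.length ≤ M) :
    (event cost s).Wp fun x k => match x with
      | Sum.inl s' => s'.forest.length ≤ M ∧ k + 1 ≤ potential dom E L M s
      | Sum.inr s' => (Inv dom cost E L (fun _ => False) s' ∧
          s'.work E L + s'.forest.length ≤ M) ∧
          potential dom E L M s' + k + 1 ≤ potential dom E L M s := by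
  have hH : 3 ≤ Heap.opCost M := by unfold Heap.opCost; omega
  have hq : s.queue.size ≤ M := le_trans (by unfold work; omega) hM
  have hbase : 13 * Heap.opCost M ≤ potential dom E L M s :=
    (Nat.le_mul_of_pos_right _ (Nat.succ_pos _)).trans (Nat.le_add_right _ _)
  have hpot : ∀ (s' : Moat n) (k : ℕ), s'.work E L + 1 ≤ s.work E L →
      k + 2 * relabels dom s' + 1 ≤ 13 * Heap.opCost M + 2 * relabels dom s →
      potential dom E L M s' + k + 1 ≤ potential dom E L M s := by
    intro s' k hw hk
    have := Nat.mul_le_mul_left (13 * Heap.opCost M) (Nat.succ_le_succ hw)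
    unfold potential
    simp only [Nat.succ_eq_add_one, mul_add] at this ⊢
    omega
  unfold event
  simp only [Comp.wp_bind, Comp.wp_step]
  by_cases hfin : s.alive ≤ 1
  · simp only [hfin, decide_true, if_true, Comp.wp_pure]
    exact ⟨by omega, by omega⟩
  simp only [hfin, decide_false, Bool.false_eq_true, if_false, Comp.wp_bind]
  refine (Heap.wp_pop h.queue_wf hq).mono ?_
  rintro (_ | ⟨key, ⟨r, st⟩, q⟩) k₁ ⟨hk₁, hpop⟩
  · rw [Comp.wp_pure]
    exact ⟨by omega, by omega⟩
  obtain ⟨hq₁, hq₂, -⟩ := hpop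
  have hqs : q.size + 1 = s.queue.size := by simp [← Heap.card_entries, hq₂]
  have h₁ := h.setQueue hq₁ fun p hp => hq₂ ▸ Multiset.mem_cons_of_mem hp
  simp only [Comp.wp_bind, Comp.wp_step]
  set s₁ : Moat n := { s with queue := q } with hs₁
  have hw₁ : s₁.work E L + 1 = s.work E L := by
    unfold work
    change q.size + s.partCount + 3 * ∑ i ∈ Finset.range E, (L - s.ver i) + 1 = _
    omega
  split_ifs with hvoid
  · rw [Comp.wp_pure]
    refine ⟨⟨h₁, ?_⟩, hpot _ _ hw₁.le ?_⟩
    · change s₁.work E L + s.forest.length ≤ M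
      omega
    · change _ + 2 * relabels dom s + 1 ≤ _
      omega
  simp only [ne_eq, Bool.or_eq_true, decide_eq_true_eq, Bool.not_eq_true', not_or, not_not,
    Bool.not_eq_false] at hvoid
  obtain ⟨hst, hact⟩ := hvoid
  simp only [Comp.wp_bind, Comp.wp_step]
  have h₂ := h₁.setNow key
  have hdue : s.Due r (s.clock r + (key - s.start r)) :=
    h.due (key, r, st) (hq₂ ▸ Multiset.mem_cons_self _ _) hst hact id
  set s₂ : Moat n := { s₁ with now := max s₁.now key } with hs₂
  have hw₂ : s₂.work E L = s₁.work E L := rfl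
  -- The global time is now at least `key`, so the clock of `r` has reached the announced value.
  have hdue₂ : s₂.Due r (s₂.time r) := by
    refine Due.mono (s := s₂) hdue ?_
    have : s₂.time r = s.clock r + (max s.now key - s.start r) := by
      simp [time, hs₂, hs₁, hact]
    rw [this]
    have := le_max_right s.now key
    linarith
  have hkill : ∀ k, k + 1 ≤ 13 * Heap.opCost M →
      (Inv dom cost E L (fun _ => False) (s₂.killed r) ∧
        (s₂.killed r).work E L + (s₂.killed r).forest.length ≤ M) ∧
        potential dom E L M (s₂.killed r) + k + 1 ≤ potential dom E L M s := by
    intro k hk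
    refine ⟨⟨h₂.killed r, ?_⟩, hpot _ _ hw₁.le ?_⟩
    · change s₁.work E L + s.forest.length ≤ M
      omega
    · change _ + 2 * relabels dom s + 1 ≤ _
      omega
  split_ifs with hdead
  · simp only [kill_eq, Comp.wp_bind, Comp.wp_step, Comp.wp_pure]
    exact hkill _ (by omega)
  have hdead : ¬ s₂.death r ≤ s₂.time r := by simpa using hdead
  rw [Comp.wp_bind]
  -- The cluster is not dead, so some part has expired; the part of least key popped below has then
  -- expired too.
  obtain ⟨p₀, hp₀, hp₀'⟩ := hdue₂.resolve_left hdead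
  have hlr : s₂.label r = r := (h₂.active_live r hact).2
  have hps : (s₂.parts r).size ≤ M := by
    refine (s₂.size_le_partCount hlr).trans ?_
    have : s₂.partCount ≤ s₂.work E L := by unfold work; omega
    omega
  refine (Heap.wp_pop (h₂.parts_wf r) hps).mono ?_
  rintro (_ | ⟨k₀, e, hp⟩) k₂ ⟨hk₂, hpop⟩
  · simp only [kill_eq, Comp.wp_bind, Comp.wp_step, Comp.wp_pure]
    exact hkill _ (by omega)
  obtain ⟨hp₁, hp₂, hmin⟩ := hpop
  simp only [Comp.wp_bind, Comp.wp_step, Comp.wp_pure]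
  have h₃ : Inv dom cost E L (fun x => x = r)
      { s₂ with parts := Function.update s₂.parts r hp } :=
    (h₂.imp (fun _ _ h => h.elim)).setParts hp₁
      (fun _ p hp => Or.inl (hp₂ ▸ Multiset.mem_cons_of_mem hp)) (Or.inl rfl)
  have hP : PieceOk dom cost E s₂ r k₀ e :=
    h₂.piece r hlr (k₀, e) (hp₂ ▸ Multiset.mem_cons_self _ _)
  set s₃ : Moat n := { s₂ with parts := Function.update s₂.parts r hp } with hs₃
  have hpc : s₃.partCount + 1 = s₂.partCount := by
    have hsz : hp.size + 1 = (s₂.parts r).size := by simp [← Heap.card_entries, hp₂]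
    have hmem : r ∈ ({x | s₂.label x = x} : Finset (Fin n)) := by simp [hlr]
    unfold partCount
    change ∑ x with s₂.label x = x, (Function.update s₂.parts r hp x).size + 1 = _
    rw [← Finset.add_sum_erase _ _ hmem, ← Finset.add_sum_erase _ _ hmem, Function.update_self,
      ← hsz, Finset.sum_congr rfl fun x hx => by
        rw [Function.update_of_ne (Finset.ne_of_mem_erase hx)]]
    omega
  have hw₃ : s₃.work E L + 2 = s.work E L := by
    unfold work at hw₁ ⊢
    change q.size + s₃.partCount + 3 * ∑ i ∈ Finset.range E, (L - s.ver i) + 2 = _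
    change q.size + s₂.partCount + 3 * ∑ i ∈ Finset.range E, (L - s.ver i) + 1 = _ at hw₁
    omega
  refine (wp_edgeEvent h₃ (hP.of_width rfl rfl rfl fun _ => le_rfl)
    ((hmin p₀ hp₀).trans hp₀') hL (M := M) (by omega)).mono ?_
  rintro s' k ⟨h₅, h₆, h₇, h₈⟩
  change s'.forest.length ≤ s.forest.length + 1 at h₈
  change k + 2 * relabels dom s' ≤ 4 * Heap.opCost M + 12 + 2 * relabels dom s at h₅
  exact ⟨⟨h₆, by omega⟩, hpot _ _ (by omega) (by omega)⟩

end Moat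

end

/-! ### Initial state, traversal, pruning, and one Steiner tree computation -/

noncomputable section

variable {n : ℕ}

theorem foldl_update {β : Type} (f : Fin n → β) : ∀ (l : List (Fin n)) (g : Fin n → β),
    l.foldl (fun g v => Function.update g v (f v)) g = fun x => if x ∈ l then f x else g x
  | [], g => by simp
  | v :: l, g => by
    rw [List.foldl_cons, foldl_update f l]
    funext x
    by_cases hx : x = v
    · subst hx
      simp
    · simp [hx]

theorem alloc_eq {β : Type} (dom : List (Fin n)) (d : β) :
    alloc dom d = ret (fun _ => d) (2 * dom.length + 1) := by
  unfold alloc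
  rw [Comp.fold_step, foldl_update fun _ => d]
  simp

namespace Moat

/-- The state in which every vertex is a cluster, before the edges are inserted. -/
def initial (dom : List (Fin n)) (active : Fin n → Bool) (death : Fin n → ℤ) (alive : ℕ) :
    Moat n :=
  { now := 0, label := id, members := fun v => if v ∈ dom then [v] else [], size := fun _ => 1
    base := fun _ => 0, active, clock := fun _ => 0, start := fun _ => 0, death
    parts := fun _ => Heap.nil, stamp := fun _ => 0, ver := fun _ => 0, queue := Heap.nil, alive
    forest := [] }

theorem inv_initial (dom : List (Fin n)) (active : Fin n → Bool) (death : Fin n → ℤ) (alive : ℕ)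
    (cost E L : ℕ) (ha : ∀ v, active v → v ∈ dom) :
    Inv dom cost E L (fun _ => False) (initial dom active death alive) where
  label_mem v hv := hv
  label_label v _ := rfl
  mem_members r hr _ v := by
    simp only [initial, hr, if_true, List.mem_singleton, id]
    exact ⟨fun h => ⟨h ▸ hr, h⟩, And.right⟩
  nodup_members r hr _ := by simp [initial, hr]
  size_eq r hr _ := by simp [initial, hr]
  parts_wf _ := trivial
  queue_wf := trivial
  piece r _ p hp := by simp [initial, Heap.entries] at hp
  active_live r hr := ⟨ha r hr, rfl⟩
  start_le _ _ := le_rfl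
  stamp_le p hp := by simp [initial, Heap.entries] at hp
  due p hp := by simp [initial, Heap.entries] at hp
  ver_le _ := Nat.zero_le _

/-- The three terms of `hM` are the initial `work`: at most one announcement per vertex, two parts
per edge, and `L` splits per edge at weight three. -/
theorem wp_init (dom : List (Fin n)) (edges : List (Fin n × Fin n)) (p : Fin n → ℕ) (cost L : ℕ)
    (hdom : ∀ uv ∈ edges, uv.1 ∈ dom ∧ uv.2 ∈ dom) {M : ℕ}
    (hM : dom.length + 2 * edges.length + 3 * (edges.length * L) ≤ M) :
    (init dom edges p cost).Wp fun s k => Inv dom cost edges.length L (fun _ => False) s ∧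
      s.work edges.length L + s.forest.length ≤ M ∧
      relabels dom s ≤ dom.length * Nat.log 2 dom.length ∧
      k ≤ (Heap.opCost M + 25) * dom.length + (2 * Heap.opCost M + 8) * edges.length + 14 := by
  unfold init
  simp only [Comp.wp_bind, alloc_eq, Comp.fold_step, Comp.wp_ret, Comp.wp_step]
  rw [foldl_update (fun v => v), foldl_update (fun v => [v]),
    foldl_update (fun v => decide (0 < p v)), foldl_update (fun v => (p v : ℤ))]
  generalize dom.foldl (fun k v => if 0 < p v then k + 1 else k) 0 = alive
  have hlabel : (fun x => if x ∈ dom then x else id x) = (id : Fin n → Fin n) := by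
    funext x
    simp
  rw [hlabel]
  set s₀ := initial dom (fun x => if x ∈ dom then decide (0 < p x) else false)
    (fun x => if x ∈ dom then (p x : ℤ) else 0) alive with hs₀
  have h₀ : Inv dom cost edges.length L (fun _ => False) s₀ := by
    refine inv_initial _ _ _ _ _ _ _ fun v hv => ?_
    by_contra hv'
    simp [hv'] at hv
  refine (Comp.wp_fold_le
    (fun l (x : Moat n × ℕ) => x.2 + l.length = edges.length ∧
      (∀ uv ∈ l, uv.1 ∈ dom ∧ uv.2 ∈ dom) ∧ (∃ ps, x.1 = { s₀ with parts := ps }) ∧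
      Inv dom cost edges.length L (fun _ => False) x.1 ∧
      x.1.partCount + 2 * l.length ≤ 2 * edges.length)
    (2 * Heap.opCost M + 7) ?_ edges (s₀, 0) ?_).mono ?_
  · rintro l uv ⟨s, i⟩ ⟨hi, hd, ⟨ps, hs⟩, hInv, hc⟩
    dsimp only at hs hi hInv hc
    have hver : Function.update s.ver i 0 = s.ver := by
      rw [hs]
      exact Function.update_eq_self i _
    obtain ⟨hu, hv⟩ := hd uv List.mem_cons_self
    have htime : ∀ r, ∀ ps', ({ s with parts := ps' } : Moat n).time r = 0 := by
      intro r ps'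
      rw [hs]
      simp [time, hs₀, initial]
    -- All clocks and bases are zero, so the claim is 2 * (cost - cost / 2 - 1) ≤ cost - 1, rounding
    -- included.
    have hbound : ∀ ps' x y, Bound cost ({ s with parts := ps' } : Moat n)
        (({ s with parts := ps' } : Moat n).time (s.label x) + cost / 2) 0 x y := by
      intro ps' x y
      unfold Bound width
      rw [htime, htime]
      have hb : s.base = fun _ => 0 := by rw [hs]; rfl
      simp only [hb]
      omega
    have hP : ∀ ps' x, (s.label uv.1 = s.label x ∨ s.label uv.2 = s.label x) →
        PieceOk dom cost edges.length ({ s with parts := ps' } : Moat n) (s.label x)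
          (({ s with parts := ps' } : Moat n).time (s.label x) + cost / 2)
          { edge := i, u := uv.1, v := uv.2, ver := 0 } := by
      intro ps' x hx
      refine ⟨hu, hv, ?_, Nat.zero_le _, hx, fun _ hne => ⟨fun h => ?_, fun h => ?_⟩⟩
      · simp only [List.length_cons] at hi
        dsimp only
        omega
      · rw [← h]
        exact hbound ps' uv.1 uv.2
      · rw [← h]
        exact hbound ps' uv.2 uv.1
    simp only [List.length_cons] at hc
    simp only [Comp.wp_bind, Comp.wp_step]
    rw [hver]
    change (s.addPart _ _ _).Wp _
    have hlab : ∀ x, s.label (s.label x) = s.label x := fun x => by rw [hs]; rfl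
    refine (wp_addPart hInv (hP s.parts uv.1 (Or.inl rfl)) (M := M)
      ((s.size_le_partCount (hlab _)).trans (by omega))).mono ?_
    rintro s₂ k₂ ⟨hk₂, ⟨ps₂, rfl⟩, h₂, hp₂⟩
    refine (wp_addPart h₂ (hP ps₂ uv.2 (Or.inr rfl)) (M := M)
      ((size_le_partCount ({ s with parts := ps₂ } : Moat n) (hlab _)).trans (by omega))).mono ?_
    rintro s₃ k₃ ⟨hk₃, ⟨ps₃, rfl⟩, h₃, hp₃⟩
    simp only [List.length_cons] at hi
    refine ⟨⟨?_, fun e he => hd e (List.mem_cons_of_mem _ he), ⟨ps₃, ?_⟩, h₃, ?_⟩, ?_⟩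
    · omega
    · simp only [hs]
    · dsimp only at hp₂ hp₃ ⊢
      omega
    · omega
  · exact ⟨by simp, hdom, ⟨_, rfl⟩, h₀, by simp [partCount, hs₀, initial, Heap.size]⟩
  · rintro ⟨s, i⟩ k₁ ⟨⟨-, -, ⟨ps, hs⟩, hInv, hc⟩, hk₁⟩
    dsimp only at hs hInv hc ⊢
    simp only [List.length_nil, mul_zero, add_zero] at hc
    have hver : s.ver = fun _ => 0 := by rw [hs]; rfl
    refine (Comp.wp_fold_le
      (fun l (t : Moat n) => Inv dom cost edges.length L (fun _ => False) t ∧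
        (∃ q st, t = { s with queue := q, stamp := st }) ∧
        t.queue.size + l.length ≤ dom.length)
      (Heap.opCost M + 2) ?_ dom s ?_).mono ?_
    · rintro l v t ⟨ht, ⟨q, st, rfl⟩, hq⟩
      simp only [List.length_cons] at hq
      refine (wp_schedule ht v (M := M) (by dsimp only; omega)).mono ?_
      rintro t' k ⟨hk, ⟨q', st', rfl⟩, ht', hq'⟩
      exact ⟨⟨ht'.imp fun _ _ h => h.1, ⟨q', st', rfl⟩, by dsimp only at hq' ⊢; omega⟩, hk⟩
    · refine ⟨hInv, ⟨s.queue, s.stamp, rfl⟩, ?_⟩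
      have : s.queue.size = 0 := by rw [hs]; rfl
      omega
    · rintro t k₂ ⟨⟨ht, ⟨q, st, rfl⟩, hq⟩, hk₂⟩
      refine ⟨ht, ?_, ?_, ?_⟩
      · have hf : s.forest = [] := by rw [hs]; rfl
        have hsum : ∑ i ∈ Finset.range edges.length, (L - s.ver i) = edges.length * L := by
          simp [hver]
        change q.size + s.partCount + 3 * ∑ i ∈ Finset.range edges.length, (L - s.ver i) +
          s.forest.length ≤ M
        rw [hsum, hf]
        simp only [List.length_nil] at hq ⊢
        omega
      · unfold relabels
        refine (Finset.sum_le_card_nsmul _ _ (Nat.log 2 dom.length)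
          fun v _ => Nat.sub_le _ _).trans ?_
        rw [smul_eq_mul]
        exact Nat.mul_le_mul_right _ (List.toFinset_card_le dom)
      · simp only [add_mul] at hk₁ hk₂ ⊢
        omega

end Moat

theorem foldl_cons {α β : Type} (f : α → β) : ∀ (l : List α) (s : List β),
    l.foldl (fun s x => f x :: s) s = (l.map f).reverse ++ s
  | [], s => rfl
  | x :: l, s => by simp [foldl_cons f l]

theorem foldl_cons_self {α : Type} (l s : List α) :
    l.foldl (fun s x => x :: s) s = l.reverse ++ s := by
  simp

theorem wp_traverse (dom : List (Fin n)) (forest : List (Fin n × Fin n)) :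
    (traverse dom forest).Wp fun F k => (F.map Prod.fst).Nodup ∧
      F.length ≤ dom.length + 2 * forest.length ∧
      k ≤ 10 * dom.length + 15 * forest.length + 6 := by
  unfold traverse
  simp only [Comp.wp_bind, alloc_eq, Comp.wp_ret]
  refine (Comp.wp_fold_le
    (fun l (g : Fin n → List (Fin n)) => ∑ v, (g v).length + 2 * l.length = 2 * forest.length)
    2 ?_ forest _ (by simp)).mono ?_
  · intro l uv g hg
    have hsum : ∀ (g : Fin n → List (Fin n)) (x y : Fin n),
        ∑ v, (Function.update g x (y :: g x) v).length = ∑ v, (g v).length + 1 := by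
      intro g x y
      have : ∀ v, (Function.update g x (y :: g x) v).length =
          (g v).length + if v = x then 1 else 0 := by
        intro v
        by_cases hv : v = x
        · subst hv
          simp
        · simp [hv]
      rw [Finset.sum_congr rfl fun v _ => this v, Finset.sum_add_distrib]
      simp
    simp only [Comp.wp_bind, Comp.wp_step, List.length_cons] at hg ⊢
    exact ⟨by rw [hsum, hsum]; omega, le_rfl⟩
  intro adj k₁ ⟨hadj, hk₁⟩
  simp only [List.length_nil, mul_zero, add_zero] at hadj
  simp only [Comp.wp_ret, Comp.fold_step]
  rw [foldl_cons (fun v => (v, none))]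
  set B := dom.length + 2 * forest.length with hB
  -- A stack entry is worth the 4 steps of handling it. An adjacency entry of an unseen vertex is
  -- worth 6: two for pushing it and four for the stack entry it becomes. Adjacency lists are
  -- scanned only at first visits, so cycles in `forest` do no harm.
  refine (Comp.wp_loop
    (fun x : Tree n × (Fin n → Bool) × Tree n => (x.2.2.map Prod.fst).Nodup ∧
      (∀ v ∈ x.2.2.map Prod.fst, x.2.1 v = true) ∧
      x.2.2.length + x.1.length + ∑ v with x.2.1 v = false, (adj v).length ≤ B)
    (fun x => 4 * x.1.length + 6 * ∑ v with x.2.1 v = false, (adj v).length + 2)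
    (fun F => (F.map Prod.fst).Nodup ∧ F.length ≤ B) ?_ _ ?_).mono ?_
  · rintro ⟨stack, seen, order⟩ ⟨h₁, h₂, h₃⟩
    dsimp only at h₁ h₂ h₃
    rcases stack with _ | ⟨⟨v, par⟩, st⟩
    · simp only [Comp.wp_step]
      exact ⟨⟨h₁, by omega⟩, by omega⟩
    · simp only [Comp.wp_bind, Comp.wp_step, List.length_cons] at h₃ ⊢
      split_ifs with hv
      · simp only [Comp.wp_pure]
        exact ⟨⟨h₁, h₂, by omega⟩, by omega⟩
      · simp only [Comp.wp_bind, Comp.wp_ret, Comp.wp_step]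
        rw [foldl_cons (fun w => (w, some v))]
        have hvs : seen v = false := by simpa using hv
        have hsum : ∑ w with Function.update seen v true w = false, (adj w).length +
            (adj v).length = ∑ w with seen w = false, (adj w).length := by
          have hmem : v ∈ ({w | seen w = false} : Finset (Fin n)) := by simp [hvs]
          rw [← Finset.sum_erase_add _ _ hmem]
          congr 2
          ext w
          by_cases hw : w = v
          · subst hw
            simp
          · simp [hw]
        simp only [List.length_append, List.length_reverse, List.length_map, List.length_cons]
        refine ⟨⟨?_, ?_, by omega⟩, by omega⟩
        · simp only [List.map_cons, List.nodup_cons]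
          exact ⟨fun h => hv (h₂ v h), h₁⟩
        · intro w hw
          by_cases hwv : w = v
          · subst hwv
            simp
          · simp only [List.map_cons, List.mem_cons, hwv, false_or] at hw
            simpa [Function.update_of_ne hwv] using h₂ w hw
  · simp only [List.map_nil, List.nodup_nil, List.not_mem_nil, false_implies, implies_true,
      true_and, List.length_nil, List.length_append, List.length_reverse, List.length_map,
      Finset.filter_true, hadj]
    omega
  · rintro F k ⟨⟨h₁, h₂⟩, hk⟩
    refine ⟨h₁, h₂, ?_⟩
    simp only [List.length_append, List.length_reverse, List.length_map, List.length_nil,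
      Finset.filter_true, hadj] at hk
    omega

theorem wp_prune (dom : List (Fin n)) (p : Fin n → ℕ) (cost : ℕ) (forest : List (Fin n × Fin n)) :
    (prune dom p cost forest).Wp fun F k => (F.map Prod.fst).Nodup ∧
      F.length ≤ dom.length + 2 * forest.length ∧
      k ≤ 25 * dom.length + 33 * forest.length + 14 := by
  unfold prune
  simp only [Comp.wp_bind]
  refine (wp_traverse dom forest).mono ?_
  rintro order k₀ ⟨hnd, hlen, hk₀⟩
  simp only [alloc_eq, Comp.wp_ret, Comp.fold_step]
  refine (Comp.wp_fold_le (fun _ _ => True) 2 ?_ order _ trivial).mono ?_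
  · rintro l ⟨v, par⟩ ⟨worth, keep, best⟩ -
    simp only [Comp.wp_bind, Comp.wp_step]
    rcases par with _ | u
    · simp
    · dsimp only
      split_ifs <;> simp
  rintro ⟨worth, keep, best⟩ k₁ ⟨-, hk₁⟩
  rcases best with _ | ⟨root, w⟩
  · simp only [Comp.wp_step, List.map_nil, List.nodup_nil, List.length_nil, true_and]
    exact ⟨Nat.zero_le _, by omega⟩
  dsimp only
  simp only [Comp.wp_bind, Comp.wp_ret]
  rw [foldl_cons_self]
  -- Entries move from the unread list to the tree or are dropped, so the vertices of both together
  -- stay distinct.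
  refine (Comp.wp_fold_le (fun l (x : (Fin n → Bool) × Tree n) =>
    (l.map Prod.fst ++ x.2.map Prod.fst).Nodup ∧ l.length + x.2.length ≤ order.length) 1 ?_ _ _
    ?_).mono ?_
  · rintro l ⟨v, par⟩ ⟨inside, tree⟩ ⟨h₁, h₂⟩
    simp only [List.length_cons] at h₂
    have h₁' : (l.map Prod.fst ++ (v :: tree.map Prod.fst)).Nodup := by
      refine (List.Perm.nodup_iff ?_).1 h₁
      simpa using List.perm_middle.symm
    have h₁'' : (l.map Prod.fst ++ tree.map Prod.fst).Nodup := by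
      simp only [List.map_cons, List.cons_append, List.nodup_cons] at h₁
      exact h₁.2
    dsimp only
    split_ifs with hr
    · simp only [Comp.wp_step, List.map_cons, List.length_cons]
      exact ⟨⟨h₁', by omega⟩, le_rfl⟩
    · rcases par with _ | u
      · simp only [Comp.wp_step]
        exact ⟨⟨h₁'', by omega⟩, le_rfl⟩
      · dsimp only
        split_ifs
        · simp only [Comp.wp_step, List.map_cons, List.length_cons]
          exact ⟨⟨h₁', by omega⟩, le_rfl⟩
        · simp only [Comp.wp_step]
          exact ⟨⟨h₁'', by omega⟩, le_rfl⟩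
  · simpa [List.map_reverse] using hnd
  rintro ⟨inside, tree⟩ k₂ ⟨⟨h₁, h₂⟩, hk₂⟩
  simp only [List.map_nil, List.nil_append, List.length_nil, zero_add] at h₁ h₂
  simp only
  rw [foldl_cons_self]
  simp only [List.append_nil, List.length_reverse, List.map_reverse,
    List.nodup_reverse] at hk₂ ⊢
  exact ⟨h₁, h₂.trans hlen, by omega⟩

/-- The cost of the prize-collecting Steiner tree algorithm, and of operations on its result. -/
def treeBound (M : ℕ) : ℕ := 100 * Heap.opCost M * (M + 1)

theorem wp_pcst (dom : List (Fin n)) (edges : List (Fin n × Fin n)) (p : Fin n → ℕ) (cost L : ℕ)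
    (hdom : ∀ uv ∈ edges, uv.1 ∈ dom ∧ uv.2 ∈ dom) (hL : cost < 2 ^ L) {M : ℕ}
    (hM : dom.length + 2 * edges.length + 3 * (edges.length * L) ≤ M) :
    (pcst dom edges p cost).Wp fun F k => (F.map Prod.fst).Nodup ∧
      F.length ≤ 3 * M ∧ k ≤ treeBound M := by
  unfold pcst
  simp only [Comp.wp_bind]
  refine (Moat.wp_init dom edges p cost L hdom hM).mono ?_
  rintro s k₁ ⟨hs, hw, hr, hk₁⟩
  refine (Comp.wp_loop (fun s => Moat.Inv dom cost edges.length L (fun _ => False) s ∧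
      s.work edges.length L + s.forest.length ≤ M)
    (Moat.potential dom edges.length L M) (fun s' => s'.forest.length ≤ M)
    (fun s hs => (Moat.wp_event hs.1 hL hs.2).mono fun x k h => by cases x <;> exact h) s ⟨hs, hw⟩).mono ?_
  rintro s' k₂ ⟨hf, hk₂⟩
  refine (wp_prune dom p cost s'.forest).mono ?_
  rintro F k₃ ⟨h₁, h₂, hk₃⟩
  refine ⟨h₁, by omega, ?_⟩
  have hd : dom.length ≤ M := by omega
  have hE : 2 * edges.length ≤ M := by omega
  have hlog : 2 * Nat.log 2 dom.length ≤ Heap.opCost M := by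
    have : Nat.log 2 dom.length ≤ Nat.log 2 (M + 1) := Nat.log_mono_right (by omega)
    unfold Heap.opCost
    omega
  have hH : 3 ≤ Heap.opCost M := by unfold Heap.opCost; omega
  set H := Heap.opCost M
  -- At the start `work` is at most `M`, and the logarithm in `relabels` is absorbed by the cost of
  -- a heap operation.
  have e₁ : k₂ ≤ 13 * H * (M + 1) + H * M := by
    refine hk₂.trans (Nat.add_le_add ?_ ?_)
    · exact Nat.mul_le_mul_left _ (by omega)
    · calc 2 * Moat.relabels dom s ≤ 2 * (dom.length * Nat.log 2 dom.length) := by omega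
        _ = 2 * Nat.log 2 dom.length * dom.length := by ring
        _ ≤ H * M := Nat.mul_le_mul hlog hd
  have e₂ : k₁ ≤ (H + 25) * M + (H + 4) * M + 14 := by
    refine hk₁.trans ?_
    have := Nat.mul_le_mul_left (H + 25) hd
    have : (2 * H + 8) * edges.length = (H + 4) * (2 * edges.length) := by ring
    have := Nat.mul_le_mul_left (H + 4) hE
    omega
  unfold treeBound
  nlinarith

end

/-! ### Linear-time operations on trees and vertex lists -/

noncomputable section

variable {n : ℕ}

theorem Comp.tabulate_step {β : Type} (d : β) (f : Fin n → β) :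
    tabulate d (fun v => step (f v)) = ret f (3 * n + 1) := by
  unfold tabulate
  have : (fun (g : Fin n → β) v => do
      let y ← step (f v)
      step (Function.update g v y)) = fun g v => ret (Function.update g v (f v)) 2 := by
    funext g v
    rw [Comp.step_eq]
    exact Comp.ret_bind_ret _ _ (fun y => step (Function.update g v y)) _ _ rfl
  rw [this, Comp.fold_ret, foldl_update, List.length_finRange]
  congr 1
  funext x
  simp

theorem wp_treeCost (F : Tree n) : (treeCost F).Wp fun _ k => k ≤ 2 * F.length + 2 := by
  unfold treeCost
  simp only [Comp.wp_bind, Comp.fold_step, Comp.wp_ret, Comp.wp_step, le_refl]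

theorem wp_vertices (F : Tree n) :
    (vertices F).Wp fun l k => l.length = F.length ∧ k ≤ 2 * F.length + 1 := by
  unfold vertices
  simp only [Comp.fold_step, Comp.wp_ret, le_refl, and_true]
  rw [foldl_cons Prod.fst]
  simp

theorem wp_prize (p : Fin n → ℕ) (l : List (Fin n)) :
    (prize p l).Wp fun _ k => k ≤ 2 * l.length + 1 := by
  unfold prize
  simp only [Comp.fold_step, Comp.wp_ret, le_refl]

theorem wp_orSingle (p : Fin n → ℕ) (l : List (Fin n)) :
    (orSingle p l).Wp fun l' k => l'.length ≤ l.length + 1 ∧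
      k ≤ 2 * n + 2 * l.length + 3 := by
  unfold orSingle
  simp only [Comp.wp_bind, Comp.fold_step, Comp.wp_ret, List.length_finRange]
  refine (wp_prize p l).mono fun val k hk => ?_
  split
  · simp only [Comp.wp_step]
    omega
  · simp only [Comp.wp_step]
    split_ifs <;> simp <;> omega

/-- The bound by `2 * edges.length` keeps isolated vertices out of the logarithmic factors; the
bound by `n` limits the total prize, hence the range of the bisection. -/
theorem wp_support (edges : List (Fin n × Fin n)) :
    (support n edges).Wp fun dom k => (∀ uv ∈ edges, uv.1 ∈ dom ∧ uv.2 ∈ dom) ∧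
      dom.length ≤ 2 * edges.length ∧ dom.length ≤ n ∧ k ≤ 5 * n + 3 * edges.length + 3 := by
  unfold support
  simp only [Comp.wp_bind, Comp.tabulate_step, Comp.wp_ret]
  refine (Comp.wp_fold_le (fun l (mark : Fin n → Bool) =>
    (∀ uv ∈ edges, uv ∈ l ∨ mark uv.1 = true ∧ mark uv.2 = true) ∧ (∀ uv ∈ l, uv ∈ edges) ∧
      ∀ v, mark v = true → v ∈ edges.map Prod.fst ++ edges.map Prod.snd) 2 ?_ edges _ ?_).mono ?_
  · rintro l uv mark ⟨h₁, h₂, h₃⟩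
    simp only [Comp.wp_bind, Comp.wp_step]
    have hmark : ∀ v, Function.update (Function.update mark uv.1 true) uv.2 true v = true ↔
        mark v = true ∨ v = uv.1 ∨ v = uv.2 := by
      intro v
      by_cases hv₂ : v = uv.2
      · simp [hv₂]
      · by_cases hv₁ : v = uv.1
        · simp [hv₁, Function.update_apply]
        · simp [hv₁, hv₂]
    refine ⟨⟨fun e he => ?_, fun e he => h₂ e (List.mem_cons_of_mem _ he), fun v hv => ?_⟩, le_rfl⟩
    · rw [hmark, hmark]
      rcases h₁ e he with h | ⟨h, h'⟩
      · rcases List.mem_cons.1 h with rfl | h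
        · exact Or.inr ⟨Or.inr (Or.inl rfl), Or.inr (Or.inr rfl)⟩
        · exact Or.inl h
      · exact Or.inr ⟨Or.inl h, Or.inl h'⟩
    · have huv := h₂ uv List.mem_cons_self
      rw [hmark] at hv
      rcases hv with hv | rfl | rfl
      · exact h₃ v hv
      · exact List.mem_append_left _ (List.mem_map_of_mem huv)
      · exact List.mem_append_right _ (List.mem_map_of_mem huv)
  · exact ⟨fun uv h => Or.inl h, fun uv h => h, fun v hv => by simp at hv⟩
  rintro mark k ⟨⟨h₁, -, h₃⟩, hk⟩
  simp only [Comp.fold_step, Comp.wp_ret]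
  have hfold : ∀ (l s : List (Fin n)), l.foldl (fun l v => if mark v = true then v :: l else l) s =
      (l.filter fun v => mark v).reverse ++ s := by
    intro l
    induction l with
    | nil => simp
    | cons v l ih =>
      intro s
      rw [List.foldl_cons, ih]
      by_cases hv : mark v = true <;> simp [hv]
  rw [hfold, List.append_nil]
  simp only [List.mem_reverse, List.mem_filter, List.mem_finRange, true_and, List.length_reverse,
    List.length_finRange]
  refine ⟨fun uv huv => (h₁ uv huv).resolve_left List.not_mem_nil, ?_, ?_, by omega⟩
  · refine (List.subperm_of_subset ((List.nodup_finRange n).filter _) (l₂ := edges.map Prod.fst ++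
      edges.map Prod.snd) fun v hv => h₃ v (List.mem_filter.1 hv).2).length_le.trans ?_
    simp only [List.length_append, List.length_map]
    omega
  · exact (List.length_filter_le _ _).trans (by simp)

theorem wp_prizeRange (dom : List (Fin n)) (p : Fin n → ℕ) {P : ℕ} (hP : ∀ v, p v ≤ P) :
    (prizeRange dom p).Wp fun x k => x.1 ≤ dom.length * P ∧ x.2 ≤ P ∧
      k ≤ 2 * dom.length + 1 := by
  unfold prizeRange
  refine (Comp.wp_fold_le (fun l (x : ℕ × ℕ) => x.1 + l.length * P ≤ dom.length * P ∧ x.2 ≤ P) 1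
    ?_ dom _ (by simp)).mono ?_
  · rintro l v ⟨a, b⟩ ⟨h₁, h₂⟩
    simp only [Comp.wp_step, List.length_cons, add_mul, one_mul] at h₁ ⊢
    have := hP v
    refine ⟨⟨by omega, ?_⟩, le_rfl⟩
    split_ifs
    exacts [this, h₂]
  · rintro x k ⟨⟨h₁, h₂⟩, hk⟩
    exact ⟨by simpa using h₁, h₂, hk⟩

/-- The vertices that are marked as visited for the first time. -/
def firsts (l : List (Fin n × Bool)) : List (Fin n) := (l.filter Prod.snd).map Prod.fst

@[simp] theorem firsts_cons_true (v : Fin n) (l : List (Fin n × Bool)) :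
    firsts ((v, true) :: l) = v :: firsts l := rfl

@[simp] theorem firsts_cons_false (v : Fin n) (l : List (Fin n × Bool)) :
    firsts ((v, false) :: l) = firsts l := rfl

theorem foldl_pushChildren (v : Fin n) : ∀ (l : List (Fin n)) (st : List (Fin n × Bool)),
    firsts (l.foldl (fun st c => (c, true) :: (v, false) :: st) st) = l.reverse ++ firsts st ∧
      (l.foldl (fun st c => (c, true) :: (v, false) :: st) st).length = 2 * l.length + st.length
  | [], st => by simp
  | c :: l, st => by
    obtain ⟨h₁, h₂⟩ := foldl_pushChildren v l ((c, true) :: (v, false) :: st)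
    rw [List.foldl_cons]
    refine ⟨by simp [h₁], ?_⟩
    rw [h₂]
    simp only [List.length_cons]
    ring

/-- The tour keeps no marks, so termination rests on `hF`: each vertex has one entry, hence one
parent or none, and is opened at most once. Entries that no root reaches are never visited. -/
theorem wp_eulerTour (dom : List (Fin n)) {F : Tree n} (hF : (F.map Prod.fst).Nodup) :
    (eulerTour dom F).Wp fun tour k => tour.length ≤ 3 * F.length ∧
      k ≤ 2 * dom.length + 13 * F.length + 4 := by
  have huniq : ∀ {v : Fin n} {a b : Option (Fin n)}, (v, a) ∈ F → (v, b) ∈ F → a = b := by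
    intro v a b ha hb
    exact (Prod.mk.inj (List.inj_on_of_nodup_map hF ha hb rfl)).2
  unfold eulerTour
  simp only [Comp.wp_bind, alloc_eq, Comp.wp_ret]
  refine (Comp.wp_fold_le
    (fun l (x : (Fin n → List (Fin n)) × List (Fin n × Bool)) =>
      (∀ u, ∀ v ∈ x.1 u, (v, some u) ∈ F ∧ v ∉ l.map Prod.fst) ∧
      (∀ u, (x.1 u).Nodup) ∧
      (∀ v ∈ firsts x.2, (v, none) ∈ F ∧ v ∉ l.map Prod.fst) ∧ (firsts x.2).Nodup ∧
      ∑ u, (x.1 u).length + x.2.length + l.length ≤ F.length ∧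
      (∀ vp ∈ l, vp ∈ F) ∧ (l.map Prod.fst).Nodup) 1 ?_ F _ ?_).mono ?_
  · rintro l ⟨v, par⟩ ⟨child, roots⟩ ⟨h₁, h₂, h₃, h₄, h₅, h₆, h₇⟩
    dsimp only at h₁ h₂ h₃ h₄ h₅
    simp only [List.map_cons, List.nodup_cons, List.length_cons, List.mem_cons, not_or] at h₁ h₃ h₅ h₇
    have hvF : (v, par) ∈ F := h₆ _ List.mem_cons_self
    have h₆' : ∀ vp ∈ l, vp ∈ F := fun vp h => h₆ vp (List.mem_cons_of_mem _ h)
    have hv₁ : ∀ u, v ∉ child u := fun u hv => (h₁ u v hv).2.1 rfl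
    have hv₃ : v ∉ firsts roots := fun hv => (h₃ v hv).2.1 rfl
    rcases par with _ | u
    · simp only [Comp.wp_step, firsts_cons_true, List.length_cons, List.nodup_cons]
      refine ⟨⟨fun u w hw => ⟨(h₁ u w hw).1, (h₁ u w hw).2.2⟩, h₂, fun w hw => ?_, ⟨hv₃, h₄⟩,
        by omega, h₆', h₇.2⟩, le_rfl⟩
      rcases List.mem_cons.1 hw with rfl | hw
      · exact ⟨hvF, h₇.1⟩
      · exact ⟨(h₃ w hw).1, (h₃ w hw).2.2⟩
    · simp only [Comp.wp_step]
      refine ⟨⟨fun x w hw => ?_, fun x => ?_, fun w hw => ⟨(h₃ w hw).1, (h₃ w hw).2.2⟩, h₄, ?_,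
        h₆', h₇.2⟩, le_rfl⟩
      · by_cases hx : x = u
        · subst hx
          simp only [Function.update_self, List.mem_cons] at hw
          rcases hw with rfl | hw
          · exact ⟨hvF, h₇.1⟩
          · exact ⟨(h₁ x w hw).1, (h₁ x w hw).2.2⟩
        · rw [Function.update_of_ne hx] at hw
          exact ⟨(h₁ x w hw).1, (h₁ x w hw).2.2⟩
      · by_cases hx : x = u
        · subst hx
          simpa using ⟨hv₁ x, h₂ x⟩
        · simpa [Function.update_of_ne hx] using h₂ x
      · have : ∀ x, (Function.update child u (v :: child u) x).length =
            (child x).length + if x = u then 1 else 0 := by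
          intro x
          by_cases hx : x = u
          · subst hx
            simp
          · simp [hx]
        rw [Finset.sum_congr rfl fun x _ => this x, Finset.sum_add_distrib]
        simp only [Finset.sum_ite_eq', Finset.mem_univ, if_true]
        omega
  · simpa [firsts] using hF
  rintro ⟨child, roots⟩ k₁ ⟨⟨h₁, h₂, h₃, h₄, h₅, -⟩, hk₁⟩
  simp only [List.map_nil, List.not_mem_nil, not_false_eq_true, and_true, List.length_nil,
    add_zero] at h₁ h₂ h₃ h₄ h₅
  dsimp only
  -- Every opened or waiting vertex is a root or a child of an opened vertex. Handling a stack entry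
  -- takes 3 steps. A child of an unopened vertex is worth 8: two for the pass of the inner fold and
  -- 2 * 3 for the two entries it pushes.
  refine (Comp.wp_loop
    (fun x : List (Fin n × Bool) × List (Fin n × Bool) =>
      (firsts x.1 ++ firsts x.2).Nodup ∧
      (∀ v ∈ firsts x.1 ++ firsts x.2, (v, none) ∈ F ∨ ∃ u ∈ firsts x.2, v ∈ child u) ∧
      x.2.length + x.1.length + 2 * ∑ v with v ∉ firsts x.2, (child v).length ≤ 3 * F.length)
    (fun x => 3 * x.1.length + 8 * ∑ v with v ∉ firsts x.2, (child v).length + 2)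
    (fun tour => tour.length ≤ 3 * F.length) ?_ (roots, []) ?_).mono ?_
  · rintro ⟨stack, tour⟩ ⟨g₁, g₂, g₃⟩
    dsimp only at g₁ g₂ g₃
    rcases stack with _ | ⟨⟨v, first⟩, st⟩
    · simp only [Comp.wp_step]
      exact ⟨by omega, by omega⟩
    · simp only [Comp.wp_bind, Comp.wp_step, List.length_cons] at g₃ ⊢
      rcases first with _ | _
      · simp only [Bool.false_eq_true, if_false, Comp.wp_pure]
        simp only [firsts_cons_false] at g₁ g₂
        have hsum : ∑ w with w ∉ firsts ((v, false) :: tour), (child w).length =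
            ∑ w with w ∉ firsts tour, (child w).length := rfl
        rw [hsum]
        exact ⟨⟨g₁, g₂, by simp only [List.length_cons]; omega⟩, by omega⟩
      · simp only [if_true, Comp.wp_bind, Comp.fold_step, Comp.wp_ret, Comp.wp_pure]
        obtain ⟨e₁, e₂⟩ := foldl_pushChildren v (child v) st
        have hv : v ∉ firsts tour ∧ v ∉ firsts st := by
          simp only [firsts_cons_true, List.cons_append, List.nodup_cons, List.mem_append,
            not_or] at g₁
          exact ⟨g₁.1.2, g₁.1.1⟩
        have hsum : ∑ w with w ∉ firsts ((v, true) :: tour), (child w).length +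
            (child v).length = ∑ w with w ∉ firsts tour, (child w).length := by
          have hmem : v ∈ ({w | w ∉ firsts tour} : Finset (Fin n)) := by simp [hv.1]
          rw [← Finset.sum_erase_add _ _ hmem]
          congr 2
          ext w
          simp
        rw [e₁, e₂]
        simp only [firsts_cons_true] at g₁ g₂ hsum ⊢
        refine ⟨⟨?_, ?_, ?_⟩, by omega⟩
        · rw [List.append_assoc, List.nodup_append']
          refine ⟨List.nodup_reverse.2 (h₂ v), (List.Perm.nodup_iff List.perm_middle).2 g₁, ?_⟩
          intro c hc hc'
          rw [List.mem_reverse] at hc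
          -- A child `c` of `v` that is already present would be a root as well, or would have an
          -- already opened parent `u`; by uniqueness `u = v`, which has not been opened yet.
          rcases g₂ c (by simpa using List.perm_middle.mem_iff.1 hc') with h | ⟨u, hu, h⟩
          · exact absurd (huniq h (h₁ v c hc)) (by simp)
          · have := huniq (h₁ u c h) (h₁ v c hc)
            simp only [Option.some.injEq] at this
            exact hv.1 (this ▸ hu)
        · intro w hw
          simp only [List.mem_append, List.mem_reverse, List.mem_cons] at hw
          rcases hw with (hw | hw) | hw
          · exact Or.inr ⟨v, List.mem_cons_self, hw⟩
          · exact (g₂ w (by simp [hw])).imp id fun ⟨u, hu, h⟩ => ⟨u, List.mem_cons_of_mem _ hu, h⟩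
          · exact (g₂ w (by rcases hw with hw | hw <;> simp [hw])).imp id
              fun ⟨u, hu, h⟩ => ⟨u, List.mem_cons_of_mem _ hu, h⟩
        · simp only [List.length_cons]
          omega
  · have : ∑ v with v ∉ firsts ([] : List (Fin n × Bool)), (child v).length =
        ∑ v, (child v).length := by simp [firsts]
    dsimp only
    rw [this]
    refine ⟨by simpa [firsts] using h₄, fun v hv => Or.inl (h₃ v (by simpa [firsts] using hv)), ?_⟩
    simp only [List.length_nil]
    omega
  · rintro tour k ⟨h, hk⟩
    have : ∑ v with v ∉ firsts ([] : List (Fin n × Bool)), (child v).length =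
        ∑ v, (child v).length := by simp [firsts]
    dsimp only at hk
    rw [this] at hk
    exact ⟨h, by omega⟩

theorem wp_pruneTree (dom : List (Fin n)) (p : Fin n → ℕ) (k : ℕ) {F : Tree n}
    (hF : (F.map Prod.fst).Nodup) :
    (pruneTree dom p k F).Wp fun l c => l.length ≤ 3 * F.length ∧
      c ≤ 2 * dom.length + 24 * F.length + 8 := by
  unfold pruneTree
  simp only [Comp.wp_bind]
  refine (wp_treeCost F).mono fun c k₁ hk₁ => ?_
  split_ifs
  · refine (wp_vertices F).mono fun l k₂ hk₂ => ?_
    omega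
  · simp only [Comp.wp_bind]
    refine (wp_eulerTour dom hF).mono fun tour k₂ hk₂ => ?_
    -- Both the current and the best piece are cut from the tour. Repeated visits may stay in them,
    -- whence the factor 3 in the length.
    refine (Comp.wp_fold_le (fun l (x : List (Fin n) × ℕ × ℕ × List (Fin n) × ℕ) =>
      x.1.length + l.length ≤ tour.length ∧ x.2.2.2.1.length ≤ tour.length) 2 ?_ tour _
      (by simp)).mono ?_
    · rintro l vf ⟨cur, len, val, best, bestVal⟩ ⟨h₁, h₂⟩
      simp only [List.length_cons] at h₁ h₂
      simp only [Comp.wp_bind, Comp.wp_step]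
      split_ifs <;> simp only [Comp.wp_step, List.length_cons, List.length_nil] <;> omega
    · rintro ⟨cur, len, val, best, bestVal⟩ k₃ ⟨⟨h₁, h₂⟩, hk₃⟩
      simp only [List.length_nil] at h₁ h₂
      simp only [Comp.wp_step]
      refine ⟨?_, by omega⟩
      split_ifs <;> omega

end

/-! ### Bisection and the projections -/

noncomputable section

variable {n : ℕ}

/-- The bisection is measured by the bit length of `hi - lo - 1`; the decrement makes either choice
of half satisfy this hypothesis. -/
theorem size_succ_le_of_le_half {a b : ℕ} (hb : 0 < b) (h : a ≤ b / 2) :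
    Nat.size a + 1 ≤ Nat.size b := by
  have hs := Nat.size_pos.2 hb
  have hlt := Nat.lt_size_self b
  have : Nat.size a ≤ Nat.size b - 1 := by
    rw [Nat.size_le]
    have : 2 ^ Nat.size b = 2 * 2 ^ (Nat.size b - 1) := by
      rw [← pow_succ']
      congr 1
      omega
    omega
  omega

theorem size_bisect_left {lo hi : ℕ} (h : ¬ hi ≤ lo + 1) :
    Nat.size (hi - (lo + hi) / 2 - 1) + 1 ≤ Nat.size (hi - lo - 1) :=
  size_succ_le_of_le_half (by omega) (by omega)

theorem size_bisect_right {lo hi : ℕ} (h : ¬ hi ≤ lo + 1) :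
    Nat.size ((lo + hi) / 2 - lo - 1) + 1 ≤ Nat.size (hi - lo - 1) :=
  size_succ_le_of_le_half (by omega) (by omega)

theorem size_bisect_le {lo hi L : ℕ} (h : hi < 2 ^ L) : Nat.size (hi - lo - 1) ≤ L :=
  Nat.size_le.2 (by omega)

theorem wp_quantize (q : ℕ) (z : Fin n → ℝ) :
    (quantize q z).Wp fun p k => (∀ v, p v ≤ n ^ 2 * n ^ q) ∧ k ≤ 5 * n + 3 := by
  unfold quantize
  simp only [Comp.wp_bind]
  refine (Comp.wp_fold_le (fun l (m : ℝ) => ∀ v, v ∈ l ∨ z v ^ 2 ≤ m) 1 ?_ (List.finRange n) _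
    (fun v => Or.inl (List.mem_finRange v))).mono ?_
  · intro l w m h
    simp only [Comp.wp_step]
    refine ⟨fun v => ?_, le_rfl⟩
    rcases h v with h | h
    · rcases List.mem_cons.1 h with rfl | h
      · exact Or.inr (le_max_right _ _)
      · exact Or.inl h
    · exact Or.inr (h.trans (le_max_left _ _))
  · intro m k ⟨h, hk⟩
    simp only [Comp.tabulate_step, Comp.wp_step, Comp.wp_ret]
    rw [List.length_finRange] at hk
    refine ⟨fun v => Nat.mul_le_mul_left _ (Nat.floor_le_of_le ?_), by omega⟩
    have hv : z v ^ 2 ≤ m := (h v).resolve_left List.not_mem_nil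
    -- The quotient by the maximum is at most 1, also for `z = 0`, where division by zero yields 0.
    exact mul_le_of_le_one_right (Nat.cast_nonneg _)
      (div_le_one_of_le₀ hv ((sq_nonneg _).trans hv))

theorem wp_restrict (z : Fin n → ℝ) (S : List (Fin n)) :
    (restrict z S).Wp fun _ k => k ≤ 3 * n + 2 * S.length + 2 := by
  unfold restrict
  simp only [Comp.wp_bind, Comp.tabulate_step, Comp.wp_ret, Comp.fold_step]
  omega

theorem le_treeBound (M : ℕ) : 300 * (M + 1) ≤ treeBound M := by
  have hH : 3 ≤ Heap.opCost M := by unfold Heap.opCost; omega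
  unfold treeBound
  exact Nat.mul_le_mul_right _ (by omega)

/-- `hL` puts every cost tried below 2^L. A round costs at most `2 * treeBound M`, for the tree and
for linear work on it; the remaining rounds number at most the bit length of the interval. -/
theorem wp_headSet (edges : List (Fin n × Fin n)) (k : ℕ) {p : Fin n → ℕ} {P L M : ℕ}
    (hn : 1 ≤ n) (hp : ∀ v, p v ≤ P) (hL : 4 * (n * P) < 2 ^ L)
    (hM : 4 * edges.length + 3 * (edges.length * L) ≤ M) :
    (headSet edges k p).Wp fun S c => S.length ≤ 9 * M + 1 ∧
      c ≤ 7 * n + 2 * treeBound M * (L + 4) := by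
  have hτ := le_treeBound M
  unfold headSet
  simp only [Comp.wp_bind]
  refine (wp_support edges).mono ?_
  rintro dom k₁ ⟨hdom, hd, hd', hk₁⟩
  refine (wp_prizeRange dom p hp).mono ?_
  rintro ⟨total, least⟩ k₂ ⟨ht, hl, hk₂⟩
  have htotal : 4 * total < 2 ^ L := by
    have := Nat.mul_le_mul_right P hd'
    dsimp only at ht
    omega
  have hlo : least / (2 * k) < 2 ^ L := by
    have h₁ : least / (2 * k) ≤ least := Nat.div_le_self _ _
    have h₂ : P ≤ n * P := Nat.le_mul_of_pos_left _ hn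
    dsimp only at hl
    omega
  have hpcst : ∀ cost, cost < 2 ^ L → (pcst dom edges p cost).Wp fun F k =>
      (F.map Prod.fst).Nodup ∧ F.length ≤ 3 * M ∧ k ≤ treeBound M :=
    fun cost hcost => wp_pcst dom edges p cost L hdom hcost (by omega)
  simp only [Comp.wp_step]
  refine (hpcst _ hlo).mono ?_
  rintro F k₃ ⟨-, hF, hk₃⟩
  refine (wp_treeCost F).mono fun c k₄ hk₄ => ?_
  set τ := treeBound M
  -- L + 1 passes of the bisection; 6 * τ covers the three trees computed outside it and all linear
  -- work.
  have hmul : 2 * τ * (L + 4) = 2 * τ * (L + 1) + 6 * τ := by ring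
  split_ifs with hc
  · simp only [Comp.wp_bind]
    refine (wp_vertices F).mono ?_
    rintro S k₅ ⟨hS, hk₅⟩
    refine (wp_orSingle p S).mono ?_
    rintro S' k₆ ⟨hS', hk₆⟩
    exact ⟨by omega, by omega⟩
  · simp only [Comp.wp_bind]
    refine (Comp.wp_loop (fun x : ℕ × ℕ => x.1 < 2 ^ L ∧ x.2 < 2 ^ L)
      (fun x => 2 * τ * (Nat.size (x.2 - x.1 - 1) + 1))
      (fun x => x.1 < 2 ^ L ∧ x.2 < 2 ^ L) ?_ (_, _) ⟨hlo, htotal⟩).mono ?_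
    · rintro ⟨lo, hi⟩ ⟨h₁, h₂⟩
      dsimp only at h₁ h₂ ⊢
      split_ifs with hlt
      · simp only [Comp.wp_step]
        refine ⟨⟨h₁, h₂⟩, ?_⟩
        rw [mul_add]
        omega
      · simp only [Comp.wp_bind, Comp.wp_step]
        have hmid : (lo + hi) / 2 < 2 ^ L := by omega
        refine (hpcst _ hmid).mono ?_
        rintro F' j₁ ⟨-, hF', hj₁⟩
        refine (wp_treeCost F').mono fun c' j₂ hj₂ => ?_
        split_ifs
        · simp only [Comp.wp_step]
          refine ⟨⟨hmid, h₂⟩, ?_⟩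
          have := Nat.mul_le_mul_left (2 * τ) (size_bisect_left hlt)
          simp only [mul_add, mul_one] at this ⊢
          omega
        · simp only [Comp.wp_step]
          refine ⟨⟨h₁, hmid⟩, ?_⟩
          have := Nat.mul_le_mul_left (2 * τ) (size_bisect_right hlt)
          simp only [mul_add, mul_one] at this ⊢
          omega
    · rintro ⟨lo, hi⟩ k₅ ⟨⟨h₁, h₂⟩, hk₅⟩
      dsimp only at h₁ h₂ hk₅ ⊢
      have hk₅' : k₅ ≤ 2 * τ * (L + 1) :=
        hk₅.trans (Nat.mul_le_mul_left _ (Nat.succ_le_succ (size_bisect_le htotal)))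
      refine (hpcst _ h₁).mono ?_
      rintro Fl k₆ ⟨hFl', hFl, hk₆⟩
      refine (hpcst _ h₂).mono ?_
      rintro Fr k₇ ⟨-, hFr, hk₇⟩
      refine (wp_pruneTree dom p k hFl').mono ?_
      rintro Sl k₈ ⟨hSl, hk₈⟩
      refine (wp_vertices Fr).mono ?_
      rintro Sr k₉ ⟨hSr, hk₉⟩
      refine (wp_prize p Sl).mono fun vl k₁₀ hk₁₀ => ?_
      refine (wp_prize p Sr).mono fun vr k₁₁ hk₁₁ => ?_
      have hS : (if vr ≤ vl then Sl else Sr).length ≤ 9 * M := by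
        split_ifs <;> omega
      refine (wp_orSingle p _).mono ?_
      rintro S' k₁₂ ⟨hS', hk₁₂⟩
      exact ⟨by omega, by omega⟩

theorem wp_tailSet (edges : List (Fin n × Fin n)) (k : ℕ) {p : Fin n → ℕ} {P L M : ℕ}
    (hn : 1 ≤ n) (hp : ∀ v, p v ≤ P) (hL : 4 * (n * P) < 2 ^ L)
    (hM : 4 * edges.length + 3 * (edges.length * L) ≤ M) :
    (tailSet edges k p).Wp fun S c => S.length ≤ 9 * M + 1 ∧
      c ≤ 9 * n + 2 * treeBound M * (L + 4) := by
  have hτ := le_treeBound M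
  unfold tailSet
  simp only [Comp.wp_bind]
  refine (wp_support edges).mono ?_
  rintro dom k₁ ⟨hdom, hd, hd', hk₁⟩
  refine (wp_prizeRange dom p hp).mono ?_
  rintro ⟨total, least⟩ k₂ ⟨ht, hl, hk₂⟩
  have htotal : 3 * total < 2 ^ L := by
    have := Nat.mul_le_mul_right P hd'
    dsimp only at ht
    omega
  have hlo : least / (2 * k) < 2 ^ L := by
    have h₁ : least / (2 * k) ≤ least := Nat.div_le_self _ _
    have h₂ : P ≤ n * P := Nat.le_mul_of_pos_left _ hn
    dsimp only at hl
    omega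
  have hpcst : ∀ cost, cost < 2 ^ L → (pcst dom edges p cost).Wp fun F k =>
      (F.map Prod.fst).Nodup ∧ F.length ≤ 3 * M ∧ k ≤ treeBound M :=
    fun cost hcost => wp_pcst dom edges p cost L hdom hcost (by omega)
  simp only [Comp.wp_step]
  refine (wp_prize p (List.finRange n)).mono fun all k₃ hk₃ => ?_
  rw [List.length_finRange] at hk₃
  refine (hpcst _ hlo).mono ?_
  rintro F k₄ ⟨-, hF, hk₄⟩
  refine (wp_treeCost F).mono fun c k₅ hk₅ => ?_
  refine (wp_vertices F).mono ?_
  rintro S k₆ ⟨hS, hk₆⟩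
  refine (wp_prize p S).mono fun got k₇ hk₇ => ?_
  set τ := treeBound M
  have hmul : 2 * τ * (L + 4) = 2 * τ * (L + 1) + 6 * τ := by ring
  split_ifs with hc
  · simp only [Comp.wp_step]
    exact ⟨by omega, by omega⟩
  · simp only [Comp.wp_bind]
    refine (Comp.wp_loop (fun x : ℕ × ℕ => x.1 < 2 ^ L ∧ x.2 < 2 ^ L)
      (fun x => 2 * τ * (Nat.size (x.2 - x.1 - 1) + 1))
      (fun S => S.length ≤ 3 * M) ?_ (_, _) ⟨Nat.two_pow_pos L, htotal⟩).mono ?_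
    · rintro ⟨lo, hi⟩ ⟨h₁, h₂⟩
      -- Here the last pass computes a tree as well, and any pass may be the last; the extra 1 in
      -- the potential reserves its cost.
      have hone : 2 * τ ≤ 2 * τ * (Nat.size (hi - lo - 1) + 1) :=
        Nat.le_mul_of_pos_right _ (Nat.succ_pos _)
      dsimp only at h₁ h₂ ⊢
      split_ifs with hlt
      · simp only [Comp.wp_bind]
        refine (hpcst _ h₂).mono ?_
        rintro F' j₁ ⟨-, hF', hj₁⟩
        refine (wp_vertices F').mono ?_
        rintro S' j₂ ⟨hS', hj₂⟩
        simp only [Comp.wp_step]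
        exact ⟨by omega, by omega⟩
      · simp only [Comp.wp_bind, Comp.wp_step]
        have hmid : (lo + hi) / 2 < 2 ^ L := by omega
        refine (hpcst _ hmid).mono ?_
        rintro F' j₁ ⟨-, hF', hj₁⟩
        refine (wp_treeCost F').mono fun c' j₂ hj₂ => ?_
        split_ifs
        · simp only [Comp.wp_bind]
          refine (wp_vertices F').mono ?_
          rintro S' j₃ ⟨hS', hj₃⟩
          simp only [Comp.wp_step]
          exact ⟨by omega, by omega⟩
        · simp only [Comp.wp_step]
          refine ⟨⟨hmid, h₂⟩, ?_⟩
          have := Nat.mul_le_mul_left (2 * τ) (size_bisect_left hlt)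
          simp only [mul_add, mul_one] at this ⊢
          omega
        · simp only [Comp.wp_step]
          refine ⟨⟨h₁, hmid⟩, ?_⟩
          have := Nat.mul_le_mul_left (2 * τ) (size_bisect_right hlt)
          simp only [mul_add, mul_one] at this ⊢
          omega
    · rintro S' k₈ ⟨hS', hk₈⟩
      have hk₈' : k₈ ≤ 2 * τ * (L + 1) :=
        hk₈.trans (Nat.mul_le_mul_left _ (Nat.succ_le_succ (size_bisect_le htotal)))
      refine (wp_orSingle p S').mono ?_
      rintro S'' k₉ ⟨hS'', hk₉⟩
      exact ⟨by omega, by omega⟩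

theorem wp_head (q k : ℕ) (edges : List (Fin n × Fin n)) (z : Fin n → ℝ) {L M : ℕ} (hn : 1 ≤ n)
    (hL : 4 * (n * (n ^ 2 * n ^ q)) < 2 ^ L)
    (hM : 4 * edges.length + 3 * (edges.length * L) ≤ M) :
    (head q k edges z).Wp fun _ c => c ≤ 20 * n + 2 * treeBound M * (L + 5) := by
  have hτ := le_treeBound M
  unfold head
  simp only [Comp.wp_bind]
  refine (wp_quantize q z).mono ?_
  rintro p k₁ ⟨hp, hk₁⟩
  refine (wp_headSet edges k hn hp hL hM).mono ?_
  rintro S k₂ ⟨hS, hk₂⟩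
  refine (wp_restrict z S).mono fun _ k₃ hk₃ => ?_
  simp only [mul_add] at hk₂ ⊢
  omega

theorem wp_tail (q k : ℕ) (edges : List (Fin n × Fin n)) (z : Fin n → ℝ) {L M : ℕ} (hn : 1 ≤ n)
    (hL : 4 * (n * (n ^ 2 * n ^ q)) < 2 ^ L)
    (hM : 4 * edges.length + 3 * (edges.length * L) ≤ M) :
    (tail q k edges z).Wp fun _ c => c ≤ 20 * n + 2 * treeBound M * (L + 5) := by
  have hτ := le_treeBound M
  unfold tail
  simp only [Comp.wp_bind]
  refine (wp_quantize q z).mono ?_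
  rintro p k₁ ⟨hp, hk₁⟩
  refine (wp_tailSet edges k hn hp hL hM).mono ?_
  rintro S k₂ ⟨hS, hk₂⟩
  refine (wp_restrict z S).mono fun _ k₃ hk₃ => ?_
  simp only [mul_add] at hk₂ ⊢
  omega

end

/-! ### Cost of Relaxed-GraphMP and GraphDPD -/

noncomputable section

variable {n T : ℕ}

theorem dot_eq (x y : Fin n → ℝ) :
    dot x y = ret ((List.finRange n).foldl (fun s v => s + x v * y v) 0) (2 * n + 1) := by
  unfold dot
  rw [Comp.fold_step, List.length_finRange]

theorem wp_windowSum (c : ℕ → Fin n → ℕ) (R : Window) :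
    (windowSum c R).Wp fun _ k => k ≤ (2 * R.days.length + 3) * n + 1 := by
  refine (Comp.wp_tabulate (fun _ _ => True) (2 * R.days.length + 1) fun v => ?_).mono
    fun _ _ h => h.2
  simp only [Comp.fold_step, Comp.wp_ret, true_and, le_refl]

theorem wp_relaxedStat (I : Instance n T) (R : Window) (P Q x : Fin n → ℝ) :
    (relaxedStat I R P Q x).Wp fun _ k => k ≤ 8 * n + 5 := by
  unfold relaxedStat
  simp only [Comp.wp_bind, dot_eq, Comp.wp_ret, Comp.wp_step]
  omega

theorem wp_gradient (I : Instance n T) (R : Window) (P Q x : Fin n → ℝ) :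
    (gradient I R P Q x).Wp fun _ k => k ≤ 11 * n + 9 := by
  unfold gradient
  simp only [Comp.wp_bind, dot_eq, Comp.wp_ret, Comp.wp_step, Comp.tabulate_step]
  omega

theorem wp_score (I : Instance n T) (R : Window) (S : Fin n → Bool) :
    (score I R S).Wp fun _ k => k ≤ 4 * (n * R.days.length) + 17 * n + 8 := by
  unfold score
  simp only [Comp.wp_bind, Comp.wp_ret, Comp.tabulate_step]
  refine (wp_windowSum I.a R).mono fun P k₁ hk₁ => ?_
  refine (wp_windowSum I.b R).mono fun Q k₂ hk₂ => ?_
  refine (wp_relaxedStat I R P Q _).mono fun _ k₃ hk₃ => ?_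
  nlinarith

theorem wp_ascent (I : Instance n T) (R : Window) (P Q : Fin n → ℝ) (eta : ℝ) (Om : Fin n → Bool) :
    ∀ (m : ℕ) (x : Fin n → ℝ),
      (ascent I R P Q eta Om m x).Wp fun _ k => k ≤ m * (14 * n + 10) + 1
  | 0, x => by simp [ascent]
  | m + 1, x => by
    unfold ascent
    simp only [Comp.wp_bind, Comp.tabulate_step, Comp.wp_ret]
    refine (wp_gradient I R P Q x).mono fun d k₁ hk₁ => ?_
    refine (wp_ascent I R P Q eta Om m _).mono fun _ k₂ hk₂ => ?_
    rw [add_mul, one_mul]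
    omega

section

variable {q B : ℕ} {edges : List (Fin n × Fin n)}

theorem wp_iteration
    (hH : ∀ (k : ℕ) (z : Fin n → ℝ), (head q k edges z).Wp fun _ c => c ≤ B)
    (hT : ∀ (k : ℕ) (z : Fin n → ℝ), (tail q k edges z).Wp fun _ c => c ≤ B)
    (I : Instance n T) (hI : I.edges = edges) (s : Settings n) (R : Window) (i : ℕ)
    (x : Fin n → ℝ) :
    (iteration q I s R i x).Wp fun _ c =>
      c ≤ 4 * (n * R.days.length) + 41 * n + s.l * (14 * n + 10) + 2 * B + 26 := by
  unfold iteration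
  simp only [Comp.wp_bind, Comp.tabulate_step, Comp.wp_ret, Comp.fold_step, Comp.wp_step,
    List.length_finRange, hI]
  refine (wp_windowSum I.a R).mono fun P k₁ hk₁ => ?_
  refine (wp_windowSum I.b R).mono fun Q k₂ hk₂ => ?_
  refine (wp_gradient I R P Q x).mono fun d k₃ hk₃ => ?_
  refine (hH s.k d).mono fun g k₄ hk₄ => ?_
  refine (wp_ascent I R P Q s.eta _ s.l _).mono fun b k₅ hk₅ => ?_
  refine (hT s.k b).mono fun x' k₆ hk₆ => ?_
  refine (wp_relaxedStat I R P Q x).mono fun f k₇ hk₇ => ?_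
  refine (wp_relaxedStat I R P Q x').mono fun f' k₈ hk₈ => ?_
  have : (2 * R.days.length + 3) * n = 2 * (n * R.days.length) + 3 * n := by ring
  omega

theorem wp_iterate {c : ℕ} (I : Instance n T) (s : Settings n) (R : Window)
    (h : ∀ i x, (iteration q I s R i x).Wp fun _ k => k ≤ c) :
    ∀ (m i : ℕ) (x : Fin n → ℝ),
      (iterate q I s R m i x).Wp fun _ k => k ≤ m * c + 1
  | 0, i, x => by simp [iterate]
  | m + 1, i, x => by
    unfold iterate
    rw [Comp.wp_bind]
    refine (h i x).mono ?_
    rintro ⟨x', halted⟩ k hk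
    dsimp only
    rw [add_mul, one_mul]
    split_ifs
    · simp only [Comp.wp_step]
      omega
    · refine (wp_iterate I s R h m (i + 1) x').mono fun _ k' hk' => ?_
      omega

/-- The cost of Relaxed-GraphMP and of the evaluation of its result, if that of a projection
is at most `B`. -/
def searchBound (n T l t B : ℕ) : ℕ := t * (200 * (n * T) + 24 * (n * l) + 2 * B)

theorem wp_relaxedGraphMP
    (hH : ∀ (k : ℕ) (z : Fin n → ℝ), (head q k edges z).Wp fun _ c => c ≤ B)
    (hT : ∀ (k : ℕ) (z : Fin n → ℝ), (tail q k edges z).Wp fun _ c => c ≤ B)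
    (hn : 1 ≤ n) (I : Instance n T) (hI : I.edges = edges) (s : Settings n)
    (ht : 1 ≤ s.t) {R : Window} (hR : R.days.length ≤ T) (hT1 : 1 ≤ T) :
    (relaxedGraphMP q I s R).Wp fun _ c => c ≤ searchBound n T s.l s.t B := by
  unfold relaxedGraphMP
  simp only [Comp.wp_bind, Comp.tabulate_step, Comp.wp_ret]
  refine (wp_iterate I s R (fun i x => wp_iteration hH hT I hI s R i x) s.t 0 s.x₀).mono
    fun _ k hk => ?_
  refine (Nat.add_le_add_right hk _).trans ?_
  have h₁ : n * R.days.length ≤ n * T := Nat.mul_le_mul_left _ hR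
  have h₂ : n ≤ n * T := Nat.le_mul_of_pos_right _ hT1
  have h₃ : s.l * (14 * n + 10) ≤ 24 * (n * s.l) := by
    have : s.l ≤ n * s.l := Nat.le_mul_of_pos_left _ hn
    have : s.l * (14 * n + 10) = 14 * (n * s.l) + 10 * s.l := by ring
    omega
  calc _ ≤ s.t * (4 * (n * T) + 41 * n + 24 * (n * s.l) + 2 * B + 26) + (3 * n + 2) := by
        have := Nat.mul_le_mul_left s.t (show 4 * (n * R.days.length) + 41 * n +
          s.l * (14 * n + 10) + 2 * B + 26 ≤ 4 * (n * T) + 41 * n + 24 * (n * s.l) + 2 * B + 26 by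
            omega)
        omega
    -- The work outside the iterations is charged to them, as `s.t` is at least 1.
    _ ≤ s.t * (4 * (n * T) + 41 * n + 24 * (n * s.l) + 2 * B + 26) + s.t * (3 * n + 2) :=
        Nat.add_le_add_left (Nat.le_mul_of_pos_left _ ht) _
    _ = s.t * (4 * (n * T) + 44 * n + 24 * (n * s.l) + 2 * B + 28) := by ring
    _ ≤ _ := Nat.mul_le_mul_left _ (by omega)

theorem wp_replica (I : Instance n T) (ω : ℕ → Fin n → ℕ × ℕ) :
    (replica I ω).Wp fun J c => J.edges = I.edges ∧ c ≤ (6 * n + 4) * T + 2 := by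
  unfold replica
  simp only [Comp.wp_bind, Comp.tabulate_step]
  refine (Comp.wp_fold_le (fun _ _ => True) (6 * n + 3) ?_ (List.range' 1 T) _ trivial).mono ?_
  · rintro l t x -
    simp only [Comp.wp_bind, Comp.wp_ret, Comp.wp_step, true_and]
    omega
  · rintro ⟨a, b⟩ k ⟨-, hk⟩
    rw [List.length_range'] at hk
    simp only [Comp.wp_step, true_and]
    exact Nat.succ_le_succ hk

theorem wp_getPValue (N : ℕ)
    (hH : ∀ (k : ℕ) (z : Fin n → ℝ), (head q k edges z).Wp fun _ c => c ≤ B)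
    (hT : ∀ (k : ℕ) (z : Fin n → ℝ), (tail q k edges z).Wp fun _ c => c ≤ B)
    (hn : 1 ≤ n) (I : Instance n T) (hI : I.edges = edges) (s : Settings n)
    (ht : 1 ≤ s.t) (ω : ℕ → ℕ → Fin n → ℕ × ℕ) (S : Fin n → Bool) {R : Window}
    (hR : R.days.length ≤ T) (hT1 : 1 ≤ T) :
    (getPValue N q I s ω S R).Wp fun _ c =>
      c ≤ (N + 1) * (searchBound n T s.l s.t B + 50 * (n * T)) := by
  have h₁ : n * R.days.length ≤ n * T := Nat.mul_le_mul_left _ hR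
  have h₂ : n ≤ n * T := Nat.le_mul_of_pos_right _ hT1
  have h₃ : T ≤ n * T := Nat.le_mul_of_pos_left _ hn
  have h₄ : (6 * n + 4) * T = 6 * (n * T) + 4 * T := by ring
  unfold getPValue
  simp only [Comp.wp_bind, Comp.wp_step]
  refine (wp_score I R S).mono fun obs k₁ hk₁ => ?_
  refine (Comp.wp_fold_le (fun _ _ => True) (searchBound n T s.l s.t B + 42 * (n * T)) ?_
    (List.range N) _ trivial).mono ?_
  · rintro l j c -
    simp only [Comp.wp_bind]
    refine (wp_replica I (ω j)).mono ?_
    rintro J k₂ ⟨hJ, hk₂⟩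
    refine (wp_relaxedGraphMP hH hT hn J (hJ.trans hI) s ht hR hT1).mono fun S' k₃ hk₃ => ?_
    refine (wp_score J R S').mono fun f k₄ hk₄ => ?_
    simp only [Comp.wp_step, true_and]
    omega
  · rintro c k₂ ⟨-, hk₂⟩
    rw [List.length_range] at hk₂
    have : (searchBound n T s.l s.t B + 42 * (n * T) + 1) * N ≤
        N * (searchBound n T s.l s.t B + 50 * (n * T)) := by
      rw [mul_comm]
      exact Nat.mul_le_mul_left _ (by omega)
    rw [add_mul, one_mul]
    omega

/-- The factor N + 2 collects the search on the data and the N + 1 units of `wp_getPValue`. Replicas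
keep the edge list, so one bound `B` on the projections serves them all. -/
theorem wp_graphDPD (N : ℕ)
    (hH : ∀ (k : ℕ) (z : Fin n → ℝ), (head q k edges z).Wp fun _ c => c ≤ B)
    (hT : ∀ (k : ℕ) (z : Fin n → ℝ), (tail q k edges z).Wp fun _ c => c ≤ B)
    (hn : 1 ≤ n) (I : Instance n T) (hI : I.edges = edges) (s : Settings n)
    (ht : 1 ≤ s.t) (ω : ℕ → ℕ → ℕ → ℕ → Fin n → ℕ × ℕ) (hT1 : 1 ≤ T) :
    (graphDPD N q I s ω).Wp fun _ c =>
      c ≤ (N + 2) * (searchBound n T s.l s.t B + 60 * (n * T)) * T ^ 2 := by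
  have hnT : 1 ≤ n * T := Nat.one_le_iff_ne_zero.2 (Nat.mul_ne_zero (by omega) (by omega))
  obtain ⟨b, hb⟩ : ∃ b, b = searchBound n T s.l s.t B + (N + 1) * (searchBound n T s.l s.t B + 50 * (n * T)) + 2 := ⟨_, rfl⟩
  unfold graphDPD
  -- The invariants 1 ≤ i and, inside, j ≤ T are kept because they limit a window to T days.
  refine (Comp.wp_fold_le (fun l _ => ∀ i ∈ l, 1 ≤ i) ((b + 1) * T + 1) ?_ (List.range' 1 T) _
    fun i hi => (List.mem_range'_1.1 hi).1).mono ?_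
  · intro l i O hl
    refine (Comp.wp_fold_le (fun l _ => ∀ j ∈ l, j ≤ T) b ?_ (List.range' (i + 1) (T - i)) O ?_).mono
      ?_
    · intro l' j O hl'
      have hj := hl' j List.mem_cons_self
      have hi := hl i List.mem_cons_self
      have hR : (Window.days { first := i, last := j }).length ≤ T := by
        simp only [Window.days, List.length_range']
        omega
      simp only [Comp.wp_bind, Comp.wp_step]
      refine (wp_relaxedGraphMP hH hT hn I hI s ht hR hT1).mono fun S k₁ hk₁ => ?_
      refine (wp_getPValue N hH hT hn I hI s ht (ω i j) S hR hT1).mono fun pv k₂ hk₂ => ?_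
      have : ∀ j ∈ l', j ≤ T := fun j hj => hl' j (List.mem_cons_of_mem _ hj)
      split_ifs <;> simp only [Comp.wp_step] <;> exact ⟨this, by omega⟩
    · intro j hj
      have := List.mem_range'_1.1 hj
      omega
    · rintro O' k ⟨-, hk⟩
      refine ⟨fun j hj => hl j (List.mem_cons_of_mem _ hj), hk.trans ?_⟩
      rw [List.length_range']
      exact Nat.add_le_add_right (Nat.mul_le_mul_left _ (Nat.sub_le _ _)) _
  · rintro O k ⟨-, hk⟩
    rw [List.length_range'] at hk
    have hT2 : T ≤ T ^ 2 := Nat.le_self_pow two_ne_zero T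
    have hb' : b + 4 ≤ (N + 2) * (searchBound n T s.l s.t B + 60 * (n * T)) := by
      have : (N + 2) * (searchBound n T s.l s.t B + 60 * (n * T)) =
          (N + 1) * (searchBound n T s.l s.t B + 60 * (n * T)) + (searchBound n T s.l s.t B + 60 * (n * T)) := by ring
      have := Nat.mul_le_mul_left (N + 1) (show searchBound n T s.l s.t B + 50 * (n * T) ≤ searchBound n T s.l s.t B + 60 * (n * T) by omega)
      omega
    calc k ≤ ((b + 1) * T + 1 + 1) * T + 1 := hk
      _ = (b + 1) * T ^ 2 + 2 * T + 1 := by ring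
      _ ≤ (b + 4) * T ^ 2 := by
        rw [add_mul, add_mul]
        omega
      _ ≤ _ := Nat.mul_le_mul_right _ hb'

end

/-! ### Choice of the parameters and passage to the real logarithm -/

/-- Yields log² n = O(n). A projection spends about log² n steps even on a graph without edges, and
the term n must absorb them. -/
theorem sq_succ_le_four_mul_two_pow (m : ℕ) : (m + 1) ^ 2 ≤ 4 * 2 ^ m := by
  rcases Nat.lt_or_ge m 2 with h | h
  · interval_cases m <;> norm_num
  · induction m, h using Nat.le_induction with
    | base => norm_num
    | succ m hm ih =>
      rw [pow_succ 2 m]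
      nlinarith

/-- With l = `Nat.log 2 n + 1`, take L about (q + 3) * l, as costs are below 4 * n^(q+3), and M of
order E * l. The three factors l are those of M, of a heap operation, and of the number of rounds.
-/
theorem exists_projection_bound (q : ℕ) : ∃ K : ℕ, ∀ n E : ℕ, 1 ≤ n → E ≤ n ^ 2 →
    ∃ L M, 4 * (n * (n ^ 2 * n ^ q)) < 2 ^ L ∧ 4 * E + 3 * (E * L) ≤ M ∧
      20 * n + 2 * treeBound M * (L + 5) ≤ K * (n + E * (Nat.log 2 n + 1) ^ 3) := by
  set A := q + 5 with hA
  refine ⟨20 + 4 * (210000 * A ^ 3), fun n E hn hE => ?_⟩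
  set l := Nat.log 2 n + 1 with hl
  have hnl : n < 2 ^ l := Nat.lt_pow_succ_log_self one_lt_two n
  have hln : l ≤ n := Nat.log_lt_self 2 (by omega)
  have hl1 : 1 ≤ l := by omega
  have hl2 : l ^ 2 ≤ 4 * n :=
    (sq_succ_le_four_mul_two_pow _).trans
      (Nat.mul_le_mul_left _ (Nat.pow_log_le_self 2 (by omega)))
  have hAl : A ≤ A * l := Nat.le_mul_of_pos_right _ hl1
  have hlA : l ≤ A * l := Nat.le_mul_of_pos_left _ (by omega)
  have hL : l * (q + 3) + 2 ≤ A * l := by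
    have : A * l = l * (q + 3) + 2 * l := by rw [hA]; ring
    omega
  refine ⟨l * (q + 3) + 2, 7 * A * (E * l), ?_, ?_, ?_⟩
  · calc 4 * (n * (n ^ 2 * n ^ q)) = 4 * n ^ (q + 3) := by ring
      _ < 4 * (2 ^ l) ^ (q + 3) :=
        Nat.mul_lt_mul_of_pos_left (Nat.pow_lt_pow_left hnl (by omega)) (by norm_num)
      _ = 2 ^ (l * (q + 3) + 2) := by rw [← pow_mul, pow_add, mul_comm]; norm_num
  · have h₁ : E * (l * (q + 3) + 2) ≤ E * (A * l) := Nat.mul_le_mul_left _ hL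
    have h₂ : E * (A * 1) ≤ E * (A * l) := Nat.mul_le_mul_left _ (Nat.mul_le_mul_left _ hl1)
    have h₃ : E * 1 ≤ E * A := Nat.mul_le_mul_left _ (by omega)
    have h₄ : 7 * A * (E * l) = 7 * (E * (A * l)) := by ring
    simp only [mul_one] at h₂ h₃
    omega
  -- E ≤ n² makes `M` polynomial in n, so heap operations cost O(log n) and not merely O(log M).
  · have hM : 7 * A * (E * l) + 1 ≤ 2 ^ (8 * A + 3 * l) := by
      have h₁ : 7 * A * (E * l) ≤ 7 * A * (n ^ 2 * n) :=
        Nat.mul_le_mul_left _ (Nat.mul_le_mul hE hln)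
      have h₂ : 1 ≤ A * (n ^ 2 * n) :=
        Nat.one_le_iff_ne_zero.2 (by positivity)
      have h₃ : 7 * A * (n ^ 2 * n) + A * (n ^ 2 * n) = (8 * A) * n ^ 3 := by ring
      have h₄ : (8 * A) * n ^ 3 ≤ 2 ^ (8 * A) * (2 ^ l) ^ 3 :=
        Nat.mul_le_mul Nat.lt_two_pow_self.le (Nat.pow_le_pow_left hnl.le 3)
      have h₅ : 2 ^ (8 * A + 3 * l) = 2 ^ (8 * A) * (2 ^ l) ^ 3 := by
        rw [← pow_mul, ← pow_add, mul_comm 3 l]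
      omega
    have hH : Heap.opCost (7 * A * (E * l)) ≤ 25 * A * l := by
      have := (Nat.log_mono_right (b := 2) hM).trans_eq (Nat.log_pow one_lt_two _)
      unfold Heap.opCost
      have : 25 * A * l = 25 * (A * l) := by ring
      omega
    have hτ : treeBound (7 * A * (E * l)) ≤ 17500 * A ^ 2 * (E * l ^ 2 + l) := by
      unfold treeBound
      calc _ ≤ 100 * (25 * A * l) * (7 * A * (E * l) + 7 * A) := by
            refine Nat.mul_le_mul (Nat.mul_le_mul_left _ hH) ?_
            omega
        _ = _ := by ring
    calc 20 * n + 2 * treeBound (7 * A * (E * l)) * (l * (q + 3) + 2 + 5)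
        ≤ 20 * n + 2 * (17500 * A ^ 2 * (E * l ^ 2 + l)) * (6 * (A * l)) := by
          refine Nat.add_le_add_left (Nat.mul_le_mul (Nat.mul_le_mul_left _ hτ) ?_) _
          omega
      _ = 20 * n + 210000 * A ^ 3 * (E * l ^ 3 + l ^ 2) := by ring
      _ ≤ 20 * n + 210000 * A ^ 3 * (E * l ^ 3 + 4 * n) :=
          Nat.add_le_add_left (Nat.mul_le_mul_left _ (by omega)) _
      _ ≤ _ := by
          have h₁ : 0 ≤ 20 * (E * l ^ 3) := Nat.zero_le _
          have h₂ : 0 ≤ 3 * (210000 * A ^ 3 * (E * l ^ 3)) := Nat.zero_le _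
          linarith

/-- The orientation u < v in `mem_edges` prevents an edge from being listed in both directions. -/
theorem Instance.length_edges_le (I : Instance n T) : I.edges.length ≤ I.graph.edgeSet.ncard := by
  classical
  have hinj : ∀ e ∈ I.edges.toFinset, ∀ e' ∈ I.edges.toFinset, s(e.1, e.2) = s(e'.1, e'.2) →
      e = e' := by
    rintro ⟨u, v⟩ h ⟨u', v'⟩ h' heq
    rw [List.mem_toFinset, I.mem_edges] at h h'
    rcases Sym2.eq_iff.1 heq with ⟨rfl, rfl⟩ | ⟨rfl, rfl⟩
    · rfl
    · exact absurd h.1 h'.1.asymm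
  rw [← List.toFinset_card_of_nodup I.nodup, ← Set.ncard_coe_finset]
  refine Set.ncard_le_ncard_of_injOn (fun e => s(e.1, e.2)) ?_
    (fun e he e' he' h => hinj e (by simpa using he) e' (by simpa using he') h) (Set.toFinite _)
  rintro ⟨u, v⟩ h
  have h := (I.mem_edges u v).1 (by simpa using h)
  simpa using h.2

theorem Instance.length_edges_le_sq (I : Instance n T) : I.edges.length ≤ n ^ 2 := by
  classical
  rw [← List.toFinset_card_of_nodup I.nodup]
  refine (Finset.card_le_univ _).trans_eq ?_
  simp [sq]

theorem Instance.two_le_of_edges (I : Instance n T) (h : 0 < I.edges.length) : 2 ≤ n := by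
  obtain ⟨⟨u, v⟩, he⟩ := List.exists_mem_of_length_pos h
  have := ((I.mem_edges u v).1 he).1
  have := v.isLt
  omega

/-- Both `Nat.log 2 n * log 2` and `log 2` are at most `log n`, and 2 / log 2 < 3. -/
theorem natLog_succ_le {n : ℕ} (hn : 2 ≤ n) : ((Nat.log 2 n + 1 : ℕ) : ℝ) ≤ 3 * Real.log n := by
  have hn' : (2 : ℝ) ≤ n := by exact_mod_cast hn
  have h₂ := Real.log_two_gt_d9
  have h₁ : Real.log 2 ≤ Real.log n := Real.log_le_log (by norm_num) hn'
  have h₃ : (Nat.log 2 n : ℝ) * Real.log 2 ≤ Real.log n := by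
    rw [← Real.log_pow]
    refine Real.log_le_log (by positivity) ?_
    exact_mod_cast Nat.pow_log_le_self 2 (by omega)
  have h₄ : (0 : ℝ) ≤ Nat.log 2 n := Nat.cast_nonneg _
  push_cast
  nlinarith

end

end GraphDPD

theorem theorem2 (N q : ℕ) :
    ∃ C : ℝ, 0 < C ∧
      ∀ (n T : ℕ) (I : GraphDPD.Instance n T) (s : GraphDPD.Settings n)
        (ω : ℕ → ℕ → ℕ → ℕ → Fin n → ℕ × ℕ),
        1 ≤ n → 1 ≤ T → 1 ≤ s.t →
          (GraphDPD.graphDPD N q I s ω).RunsWithin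
            (C * ((T : ℝ) ^ 2 * s.t *
              (n * T + n * s.l + I.graph.edgeSet.ncard * Real.log n ^ 3))) := by
  obtain ⟨K, hK⟩ := GraphDPD.exists_projection_bound q
  -- 27 = 3^3 comes from `natLog_succ_le`; 260 is the 200 of `searchBound` plus the 60 of
  -- `wp_graphDPD`.
  refine ⟨27 * ((N + 2) * (260 + 2 * K)), by positivity, fun n T I s ω hn hT ht => ?_⟩
  obtain ⟨L, M, hL, hM, hB⟩ := hK n I.edges.length hn I.length_edges_le_sq
  refine GraphDPD.Comp.Wp.runsWithin ((GraphDPD.wp_graphDPD N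
    (fun k z => (GraphDPD.wp_head q k I.edges z hn hL hM).mono fun _ _ h => h.trans hB)
    (fun k z => (GraphDPD.wp_tail q k I.edges z hn hL hM).mono fun _ _ h => h.trans hB)
    hn I rfl s ht ω hT).mono fun _ c hc => ?_)
  have hE : (I.edges.length : ℝ) * ((Nat.log 2 n + 1 : ℕ) : ℝ) ^ 3 ≤
      27 * (I.graph.edgeSet.ncard * Real.log n ^ 3) := by
    -- For n = 1 the real logarithm vanishes while the integer one plus 1 does not; but an edge
    -- forces n ≥ 2.
    rcases Nat.eq_zero_or_pos I.edges.length with h | h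
    · have : 0 ≤ Real.log n := Real.log_natCast_nonneg n
      rw [h, Nat.cast_zero, zero_mul]
      positivity
    · have h₁ : (I.edges.length : ℝ) ≤ I.graph.edgeSet.ncard := by
        exact_mod_cast I.length_edges_le
      have h₂ := pow_le_pow_left₀ (Nat.cast_nonneg _)
        (GraphDPD.natLog_succ_le (I.two_le_of_edges h)) 3
      calc _ ≤ (I.graph.edgeSet.ncard : ℝ) * (3 * Real.log n) ^ 3 :=
            mul_le_mul h₁ h₂ (by positivity) (Nat.cast_nonneg _)
        _ = _ := by ring
  set e := I.edges.length * (Nat.log 2 n + 1) ^ 3 with he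
  have hc' : c ≤ (N + 2) * (260 + 2 * K) * (T ^ 2 * s.t * (n * T + n * s.l + e)) := by
    refine hc.trans ?_
    have h₁ : n ≤ n * T := Nat.le_mul_of_pos_right _ hT
    have h₂ : 60 * (n * T) ≤ s.t * (60 * (n * T)) := Nat.le_mul_of_pos_left _ ht
    have h₃ : GraphDPD.searchBound n T s.l s.t (K * (n + e)) + 60 * (n * T) ≤
        (260 + 2 * K) * (s.t * (n * T + n * s.l + e)) := by
      unfold GraphDPD.searchBound
      calc _ ≤ s.t * (200 * (n * T) + 24 * (n * s.l) + 2 * (K * (n + e))) +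
            s.t * (60 * (n * T)) := Nat.add_le_add_left h₂ _
        _ = s.t * (260 * (n * T) + 24 * (n * s.l) + 2 * (K * (n + e))) := by ring
        _ ≤ s.t * ((260 + 2 * K) * (n * T + n * s.l + e)) := by
          refine Nat.mul_le_mul_left _ ?_
          have h₄ : K * (n + e) ≤ K * (n * T + n * s.l + e) := Nat.mul_le_mul_left _ (by omega)
          rw [add_mul, mul_assoc 2 K]
          omega
        _ = _ := by ring
    calc _ ≤ (N + 2) * ((260 + 2 * K) * (s.t * (n * T + n * s.l + e))) * T ^ 2 :=
          Nat.mul_le_mul_right _ (Nat.mul_le_mul_left _ h₃)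
      _ = _ := by ring
  have hcR : (c : ℝ) ≤ (N + 2) * (260 + 2 * K) * (T ^ 2 * s.t * (n * T + n * s.l + e)) := by
    exact_mod_cast hc'
  refine hcR.trans ?_
  have heR : (e : ℝ) ≤ 27 * (I.graph.edgeSet.ncard * Real.log n ^ 3) := by
    rw [he]
    push_cast at hE ⊢
    exact hE
  have h₅ : (n * T + n * s.l + e : ℝ) ≤
      27 * (n * T + n * s.l + I.graph.edgeSet.ncard * Real.log n ^ 3) := by
    have : (0 : ℝ) ≤ n * T := by positivity
    have : (0 : ℝ) ≤ n * s.l := by positivity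
    linarith
  calc _ ≤ ((N : ℝ) + 2) * (260 + 2 * K) * (T ^ 2 * s.t *
        (27 * (n * T + n * s.l + I.graph.edgeSet.ncard * Real.log n ^ 3))) := by gcongr
    _ = _ := by ring
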